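/- Let $E$ be the elliptic curve $y^2 = x^3 - x$ over $\mathbb{Q}$. For an odd prime $p$ (the odd primes are exactly the primes of good reduction for $E$) let $\#E(\mathbb{F}_p)$ denote the number of $\mathbb{F}_p$-rational points, including the point at infinity, of the reduction of $E$ modulo $p$. Let $\omega(n)$ denote the number of distinct prime factors of $n$, let $\log$ be the natural logarithm, and write $\log_2 x = \log\log x$. For every real $\gamma > 1$ there is a constant $C > 0$, depending only on $\gamma$, such that for all real $x \ge 3$ $$\#\{p \le x : p \text{ an odd prime},\ \omega(\#E(\mathbb{F}_p)) > \gamma \log_2 x\} \le C\,\frac{x(\log_2 x)^5}{(\log x)^{2+\gamma\log\gamma-\gamma}}.$$ Likewise, for every real $\gamma$ with $0 < \gamma < 1$ there is a constant $C > 0$, depending only on $\gamma$, such that for all real $x \ge 3$ $$\#\{p \le x : p \text{ an odd prime},\ \omega(\#E(\mathbb{F}_p)) < \gamma \log_2 x\} \le C\,\frac{x(\log_2 x)^5}{(\log x)^{2+\gamma\log\gamma-\gamma}}.$$ -/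

import Mathlib

/-- The integral Weierstrass model `y² = x³ - x` of the elliptic curve `E` over `ℚ`
(it has discriminant `2⁶`, hence it is a global minimal model). -/
def curveE : WeierstrassCurve ℤ :=
  { a₁ := 0, a₂ := 0, a₃ := 0, a₄ := -1, a₆ := 0 }

/-- The reduction of `E : y² = x³ - x` modulo `p`, as a Weierstrass curve over `ℤ/pℤ`. -/
def curveEMod (p : ℕ) : WeierstrassCurve (ZMod p) :=
  curveE.map (Int.castRingHom (ZMod p))

/-- `p` is a prime of good reduction for `E`: the reduction modulo `p` of the minimal model
is again an elliptic curve, that is, its discriminant is invertible. -/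
def GoodPrime (p : ℕ) : Prop :=
  p.Prime ∧ (curveEMod p).IsElliptic

/-- `#E(𝔽_p)`: the number of `𝔽_p`-rational points, the point at infinity included, of the
reduction of `E` modulo `p`. -/
noncomputable def numPoints (p : ℕ) : ℕ :=
  Nat.card (WeierstrassCurve.Affine.Point (curveEMod p).toAffine)

/-- The good primes of `E` are exactly the odd primes. -/
theorem goodPrime_iff (p : ℕ) : GoodPrime p ↔ p.Prime ∧ p ≠ 2 := by
  refine and_congr_right fun hp => ?_
  have : Fact p.Prime := ⟨hp⟩
  have hΔ : (curveEMod p).Δ = ((2 ^ 6 : ℕ) : ZMod p) := by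
    simp [curveEMod, curveE, WeierstrassCurve.Δ, WeierstrassCurve.b₂, WeierstrassCurve.b₄,
      WeierstrassCurve.b₆, WeierstrassCurve.b₈]
    norm_num
  rw [WeierstrassCurve.isElliptic_iff, hΔ, isUnit_iff_ne_zero, Ne, ZMod.natCast_eq_zero_iff]
  refine not_congr ⟨fun h => ?_, fun h => ?_⟩
  · exact (Nat.prime_dvd_prime_iff_eq hp Nat.prime_two).1 (hp.dvd_of_dvd_pow h)
  · subst h
    norm_num

/-! The curve has complex multiplication by ℤ[i], which makes the point count explicit: it is p + 1
for p ≡ 3 mod 4, and N(π - 1) with N(π) = p for p ≡ 1 mod 4. The problem thus concerns shifted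
primes, p + 1 in ℕ and π - 1 in ℤ[i], whose norm has an atypical number of prime factors.

Write L = log log x. A Rankin weight handles both tails at once: whether γ > 1 and ω > γL, or γ < 1
and ω < γL, one has 1 ≤ γ^(ω - γL), and γ^(-γL) = (log x)^(-γ log γ). Apart from p ≤ √x and shifted
primes of smooth norm, both negligible, the shifted prime factors as αβ, where β has norm q or q²
for a prime q > y = exp(log x / (C L)). For fixed α, neither β nor the prime recovered from αβ (am -
1 in ℕ, αβ + 1 in ℤ[i]) has norm divisible by a prime up to y, so a sieve of dimension two bounds
the number of β by x/N(α) · L⁴/(log x)² times a factor depending on the primes dividing N(α). The L⁴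
is the price of Brun's pure sieve, which only sieves up to exp(log x / (120 C L²)). Summing
γ^ω(N(α))/N(α) by an Euler product and Mertens' theorem gives (log x)^γ, and the three powers of log
x combine to the stated exponent.

Both congruence classes go through `exists_card_le_of_sieve`, stated for a commutative monoid with a
norm to ℕ. The arithmetic input is a function c on primes with ∑ c(p)/p = log log x + O(1): c = 1
for ℕ and c = 1 + χ₄ for ℤ[i]. The other main lemmas are `numPoints_of_mod_four_eq_one` (via
Jacobsthal sums), `exists_sum_arithWeight_le`, `exists_sum_smooth_arithWeight_le` and
`exists_card_sieved_box_le`. The method yields L⁴ for large x; the fifth power in the theorem is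
weaker. -/

/-! ### Jacobsthal sums over a finite field -/

section CharacterSums

variable {F : Type*} [Field F] [Fintype F] [DecidableEq F]

/-- For a ≠ b the substitution t = (a - k)/(a - b) turns the sum into χ(-1) times the Jacobi sum
J(χ, χ⁻¹) = -χ(-1). -/
theorem sum_quadraticChar_sub_mul_sub (hF : ringChar F ≠ 2) (a b : F) :
    ∑ k : F, quadraticChar F (a - k) * quadraticChar F (b - k)
      = (if a = b then (Fintype.card F : ℤ) else 0) - 1 := by
  have hq := quadraticChar_isQuadratic F
  split_ifs with h
  · subst h
    have h1 : ∀ k : F, quadraticChar F (a - k) * quadraticChar F (a - k)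
        = 1 - if k = a then 1 else 0 := by
      intro k
      split_ifs with hk
      · simp [hk]
      · rw [← pow_two, quadraticChar_sq_one (sub_ne_zero.2 (Ne.symm hk))]; simp
    simp only [h1, Finset.sum_sub_distrib, Finset.sum_ite_eq', Finset.mem_univ, if_true,
      Finset.sum_const, Finset.card_univ, nsmul_eq_mul, mul_one]
  · have hab : a - b ≠ 0 := sub_ne_zero.2 h
    have hJ := jacobiSum_nontrivial_inv (quadraticChar_ne_one hF)
    rw [hq.inv, jacobiSum] at hJ
    have hm1 : quadraticChar F (-1) ^ 2 = 1 := quadraticChar_sq_one (by simp)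
    have key : ∑ k : F, quadraticChar F (a - k) * quadraticChar F (b - k)
        = ∑ t : F, quadraticChar F (-1) * (quadraticChar F t * quadraticChar F (1 - t)) := by
      refine Fintype.sum_equiv ((Equiv.subLeft a).trans (Equiv.divRight₀ (a - b) hab)) _ _ ?_
      intro k
      simp only [Equiv.trans_apply, Equiv.subLeft_apply, Equiv.divRight₀_apply]
      have e1 : a - k = (a - b) * ((a - k) / (a - b)) := by field_simp
      have e2 : b - k = (-1) * (a - b) * (1 - (a - k) / (a - b)) := by field_simp; ring
      generalize (a - k) / (a - b) = t at e1 e2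
      rw [e1, e2]
      simp only [map_mul]
      have := quadraticChar_sq_one hab
      linear_combination (quadraticChar F t * quadraticChar F (-1) *
        quadraticChar F (1 - t)) * this
    rw [key, ← Finset.mul_sum, hJ]
    linear_combination -hm1

/-- Jacobsthal's character sum. -/
def jacobsthalSum (F : Type*) [Field F] [Fintype F] [DecidableEq F] (k : F) : ℤ :=
  ∑ x : F, quadraticChar F x * quadraticChar F (x ^ 2 - k)

/-- After expanding the square and summing over k first, only the pairs with x² = y² survive. Since
χ(-1) = 1, both y = x and y = -x contribute +1 for x ≠ 0. -/
theorem sum_jacobsthalSum_sq (hF : ringChar F ≠ 2) (h1 : quadraticChar F (-1) = 1) :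
    ∑ k : F, jacobsthalSum F k ^ 2
      = 2 * (Fintype.card F : ℤ) * ((Fintype.card F : ℤ) - 1) := by
  have hinner : ∀ x : F, ∑ y : F, quadraticChar F x * quadraticChar F y *
      (if x ^ 2 = y ^ 2 then (Fintype.card F : ℤ) else 0)
      = if x = 0 then 0 else 2 * (Fintype.card F : ℤ) := by
    intro x
    split_ifs with hx
    · simp [hx]
    · have hne : x ≠ -x := by
        intro h
        have h2 : (2 : F) * x = 0 := by linear_combination h
        rcases mul_eq_zero.1 h2 with h2 | h2
        · exact Ring.two_ne_zero hF h2
        · exact hx h2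
      have hsub : ∀ y : F, quadraticChar F x * quadraticChar F y *
          (if x ^ 2 = y ^ 2 then (Fintype.card F : ℤ) else 0)
          = if y ∈ ({x, -x} : Finset F) then (Fintype.card F : ℤ) else 0 := by
        intro y
        have hiff : x ^ 2 = y ^ 2 ↔ y ∈ ({x, -x} : Finset F) := by
          rw [sq_eq_sq_iff_eq_or_eq_neg]
          simp only [Finset.mem_insert, Finset.mem_singleton]
          constructor
          · rintro (h | h)
            · exact Or.inl h.symm
            · right; rw [h]; ring
          · rintro (h | h)
            · exact Or.inl h.symm
            · right; rw [h]; ring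
        by_cases hy : y ∈ ({x, -x} : Finset F)
        · rw [if_pos (hiff.2 hy), if_pos hy]
          have hxx := quadraticChar_sq_one hx
          simp only [Finset.mem_insert, Finset.mem_singleton] at hy
          rcases hy with rfl | rfl
          · rw [← pow_two, hxx, one_mul]
          · rw [neg_eq_neg_one_mul x, map_mul, h1, one_mul, ← pow_two, hxx, one_mul]
        · rw [if_neg (fun h => hy (hiff.1 h)), if_neg hy, mul_zero]
      rw [Finset.sum_congr rfl (fun y _ => hsub y), Finset.sum_ite_mem, Finset.univ_inter,
        Finset.sum_const, Finset.card_pair hne]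
      simp
  have h0 := quadraticChar_sum_zero hF
  calc ∑ k : F, jacobsthalSum F k ^ 2
      = ∑ k : F, ∑ x : F, ∑ y : F, quadraticChar F x * quadraticChar F y *
          (quadraticChar F (x ^ 2 - k) * quadraticChar F (y ^ 2 - k)) := by
        refine Finset.sum_congr rfl fun k _ => ?_
        rw [jacobsthalSum, pow_two, Finset.sum_mul_sum]
        exact Finset.sum_congr rfl fun x _ => Finset.sum_congr rfl fun y _ => by ring
    _ = ∑ x : F, ∑ y : F, quadraticChar F x * quadraticChar F y *
          ((if x ^ 2 = y ^ 2 then (Fintype.card F : ℤ) else 0) - 1) := by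
        rw [Finset.sum_comm]
        refine Finset.sum_congr rfl fun x _ => ?_
        rw [Finset.sum_comm]
        refine Finset.sum_congr rfl fun y _ => ?_
        rw [← Finset.mul_sum, sum_quadraticChar_sub_mul_sub hF]
    _ = ∑ x : F, (if x = 0 then 0 else 2 * (Fintype.card F : ℤ)) := by
        refine Finset.sum_congr rfl fun x _ => ?_
        rw [← hinner x]
        simp only [mul_sub, Finset.sum_sub_distrib, mul_one]
        rw [← Finset.mul_sum, h0, mul_zero, sub_zero]
    _ = _ := by
        have : ∀ x : F, (if x = 0 then 0 else 2 * (Fintype.card F : ℤ))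
          = 2 * (Fintype.card F : ℤ) - if x = 0 then 2 * (Fintype.card F : ℤ) else 0 := by
          intro x; split_ifs <;> simp
        simp only [this, Finset.sum_sub_distrib, Finset.sum_ite_eq', Finset.mem_univ, if_true,
          Finset.sum_const, Finset.card_univ, nsmul_eq_mul]
        ring

theorem jacobsthalSum_mul_sq (k t : F) (ht : t ≠ 0) :
    jacobsthalSum F (k * t ^ 2) = quadraticChar F t * jacobsthalSum F k := by
  rw [jacobsthalSum, jacobsthalSum, Finset.mul_sum]
  symm
  refine Fintype.sum_equiv (Equiv.mulLeft₀ t ht) _ _ fun x => ?_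
  simp only [Equiv.mulLeft₀_apply]
  have : (t * x) ^ 2 - k * t ^ 2 = t ^ 2 * (x ^ 2 - k) := by ring
  rw [this, map_mul, map_mul, quadraticChar_sq_one' ht]
  ring

theorem jacobsthalSum_zero (hF : ringChar F ≠ 2) : jacobsthalSum F 0 = 0 := by
  rw [jacobsthalSum, ← quadraticChar_sum_zero hF]
  refine Finset.sum_congr rfl fun x _ => ?_
  by_cases hx : x = 0
  · simp [hx]
  · rw [sub_zero, quadraticChar_sq_one' hx, mul_one]

/-- The terms at x and -x agree because χ(-1) = 1, and the fixed point x = 0 contributes 0. -/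
theorem even_jacobsthalSum (hF : ringChar F ≠ 2) (h1 : quadraticChar F (-1) = 1) (k : F) :
    (2 : ℤ) ∣ jacobsthalSum F k := by
  have : ((jacobsthalSum F k : ℤ) : ZMod 2) = 0 := by
    rw [jacobsthalSum, Int.cast_sum]
    refine Finset.sum_involution (fun x _ => -x) ?_ ?_ (fun _ _ => Finset.mem_univ _)
      (fun x _ => neg_neg x)
    · intro x _
      rw [neg_sq, neg_eq_neg_one_mul x, map_mul, h1, one_mul]
      exact CharTwo.add_self_eq_zero _
    · intro x _ hne hx
      have h2 : (2 : F) * x = 0 := by linear_combination -hx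
      rcases mul_eq_zero.1 h2 with h2 | h2
      · exact Ring.two_ne_zero hF h2
      · simp [h2] at hne
  exact_mod_cast (ZMod.intCast_zmod_eq_zero_iff_dvd _ 2).1 this

/-- On nonzero k the square of the Jacobsthal sum depends only on the square class of k, so it takes
just two values; the second moment then determines their sum. -/
theorem exists_jacobsthalSum_sq_add_sq (hF : ringChar F ≠ 2) (h1 : quadraticChar F (-1) = 1) :
    ∃ n : F, jacobsthalSum F 1 ^ 2 + jacobsthalSum F n ^ 2 = 4 * (Fintype.card F : ℤ) := by
  obtain ⟨n, hn⟩ := quadraticChar_exists_neg_one hF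
  refine ⟨n, ?_⟩
  have hn0 : n ≠ 0 := by rintro rfl; simp at hn
  -- The factors 1 ± χ(k) select the square class. At k = 0 both equal 1 while the Jacobsthal sum
  -- vanishes, hence the correction term.
  have hk : ∀ k : F, 2 * jacobsthalSum F k ^ 2
      = jacobsthalSum F 1 ^ 2 * (1 + quadraticChar F k)
        + jacobsthalSum F n ^ 2 * (1 - quadraticChar F k)
        - if k = 0 then (jacobsthalSum F 1 ^ 2 + jacobsthalSum F n ^ 2) else 0 := by
    intro k
    by_cases hk0 : k = 0
    · simp [hk0, jacobsthalSum_zero hF]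
    · rw [if_neg hk0]
      rcases quadraticChar_dichotomy hk0 with h | h
      · obtain ⟨t, ht⟩ := (quadraticChar_one_iff_isSquare hk0).1 h
        have ht0 : t ≠ 0 := by rintro rfl; simp at ht; exact hk0 ht
        have := jacobsthalSum_mul_sq 1 t ht0
        rw [one_mul, pow_two, ← ht] at this
        rw [this, h, mul_pow, quadraticChar_sq_one ht0]; ring
      · have hkn : quadraticChar F (k / n) = 1 := by
          have : quadraticChar F (k / n) * quadraticChar F n = quadraticChar F k := by
            rw [← map_mul, div_mul_cancel₀ _ hn0]
          rw [hn, h] at this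
          linarith
        obtain ⟨t, ht⟩ := (quadraticChar_one_iff_isSquare (div_ne_zero hk0 hn0)).1 hkn
        have ht0 : t ≠ 0 := by
          rintro rfl
          simp at ht
          tauto
        have hkt : k = n * t ^ 2 := by rw [pow_two, ← ht]; field_simp
        have := jacobsthalSum_mul_sq n t ht0
        rw [← hkt] at this
        rw [this, h, mul_pow, quadraticChar_sq_one ht0]; ring
  have hsum := Finset.sum_congr (rfl : (Finset.univ : Finset F) = Finset.univ) (fun k _ => hk k)
  simp only [← Finset.mul_sum, sum_jacobsthalSum_sq hF h1, Finset.sum_sub_distrib,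
    Finset.sum_add_distrib, quadraticChar_sum_zero hF, Finset.sum_const, Finset.card_univ,
    Finset.sum_ite_eq', Finset.mem_univ, if_true, nsmul_eq_mul] at hsum
  have hc : (1 : ℤ) < Fintype.card F := by exact_mod_cast Fintype.one_lt_card
  have hc' : (Fintype.card F : ℤ) - 1 ≠ 0 := by omega
  apply mul_left_cancel₀ hc'
  linear_combination -hsum

end CharacterSums

/-! ### Point counts of the reductions -/

theorem numPoints_eq (p : ℕ) [Fact p.Prime] (hp : p ≠ 2) :
    (numPoints p : ℤ) = p + 1 + jacobsthalSum (ZMod p) 1 := by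
  have hgood : GoodPrime p := (goodPrime_iff p).2 ⟨Fact.out, hp⟩
  have hE : (curveEMod p).toAffine.IsElliptic := hgood.2
  have hF : ringChar (ZMod p) ≠ 2 := by rwa [ZMod.ringChar_zmod_n]
  have heq : ∀ x y : ZMod p, (curveEMod p).toAffine.Nonsingular x y ↔ y ^ 2 = x ^ 3 - x := by
    intro x y
    rw [← WeierstrassCurve.Affine.equation_iff_nonsingular, WeierstrassCurve.Affine.equation_iff]
    simp [curveEMod, curveE, sub_eq_add_neg]
  have e1 := Nat.card_congr (WeierstrassCurve.Affine.nonsingularPointEquiv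
    (W' := (curveEMod p).toAffine))
  have e2 : Nat.card {xy : ZMod p × ZMod p // (curveEMod p).toAffine.Nonsingular xy.1 xy.2}
      = ∑ x : ZMod p, {y : ZMod p | y ^ 2 = x ^ 3 - x}.toFinset.card := by
    simp only [heq]
    rw [Nat.card_eq_fintype_card, Fintype.card_subtype]
    rw [Finset.card_filter, Fintype.sum_prod_type]
    refine Finset.sum_congr rfl fun x _ => ?_
    rw [← Finset.card_filter]
    congr 1
    ext y; simp
  have e3 : numPoints p = Nat.card {xy : ZMod p × ZMod p //
      (curveEMod p).toAffine.Nonsingular xy.1 xy.2} + 1 := by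
    rw [numPoints, e1]
    exact Finite.card_option
  rw [e3, e2]
  push_cast
  simp only [quadraticChar_card_sqrts hF, Finset.sum_add_distrib, Finset.sum_const,
    Finset.card_univ, ZMod.card, nsmul_eq_mul, mul_one, jacobsthalSum, ← map_mul]
  have : ∀ x : ZMod p, x ^ 3 - x = x * (x ^ 2 - 1) := fun x => by ring
  simp only [this]
  ring

/-- Here χ(-1) = -1, so x ↦ -x shows that the Jacobsthal sum equals its own negative. -/
theorem numPoints_of_mod_four_eq_three (p : ℕ) (hp : p.Prime) (h : p % 4 = 3) :
    numPoints p = p + 1 := by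
  have := Fact.mk hp
  have hp2 : p ≠ 2 := by omega
  have hF : ringChar (ZMod p) ≠ 2 := by rwa [ZMod.ringChar_zmod_n]
  have h1 : quadraticChar (ZMod p) (-1) = -1 := by
    rw [quadraticChar_neg_one_iff_not_isSquare, FiniteField.isSquare_neg_one_iff, ZMod.card]
    simpa using h
  have hS : jacobsthalSum (ZMod p) 1 = - jacobsthalSum (ZMod p) 1 := by
    rw [jacobsthalSum, ← Finset.sum_neg_distrib]
    refine Fintype.sum_equiv (Equiv.neg (ZMod p)) _ _ fun x => ?_
    rw [Equiv.neg_apply, neg_sq, neg_eq_neg_one_mul x, map_mul, h1]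
    ring
  have := numPoints_eq p hp2
  omega

/-- Halving the two even Jacobsthal sums of `exists_jacobsthalSum_sq_add_sq` gives p = a² + b², and
then p + 1 + 2a = (a + 1)² + b²; the sign of a is flipped at the end. -/
theorem numPoints_of_mod_four_eq_one (p : ℕ) (hp : p.Prime) (h : p % 4 = 1) :
    ∃ a b : ℤ, a ^ 2 + b ^ 2 = p ∧ (numPoints p : ℤ) = (a - 1) ^ 2 + b ^ 2 := by
  have := Fact.mk hp
  have hp2 : p ≠ 2 := by omega
  have hF : ringChar (ZMod p) ≠ 2 := by rwa [ZMod.ringChar_zmod_n]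
  have h1 : quadraticChar (ZMod p) (-1) = 1 := by
    rw [quadraticChar_one_iff_isSquare (by simp), FiniteField.isSquare_neg_one_iff, ZMod.card]
    omega
  obtain ⟨n, hn⟩ := exists_jacobsthalSum_sq_add_sq hF h1
  obtain ⟨a, ha⟩ := even_jacobsthalSum hF h1 1
  obtain ⟨b, hb⟩ := even_jacobsthalSum hF h1 n
  rw [ha, hb, ZMod.card] at hn
  have e := numPoints_eq p hp2
  rw [ha] at e
  have hab : a ^ 2 + b ^ 2 = p := by linarith
  refine ⟨-a, b, by linarith, ?_⟩
  linear_combination e - hab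

/-! ### Mertens' first theorem, plain and twisted by χ₄ -/

section Mertens

/-- Abel summation for a nonnegative nonincreasing weight. The induction carries the boundary term
so that the error telescopes. -/
theorem abs_sum_Ioc_mul_le (f b : ℕ → ℝ) (m : ℕ) (C : ℝ)
    (hb : ∀ i, m < i → b (i + 1) ≤ b i) (hb0 : ∀ i, m < i → 0 ≤ b i)
    (hC : ∀ n, |∑ i ∈ Finset.Ioc m n, f i| ≤ C) (n : ℕ) :
    |∑ i ∈ Finset.Ioc m n, f i * b i| ≤ C * b (m + 1) := by
  have hC0 : 0 ≤ C := (abs_nonneg _).trans (hC 0)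
  rcases le_or_gt n m with h | h
  · rw [Finset.Ioc_eq_empty (by omega)]
    simpa using mul_nonneg hC0 (hb0 (m + 1) (by omega))
  have key : ∀ k, |∑ i ∈ Finset.Ioc m (m + k), f i * b i
      - (∑ i ∈ Finset.Ioc m (m + k), f i) * b (m + k + 1)| ≤ C * (b (m + 1) - b (m + k + 1)) := by
    intro k
    induction k with
    | zero => simp
    | succ k ih =>
      rw [← add_assoc, Finset.sum_Ioc_succ_top (by omega), Finset.sum_Ioc_succ_top (by omega)]
      set F := ∑ i ∈ Finset.Ioc m (m + k), f i
      have h1 := hC (m + k + 1)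
      rw [Finset.sum_Ioc_succ_top (by omega)] at h1
      have h2 : 0 ≤ b (m + k + 1) - b (m + k + 1 + 1) := sub_nonneg.2 (hb _ (by omega))
      have h3 : |(F + f (m + k + 1)) * (b (m + k + 1) - b (m + k + 1 + 1))|
          ≤ C * (b (m + k + 1) - b (m + k + 1 + 1)) := by
        rw [abs_mul, abs_of_nonneg h2]; exact mul_le_mul_of_nonneg_right h1 h2
      calc _ = |(∑ i ∈ Finset.Ioc m (m + k), f i * b i - F * b (m + k + 1))
            + (F + f (m + k + 1)) * (b (m + k + 1) - b (m + k + 1 + 1))| := by congr 1; ring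
        _ ≤ _ := (abs_add_le _ _).trans (by linarith)
  obtain ⟨k, rfl⟩ := Nat.exists_eq_add_of_lt h
  have h1 := key (k + 1)
  have h2 : |(∑ i ∈ Finset.Ioc m (m + (k + 1)), f i) * b (m + (k + 1) + 1)|
      ≤ C * b (m + (k + 1) + 1) := by
    have hb' := hb0 (m + (k + 1) + 1) (by omega)
    rw [abs_mul, abs_of_nonneg hb']; exact mul_le_mul_of_nonneg_right (hC _) hb'
  rw [add_assoc]
  rw [abs_le] at *
  constructor <;> linarith [h1.1, h1.2, h2.1, h2.2]

-- Compare log N! = ∑ Λ(n)⌊N/n⌋ with N log N + O(N); Chebyshev's bound on ψ pays for removing the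
-- floors.
open ArithmeticFunction in
theorem exists_abs_sum_vonMangoldt_div_sub_log_le :
    ∃ K : ℝ, ∀ N : ℕ, |∑ n ∈ Finset.Ioc 0 N, vonMangoldt n / n - Real.log N| ≤ K := by
  refine ⟨Real.log 4 + 4 + 1, fun N => ?_⟩
  have hl4 : 0 ≤ Real.log 4 := Real.log_nonneg (by norm_num)
  rcases Nat.eq_zero_or_pos N with rfl | hN
  · simp; positivity
  have hN' : (0 : ℝ) < N := by exact_mod_cast hN
  have e1 : ∑ n ∈ Finset.Ioc 0 N, vonMangoldt n * ((N / n : ℕ) : ℝ) = Real.log (N.factorial) := by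
    have := sum_Ioc_mul_zeta_eq_sum vonMangoldt N
    rw [← this, vonMangoldt_mul_zeta]
    rw [← Finset.prod_range_add_one_eq_factorial, Nat.cast_prod, Real.log_prod]
    · rw [Finset.range_eq_Ico, Finset.sum_Ico_add' (fun x : ℕ => Real.log (x : ℕ)) 0 N 1]
      apply Finset.sum_congr
      · ext; simp; omega
      · intros; rfl
    · intros; positivity
  have h1 : Real.log N.factorial ≤ N * Real.log N := by
    rw [← Real.log_pow]
    apply Real.log_le_log (by positivity)
    exact_mod_cast Nat.factorial_le_pow N
  have h2 : N * Real.log N - N ≤ Real.log N.factorial := by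
    have := Real.pow_div_factorial_le_exp (x := (N : ℝ)) hN'.le N
    have h3 := Real.log_le_log (by positivity) this
    rw [Real.log_exp, Real.log_div (by positivity) (by positivity), Real.log_pow] at h3
    linarith
  have hψ : ∑ n ∈ Finset.Ioc 0 N, vonMangoldt n ≤ (Real.log 4 + 4) * N := by
    have := Chebyshev.psi_le_const_mul_self hN'.le
    rwa [Chebyshev.psi, Nat.floor_natCast] at this
  have h4 : ∑ n ∈ Finset.Ioc 0 N, vonMangoldt n * ((N / n : ℕ) : ℝ)
      ≤ N * ∑ n ∈ Finset.Ioc 0 N, vonMangoldt n / n := by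
    rw [Finset.mul_sum]
    refine Finset.sum_le_sum fun n _ => ?_
    calc _ ≤ vonMangoldt n * ((N : ℝ) / n) :=
          mul_le_mul_of_nonneg_left Nat.cast_div_le vonMangoldt_nonneg
      _ = _ := by ring
  have h5 : N * ∑ n ∈ Finset.Ioc 0 N, vonMangoldt n / n
      ≤ ∑ n ∈ Finset.Ioc 0 N, vonMangoldt n * ((N / n : ℕ) : ℝ)
        + ∑ n ∈ Finset.Ioc 0 N, vonMangoldt n := by
    rw [Finset.mul_sum, ← Finset.sum_add_distrib]
    refine Finset.sum_le_sum fun n hn => ?_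
    have hn0 : 0 < n := (Finset.mem_Ioc.1 hn).1
    have : (N : ℝ) / n ≤ ((N / n : ℕ) : ℝ) + 1 := by
      rw [div_le_iff₀ (by exact_mod_cast hn0)]
      have h := Nat.lt_div_mul_add (a := N) hn0
      exact_mod_cast (by linarith : N ≤ (N / n + 1) * n)
    calc _ = vonMangoldt n * ((N : ℝ) / n) := by ring
      _ ≤ vonMangoldt n * (((N / n : ℕ) : ℝ) + 1) :=
        mul_le_mul_of_nonneg_left this vonMangoldt_nonneg
      _ = _ := by ring
  rw [e1] at h4 h5
  set S := ∑ n ∈ Finset.Ioc 0 N, vonMangoldt n / n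
  rw [abs_le]
  constructor
  · have : N * (Real.log N - 1) ≤ N * S := by linarith
    have := le_of_mul_le_mul_left this hN'
    linarith
  · have : N * S ≤ N * (Real.log N + (Real.log 4 + 4)) := by linarith
    have := le_of_mul_le_mul_left this hN'
    linarith

theorem sum_Ioc_zero_chi_four (n : ℕ) :
    ∑ k ∈ Finset.Ioc 0 n, ((ZMod.χ₄ k : ℤ) : ℝ) = if n % 4 = 1 ∨ n % 4 = 2 then 1 else 0 := by
  induction n with
  | zero => simp
  | succ n ih =>
    rw [Finset.sum_Ioc_succ_top (by omega), ih, ZMod.χ₄_nat_eq_if_mod_four]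
    have h : n % 4 = 0 ∨ n % 4 = 1 ∨ n % 4 = 2 ∨ n % 4 = 3 := by omega
    rcases h with h | h | h | h
    · have h1 : (n + 1) % 2 = 1 := by omega
      have h2 : (n + 1) % 4 = 1 := by omega
      simp [h, h1, h2]
    · have h1 : (n + 1) % 2 = 0 := by omega
      have h2 : (n + 1) % 4 = 2 := by omega
      simp [h, h1, h2]
    · have h1 : (n + 1) % 2 = 1 := by omega
      have h2 : (n + 1) % 4 = 3 := by omega
      simp [h, h1, h2]
    · have h1 : (n + 1) % 2 = 0 := by omega
      have h2 : (n + 1) % 4 = 0 := by omega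
      simp [h, h1, h2]

theorem abs_sum_Ioc_chi_four_le (m n : ℕ) :
    |∑ k ∈ Finset.Ioc m n, ((ZMod.χ₄ k : ℤ) : ℝ)| ≤ 1 := by
  rcases le_or_gt m n with h | h
  · have := Finset.sum_Ioc_consecutive (fun k : ℕ => ((ZMod.χ₄ k : ℤ) : ℝ)) (Nat.zero_le m) h
    rw [sum_Ioc_zero_chi_four, sum_Ioc_zero_chi_four] at this
    rw [← eq_sub_iff_add_eq'] at this
    rw [this]
    split_ifs <;> norm_num
  · rw [Finset.Ioc_eq_empty (by omega)]; simp

theorem abs_chi_four_le_one (n : ℕ) : |((ZMod.χ₄ n : ℤ) : ℝ)| ≤ 1 := by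
  rw [ZMod.χ₄_nat_eq_if_mod_four]
  split_ifs <;> simp

theorem abs_sum_Ioc_chi_four_div_le (m n : ℕ) :
    |∑ k ∈ Finset.Ioc m n, ((ZMod.χ₄ k : ℤ) : ℝ) / k| ≤ 1 / (m + 1) := by
  have := abs_sum_Ioc_mul_le (fun k : ℕ => ((ZMod.χ₄ k : ℤ) : ℝ)) (fun k => 1 / (k : ℝ)) m 1
    (fun i hi => one_div_le_one_div_of_le (by exact_mod_cast (by omega)) (by push_cast; linarith))
    (fun i _ => by positivity) (abs_sum_Ioc_chi_four_le m) n
  simpa [div_eq_mul_inv] using this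

theorem exists_abs_sum_chi_four_mul_log_div_le :
    ∃ K : ℝ, ∀ N : ℕ, |∑ k ∈ Finset.Ioc 0 N, ((ZMod.χ₄ k : ℤ) : ℝ) * (Real.log k / k)| ≤ K := by
  refine ⟨1 * (Real.log (2 + 1 : ℕ) / (2 + 1 : ℕ)), fun N => ?_⟩
  -- The weight log k / k decreases only from e onwards, so the terms k = 1, 2 are split off; both
  -- vanish, as log 1 = 0 and χ₄(2) = 0.
  have h := abs_sum_Ioc_mul_le (fun k : ℕ => ((ZMod.χ₄ k : ℤ) : ℝ))
    (fun k => Real.log k / (k : ℝ)) 2 1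
    (fun i hi => Real.log_div_self_antitoneOn
      (by
        have : (3 : ℝ) ≤ i := by exact_mod_cast hi
        show Real.exp 1 ≤ i
        linarith [Real.exp_one_lt_three])
      (by
        have : (3 : ℝ) ≤ i := by exact_mod_cast hi
        show Real.exp 1 ≤ ((i + 1 : ℕ) : ℝ)
        push_cast
        linarith [Real.exp_one_lt_three]) (by push_cast; linarith))
    (fun i _ => div_nonneg (Real.log_natCast_nonneg i) (Nat.cast_nonneg i))
    (abs_sum_Ioc_chi_four_le 2) N
  have h2 : ∑ k ∈ (Finset.Ioc 0 2 : Finset ℕ), ((ZMod.χ₄ k : ℤ) : ℝ) * (Real.log k / k) = 0 := by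
    rw [show (Finset.Ioc 0 2 : Finset ℕ) = {1, 2} by rfl]
    simp
  rcases le_or_gt 2 N with hN | hN
  · rw [← Finset.sum_Ioc_consecutive _ (Nat.zero_le 2) hN, h2, zero_add]
    exact h
  · rw [Finset.Ioc_eq_empty (by omega)] at h
    have : ∑ k ∈ Finset.Ioc 0 N, ((ZMod.χ₄ k : ℤ) : ℝ) * (Real.log k / k) = 0 := by
      interval_cases N
      · simp
      · simp
    rw [this]
    simpa using h

-- With T the partial sums of χ₄(k)/k, the identity log = Λ * 1 gives ∑ χ₄(n)Λ(n)/n · T(N/n) = ∑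
-- χ₄(n) log n / n = O(1). Replacing T(N/n) by T(N) costs at most n/N per term, which Chebyshev
-- absorbs. One may then divide by T(N), since it is bounded away from 0.
open ArithmeticFunction in
theorem exists_abs_sum_chi_four_mul_vonMangoldt_div_le :
    ∃ K : ℝ, ∀ N : ℕ,
      |∑ n ∈ Finset.Ioc 0 N, ((ZMod.χ₄ n : ℤ) : ℝ) * (vonMangoldt n / n)| ≤ K := by
  obtain ⟨K, hK⟩ := exists_abs_sum_chi_four_mul_log_div_le
  refine ⟨2 * (K + (Real.log 4 + 4)), fun N => ?_⟩
  have hl4 : 0 ≤ Real.log 4 := Real.log_nonneg (by norm_num)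
  have hK0 : 0 ≤ K := (abs_nonneg _).trans (hK 0)
  rcases Nat.eq_zero_or_pos N with rfl | hN
  · simp; positivity
  have hN' : (0 : ℝ) < N := by exact_mod_cast hN
  set T : ℕ → ℝ := fun n => ∑ k ∈ Finset.Ioc 0 n, ((ZMod.χ₄ k : ℤ) : ℝ) / k with hT
  -- The first term is 1 and the rest is at most 1/2 in absolute value: this is L(1, χ₄) ≠ 0 in
  -- elementary form.
  have hTN : 1 / 2 ≤ T N := by
    have h1 := abs_sum_Ioc_chi_four_div_le 1 N
    rw [hT]
    dsimp only
    rw [← Finset.sum_Ioc_consecutive _ (Nat.zero_le 1) hN]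
    rw [abs_le] at h1
    norm_num at h1 ⊢
    linarith [h1.1]
  let f : ArithmeticFunction ℝ := ⟨fun n => ((ZMod.χ₄ n : ℤ) : ℝ) * (vonMangoldt n / n), by simp⟩
  let g : ArithmeticFunction ℝ := ⟨fun n => ((ZMod.χ₄ n : ℤ) : ℝ) / n, by simp⟩
  have hfg : ∀ n, (f * g) n = ((ZMod.χ₄ n : ℤ) : ℝ) * (Real.log n / n) := by
    intro n
    rw [mul_apply, ← vonMangoldt_sum, Nat.sum_divisorsAntidiagonal (fun d e => f d * g e),
      Finset.sum_div, Finset.mul_sum]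
    refine Finset.sum_congr rfl fun d hd => ?_
    obtain ⟨e, rfl⟩ := Nat.dvd_of_mem_divisors hd
    have hne := (Nat.mem_divisors.1 hd).2
    have hd0 : d ≠ 0 := left_ne_zero_of_mul hne
    have he0 : e ≠ 0 := right_ne_zero_of_mul hne
    simp only [Nat.mul_div_cancel_left e (Nat.pos_of_ne_zero hd0)]
    change ((ZMod.χ₄ d : ℤ) : ℝ) * (vonMangoldt d / d) * (((ZMod.χ₄ e : ℤ) : ℝ) / e) = _
    push_cast
    rw [map_mul]
    push_cast
    have : (d : ℝ) ≠ 0 := by exact_mod_cast hd0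
    have : (e : ℝ) ≠ 0 := by exact_mod_cast he0
    field_simp
  have hsum := sum_Ioc_mul_eq_sum_sum f g N
  simp only [hfg] at hsum
  have hdiff : ∀ n ∈ Finset.Ioc 0 N, |f n * (T N - T (N / n))| ≤ vonMangoldt n / N := by
    intro n hn
    obtain ⟨hn0, hnN⟩ := Finset.mem_Ioc.1 hn
    have hn' : (0 : ℝ) < n := by exact_mod_cast hn0
    have e : T N - T (N / n) = ∑ k ∈ Finset.Ioc (N / n) N, ((ZMod.χ₄ k : ℤ) : ℝ) / k := by
      rw [sub_eq_iff_eq_add', hT]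
      exact (Finset.sum_Ioc_consecutive _ (Nat.zero_le _) (Nat.div_le_self _ _)).symm
    have h1 : |T N - T (N / n)| ≤ n / N := by
      rw [e]
      refine (abs_sum_Ioc_chi_four_div_le _ _).trans ?_
      rw [div_le_div_iff₀ (by positivity) hN', one_mul, mul_comm]
      have h := Nat.lt_div_mul_add (a := N) hn0
      exact_mod_cast (by linarith : N ≤ (N / n + 1) * n)
    have h2 : |f n| ≤ vonMangoldt n / n := by
      change |((ZMod.χ₄ n : ℤ) : ℝ) * (vonMangoldt n / n)| ≤ _
      have h0 : 0 ≤ vonMangoldt n / (n : ℝ) := div_nonneg vonMangoldt_nonneg hn'.le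
      rw [abs_mul, abs_of_nonneg h0]
      exact mul_le_of_le_one_left h0 (abs_chi_four_le_one n)
    rw [abs_mul]
    calc |f n| * |T N - T (N / n)| ≤ (vonMangoldt n / n) * (n / N) := by gcongr
      _ = _ := by field_simp
  have hψ : ∑ n ∈ Finset.Ioc 0 N, vonMangoldt n ≤ (Real.log 4 + 4) * N := by
    have := Chebyshev.psi_le_const_mul_self hN'.le
    rwa [Chebyshev.psi, Nat.floor_natCast] at this
  have h3 : |∑ n ∈ Finset.Ioc 0 N, f n * (T N - T (N / n))| ≤ Real.log 4 + 4 := by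
    refine (Finset.abs_sum_le_sum_abs _ _).trans ((Finset.sum_le_sum hdiff).trans ?_)
    rw [← Finset.sum_div, div_le_iff₀ hN']
    exact hψ
  have h4 : (∑ n ∈ Finset.Ioc 0 N, f n) * T N
      = ∑ n ∈ Finset.Ioc 0 N, f n * (T N - T (N / n))
        + ∑ k ∈ Finset.Ioc 0 N, ((ZMod.χ₄ k : ℤ) : ℝ) * (Real.log k / k) := by
    rw [hsum, ← Finset.sum_add_distrib, Finset.sum_mul]
    refine Finset.sum_congr rfl fun n _ => ?_
    change _ = _ + f n * T (N / n)
    ring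
  have h5 : |∑ n ∈ Finset.Ioc 0 N, f n| * T N ≤ K + (Real.log 4 + 4) := by
    rw [← abs_of_nonneg (by linarith : 0 ≤ T N), ← abs_mul, h4]
    exact (abs_add_le _ _).trans (by linarith [hK N])
  change |∑ n ∈ Finset.Ioc 0 N, f n| ≤ _
  nlinarith [abs_nonneg (∑ n ∈ Finset.Ioc 0 N, f n)]

end Mertens

/-! ### Mertens' second theorem for c = 1 and c = 1 + χ₄ -/

section MertensSecond

/-- A Riemann sum for ∫ du/u in the variable u = log n. With consecutive values u ≤ v, the error of
a step lies between 0 and (v - u)(1/u - 1/v) ≤ 1/u - 1/v, which telescopes. -/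
theorem abs_sum_log_sub_log_div_log_sub_log_log_le (n : ℕ) (hn : 2 ≤ n) :
    |∑ i ∈ Finset.Ioc 1 n, (Real.log i - Real.log (i - 1 : ℕ)) * (1 / Real.log i)
      - Real.log (Real.log n)| ≤ 1 - Real.log (Real.log 2) + 1 / Real.log 2 := by
  have hl2 : 0 < Real.log 2 := Real.log_pos (by norm_num)
  have hl2' : Real.log 2 < 1 := by linarith [Real.log_two_lt_d9]
  have hll2 : Real.log (Real.log 2) ≤ 0 := Real.log_nonpos hl2.le hl2'.le
  have key : 0 ≤ Real.log (Real.log n) - Real.log (Real.log 2)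
        + 1 - ∑ i ∈ Finset.Ioc 1 n, (Real.log i - Real.log (i - 1 : ℕ)) * (1 / Real.log i)
      ∧ Real.log (Real.log n) - Real.log (Real.log 2)
        + 1 - ∑ i ∈ Finset.Ioc 1 n, (Real.log i - Real.log (i - 1 : ℕ)) * (1 / Real.log i)
        ≤ 1 / Real.log 2 - 1 / Real.log n := by
    induction n, hn using Nat.le_induction with
    | base => simp [hl2.ne']
    | succ n hn ih =>
      rw [Finset.sum_Ioc_succ_top (by omega), Nat.add_sub_cancel]
      set u := Real.log n with hu
      set v := Real.log (n + 1 : ℕ) with hv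
      have hn' : (2 : ℝ) ≤ n := by exact_mod_cast hn
      have hu0 : 0 < u := Real.log_pos (by linarith)
      have huv : u ≤ v := Real.log_le_log (by linarith) (by push_cast; linarith)
      have hv0 : 0 < v := hu0.trans_le huv
      have hvu : v - u ≤ 1 := by
        rw [hv, hu, ← Real.log_div (by positivity) (by positivity)]
        have : ((n + 1 : ℕ) : ℝ) / n ≤ 2 := by
          rw [div_le_iff₀ (by linarith)]; push_cast; linarith
        exact (Real.log_le_log (by positivity) this).trans hl2'.le
      have h1 : (v - u) * (1 / v) ≤ Real.log v - Real.log u := by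
        have := Real.log_le_sub_one_of_pos (div_pos hu0 hv0)
        rw [Real.log_div hu0.ne' hv0.ne'] at this
        have e : (v - u) * (1 / v) = 1 - u / v := by field_simp
        rw [e]; linarith
      have h2 : Real.log v - Real.log u ≤ (v - u) * (1 / u) := by
        have := Real.log_le_sub_one_of_pos (div_pos hv0 hu0)
        rw [Real.log_div hv0.ne' hu0.ne'] at this
        have e : (v - u) * (1 / u) = v / u - 1 := by field_simp
        rw [e]; linarith
      have h3 : (v - u) * (1 / u - 1 / v) ≤ 1 / u - 1 / v := by
        have : 0 ≤ 1 / u - 1 / v := sub_nonneg.2 (one_div_le_one_div_of_le hu0 huv)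
        nlinarith
      constructor
      · linarith [ih.1]
      · linarith [ih.2]
  have : 0 ≤ 1 / Real.log n := by positivity
  rw [abs_le]
  constructor <;> linarith [key.1, key.2]

/-- Subtracting κ(log n - log(n - 1)) from a(n) leaves a sequence with bounded partial sums, to
which Abel summation with weight 1/log n applies. -/
theorem exists_abs_sum_div_log_sub_log_log_le (a : ℕ → ℝ) (κ K : ℝ)
    (h : ∀ N : ℕ, |∑ n ∈ Finset.Ioc 0 N, a n - κ * Real.log N| ≤ K) :
    ∃ K' : ℝ, ∀ N : ℕ, 2 ≤ N →
      |∑ n ∈ Finset.Ioc 1 N, a n / Real.log n - κ * Real.log (Real.log N)| ≤ K' := by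
  have hlog : ∀ n : ℕ, 1 ≤ n →
      ∑ i ∈ Finset.Ioc 1 n, (Real.log i - Real.log (i - 1 : ℕ)) = Real.log n := by
    intro n hn
    induction n, hn using Nat.le_induction with
    | base => simp
    | succ n hn ih => rw [Finset.sum_Ioc_succ_top (by omega), ih, Nat.add_sub_cancel]; ring
  have ha1 : |a 1| ≤ K := by simpa using h 1
  have hb := abs_sum_Ioc_mul_le (fun n => a n - κ * (Real.log n - Real.log (n - 1 : ℕ)))
    (fun n => 1 / Real.log n) 1 (2 * K) ?_ ?_ ?_
  · refine ⟨2 * K * (1 / Real.log (1 + 1 : ℕ))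
      + |κ| * (1 - Real.log (Real.log 2) + 1 / Real.log 2), fun N hN => ?_⟩
    have h1 := hb N
    have h2 : |κ * (∑ i ∈ Finset.Ioc 1 N,
        (Real.log i - Real.log (i - 1 : ℕ)) * (1 / Real.log i) - Real.log (Real.log N))|
        ≤ |κ| * (1 - Real.log (Real.log 2) + 1 / Real.log 2) := by
      rw [abs_mul]
      exact mul_le_mul_of_nonneg_left (abs_sum_log_sub_log_div_log_sub_log_log_le N hN)
        (abs_nonneg _)
    refine le_trans (le_of_eq ?_) ((abs_add_le _ _).trans (add_le_add h1 h2))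
    congr 1
    rw [mul_sub, Finset.mul_sum, ← add_sub_assoc, ← Finset.sum_add_distrib]
    congr 1
    refine Finset.sum_congr rfl fun n _ => ?_
    ring
  · intro i hi
    have hi' : (2 : ℝ) ≤ i := by exact_mod_cast hi
    exact one_div_le_one_div_of_le (Real.log_pos (by linarith))
      (Real.log_le_log (by linarith) (by push_cast; linarith))
  · intro i _
    exact div_nonneg zero_le_one (Real.log_natCast_nonneg i)
  · intro n
    have hK0 : 0 ≤ K := (abs_nonneg _).trans (h 0)
    rcases le_or_gt n 1 with hn | hn
    · rw [Finset.Ioc_eq_empty (by omega)]; simpa using hK0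
    · rw [Finset.sum_sub_distrib, ← Finset.mul_sum, hlog n hn.le]
      have h1 := Finset.sum_Ioc_consecutive a (Nat.zero_le 1) hn.le
      have h2 := h n
      rw [← h1] at h2
      have h3 : ∑ i ∈ Finset.Ioc 0 1, a i = a 1 := by
        rw [show Finset.Ioc 0 1 = {1} by rfl]; simp
      rw [h3] at h2
      rw [abs_le] at *
      constructor <;> linarith [h2.1, h2.2, ha1.1, ha1.2]

open ArithmeticFunction in
theorem exists_abs_sum_vonMangoldt_sub_sum_prime_le (f : ℕ → ℝ) (hf : ∀ n, |f n| ≤ 1) :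
    ∃ K : ℝ, ∀ N : ℕ, |∑ n ∈ Finset.Ioc 0 N, f n * (vonMangoldt n / n)
      - ∑ n ∈ Finset.Ioc 0 N, if n.Prime then f n * (Real.log n / n) else 0| ≤ K := by
  -- Modulo 1 there is a single residue class, so this is the convergence of ∑ Λ(n)/n over all
  -- nonprime n.
  have hs := vonMangoldt.summable_residueClass_non_primes_div (q := 1) 0
  refine ⟨∑' n : ℕ, (if n.Prime then 0 else vonMangoldt.residueClass (0 : ZMod 1) n) / n,
    fun N => ?_⟩
  · rw [← Finset.sum_sub_distrib]
    refine (Finset.abs_sum_le_sum_abs _ _).trans (le_trans (Finset.sum_le_sum ?_)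
      (hs.sum_le_tsum (Finset.Ioc 0 N) ?_))
    · intro n _
      have hres : vonMangoldt.residueClass (0 : ZMod 1) n = vonMangoldt n :=
        Set.indicator_of_mem (by simp [eq_iff_true_of_subsingleton]) _
      rw [hres]
      split_ifs with hp
      · rw [vonMangoldt_apply_prime hp]; simp
      · rw [sub_zero, abs_mul]
        have h0 : 0 ≤ vonMangoldt n / (n : ℝ) := div_nonneg vonMangoldt_nonneg n.cast_nonneg
        rw [abs_of_nonneg h0]
        exact mul_le_of_le_one_left h0 (hf n)
    · intro n _
      exact div_nonneg (by split_ifs; exacts [le_rfl, vonMangoldt.residueClass_nonneg _ _])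
        n.cast_nonneg

open ArithmeticFunction in
theorem exists_abs_sum_primesLE_sub_log_log_le (f : ℕ → ℝ) (hf : ∀ n, |f n| ≤ 1) (κ K : ℝ)
    (h : ∀ N : ℕ, |∑ n ∈ Finset.Ioc 0 N, f n * (vonMangoldt n / n) - κ * Real.log N| ≤ K) :
    ∃ K' : ℝ, ∀ x : ℝ, 2 ≤ x →
      |∑ p ∈ Nat.primesLE ⌊x⌋₊, f p / p - κ * Real.log (Real.log x)| ≤ K' := by
  obtain ⟨K₁, h₁⟩ := exists_abs_sum_vonMangoldt_sub_sum_prime_le f hf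
  obtain ⟨K₂, h₂⟩ := exists_abs_sum_div_log_sub_log_log_le
    (fun n => if n.Prime then f n * (Real.log n / n) else 0) κ (K + K₁) (by
      intro N
      have h3 := h N
      have h4 := h₁ N
      rw [abs_le] at *
      constructor <;> linarith [h3.1, h3.2, h4.1, h4.2])
  refine ⟨K₂ + |κ| * Real.log 2, fun x hx => ?_⟩
  have hN : 2 ≤ ⌊x⌋₊ := Nat.le_floor (by exact_mod_cast hx)
  set N := ⌊x⌋₊
  have hN2 : (2 : ℝ) ≤ N := by exact_mod_cast hN
  have hNx : (N : ℝ) ≤ x := Nat.floor_le (by linarith)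
  -- Consequently log log x and log log ⌊x⌋ differ by at most log 2.
  have hxN : x ≤ (N : ℝ) ^ 2 := by
    have := (Nat.lt_floor_add_one x).le
    nlinarith
  have hlN : 0 < Real.log N := Real.log_pos (by linarith)
  have hl1 : Real.log (Real.log N) ≤ Real.log (Real.log x) :=
    Real.log_le_log hlN (Real.log_le_log (by linarith) hNx)
  have hl2 : Real.log (Real.log x) ≤ Real.log 2 + Real.log (Real.log N) := by
    rw [← Real.log_mul (by norm_num) hlN.ne']
    refine Real.log_le_log (Real.log_pos (by linarith)) ?_
    have := Real.log_le_log (by linarith) hxN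
    rwa [Real.log_pow] at this
  have e : ∑ p ∈ Nat.primesLE N, f p / p
      = ∑ n ∈ Finset.Ioc 1 N, (if n.Prime then f n * (Real.log n / n) else 0) / Real.log n := by
    rw [Nat.primesLE_eq_filter_Ioc_one, Finset.sum_filter]
    refine Finset.sum_congr rfl fun n _ => ?_
    split_ifs with hp
    · have h1 : (0 : ℝ) < Real.log n := Real.log_pos (by exact_mod_cast hp.one_lt)
      field_simp
    · simp
  rw [e]
  calc _ = |(∑ n ∈ Finset.Ioc 1 N, (if n.Prime then f n * (Real.log n / n) else 0) / Real.log n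
        - κ * Real.log (Real.log N)) + κ * (Real.log (Real.log N) - Real.log (Real.log x))| := by
        congr 1; ring
    _ ≤ K₂ + |κ| * Real.log 2 := by
        refine (abs_add_le _ _).trans (add_le_add (h₂ N hN) ?_)
        rw [abs_mul]
        refine mul_le_mul_of_nonneg_left ?_ (abs_nonneg _)
        rw [abs_le]
        constructor <;> linarith [Real.log_nonneg (show (1 : ℝ) ≤ 2 by norm_num)]

/-- A function on the primes whose sum `∑_{p ≤ x} c p / p` satisfies Mertens' second theorem. -/
def HasMertens (c : ℕ → ℝ) : Prop :=
  ∃ K : ℝ, ∀ x : ℝ, 2 ≤ x →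
    |∑ p ∈ Nat.primesLE ⌊x⌋₊, c p / p - Real.log (Real.log x)| ≤ K

theorem hasMertens_one : HasMertens (fun _ => 1) := by
  obtain ⟨K, hK⟩ := exists_abs_sum_vonMangoldt_div_sub_log_le
  obtain ⟨K', hK'⟩ := exists_abs_sum_primesLE_sub_log_log_le (fun _ => 1) (by simp) 1 K
    (by simpa using hK)
  exact ⟨K', by simpa using hK'⟩

theorem hasMertens_one_add_chi_four :
    HasMertens (fun p => 1 + ((ZMod.χ₄ p : ℤ) : ℝ)) := by
  obtain ⟨K₁, hK₁⟩ := hasMertens_one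
  obtain ⟨K, hK⟩ := exists_abs_sum_chi_four_mul_vonMangoldt_div_le
  obtain ⟨K', hK'⟩ := exists_abs_sum_primesLE_sub_log_log_le
    (fun n => ((ZMod.χ₄ n : ℤ) : ℝ)) abs_chi_four_le_one 0 K (by simpa using hK)
  refine ⟨K₁ + K', fun x hx => ?_⟩
  have h1 := hK₁ x hx
  have h2 := hK' x hx
  simp only [add_div, Finset.sum_add_distrib]
  rw [abs_le] at *
  constructor <;> linarith [h1.1, h1.2, h2.1, h2.2]

end MertensSecond

/-! ### Brun's pure sieve in a box of integer pairs -/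

section BrunSieve

/-- Bonferroni's inequality: the alternating binomial sum cut at the even index 2r equals a single
binomial coefficient, hence is nonnegative. -/
theorem ite_eq_empty_le_sum_powerset {α : Type*} [DecidableEq α] (S : Finset α) (r : ℕ) :
    (if S = ∅ then (1 : ℤ) else 0)
      ≤ ∑ D ∈ S.powerset, if D.card ≤ 2 * r then (-1) ^ D.card else 0 := by
  rw [Finset.sum_powerset_apply_card (fun k => if k ≤ 2 * r then (-1 : ℤ) ^ k else 0)]
  split_ifs with h
  · simp [h]
  · obtain ⟨n, hn⟩ := Nat.exists_eq_succ_of_ne_zero (mt Finset.card_eq_zero.1 h)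
    have h1 : ∑ m ∈ Finset.range (S.card + 1), S.card.choose m •
        (if m ≤ 2 * r then (-1 : ℤ) ^ m else 0)
        = ∑ m ∈ Finset.range (2 * r + 1), ((-1) ^ m * (n + 1).choose m : ℤ) := by
      rw [hn]
      have e1 : ∑ m ∈ Finset.range (2 * r + 1), ((-1) ^ m * (n + 1).choose m : ℤ)
          = ∑ m ∈ Finset.range (n.succ + 1 + (2 * r + 1)),
            (n + 1).choose m • (if m ≤ 2 * r then (-1 : ℤ) ^ m else 0) := by
        symm
        rw [← Finset.sum_subset (Finset.range_mono (by omega : 2 * r + 1 ≤ _))]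
        · refine Finset.sum_congr rfl fun m hm => ?_
          rw [Finset.mem_range] at hm
          rw [if_pos (by omega), nsmul_eq_mul, mul_comm]
        · intro m _ hm
          rw [Finset.mem_range] at hm
          rw [if_neg (by omega), smul_zero]
      rw [e1]
      refine Finset.sum_subset (Finset.range_mono (by omega)) ?_
      intro m _ hm
      rw [Finset.mem_range] at hm
      rw [Nat.choose_eq_zero_of_lt (by omega), zero_smul]
    rw [h1, Int.alternating_sum_range_choose_eq_choose]
    simp

/-- Inclusion–exclusion is cut at 2r prime factors. Completing the main term to the full product
costs the subsets with more than 2r elements; the weight e^(|D| - 2r) ≥ 1 bounds these by e^(-2r) ∏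
(1 + e g(q)). -/
theorem brun_pure_sieve {α : Type*} (A : Finset α) (P : Finset ℕ) (B : ℕ → α → Prop)
    [∀ q a, Decidable (B q a)] (g : ℕ → ℝ) (hg0 : ∀ q ∈ P, 0 ≤ g q) (X : ℝ) (hX : 0 ≤ X)
    (R : Finset ℕ → ℝ) (r : ℕ)
    (hR : ∀ D ⊆ P, |((A.filter fun a => ∀ q ∈ D, B q a).card : ℝ) - X * ∏ q ∈ D, g q| ≤ R D) :
    ((A.filter fun a => ∀ q ∈ P, ¬ B q a).card : ℝ)
      ≤ X * (∏ q ∈ P, (1 - g q) + Real.exp (-(2 * r) + Real.exp 1 * ∑ q ∈ P, g q))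
        + ∑ D ∈ P.powerset with D.card ≤ 2 * r, R D := by
  have h1 : ((A.filter fun a => ∀ q ∈ P, ¬ B q a).card : ℤ)
      ≤ ∑ D ∈ P.powerset, (if D.card ≤ 2 * r then (-1) ^ D.card else 0) *
        ((A.filter fun a => ∀ q ∈ D, B q a).card : ℤ) := by
    have e1 : ∀ D : Finset ℕ, ((A.filter fun a => ∀ q ∈ D, B q a).card : ℤ)
        = ∑ a ∈ A, if ∀ q ∈ D, B q a then (1 : ℤ) else 0 := by
      intro D; rw [Finset.card_filter]; push_cast; rfl
    simp only [e1, Finset.mul_sum]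
    rw [Finset.sum_comm, Finset.card_filter]
    push_cast
    refine Finset.sum_le_sum fun a _ => ?_
    refine le_trans (le_of_eq ?_) ((ite_eq_empty_le_sum_powerset (P.filter fun q => B q a) r).trans
      (le_of_eq ?_))
    · simp only [Finset.filter_eq_empty_iff]
    · have : (P.filter fun q => B q a).powerset
          = P.powerset.filter fun D => ∀ q ∈ D, B q a := by
        ext D
        simp only [Finset.mem_powerset, Finset.mem_filter, Finset.subset_iff]
        exact ⟨fun h => ⟨fun q hq => (h hq).1, fun q hq => (h hq).2⟩,
          fun h q hq => ⟨h.1 hq, h.2 q hq⟩⟩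
      rw [this, Finset.sum_filter]
      refine Finset.sum_congr rfl fun D _ => ?_
      split_ifs <;> simp
  have h1' : ((A.filter fun a => ∀ q ∈ P, ¬ B q a).card : ℝ)
      ≤ ∑ D ∈ P.powerset, (if D.card ≤ 2 * r then (-1) ^ D.card else 0) *
        ((A.filter fun a => ∀ q ∈ D, B q a).card : ℝ) := by exact_mod_cast h1
  have h2 : ∀ D ∈ P.powerset, (if D.card ≤ 2 * r then (-1 : ℝ) ^ D.card else 0) *
        ((A.filter fun a => ∀ q ∈ D, B q a).card : ℝ)
      ≤ X * ((-1) ^ D.card * ∏ q ∈ D, g q)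
        + X * (Real.exp (-(2 * r)) * ∏ q ∈ D, (Real.exp 1 * g q))
        + if D.card ≤ 2 * r then R D else 0 := by
    intro D hD
    have hDP := Finset.mem_powerset.1 hD
    have hprod : 0 ≤ ∏ q ∈ D, g q := Finset.prod_nonneg fun q hq => hg0 q (hDP hq)
    have hexp : Real.exp (-(2 * r)) * ∏ q ∈ D, (Real.exp 1 * g q)
        = Real.exp (-(2 * r) + D.card) * ∏ q ∈ D, g q := by
      rw [Finset.prod_mul_distrib, Finset.prod_const, ← Real.exp_nat_mul, mul_one, Real.exp_add,
        mul_assoc]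
    rw [hexp]
    have hpow : |(-1 : ℝ) ^ D.card| = 1 := by simp
    split_ifs with hc
    · have h := hR D hDP
      have h3 : |(-1 : ℝ) ^ D.card * (((A.filter fun a => ∀ q ∈ D, B q a).card : ℝ)
          - X * ∏ q ∈ D, g q)| ≤ R D := by rwa [abs_mul, hpow, one_mul]
      have h4 := (abs_le.1 h3).2
      have h5 : 0 ≤ X * (Real.exp (-(2 * r) + D.card) * ∏ q ∈ D, g q) := by positivity
      linarith
    · have h6 : (1 : ℝ) ≤ Real.exp (-(2 * r) + D.card) := by
        rw [Real.one_le_exp_iff]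
        have : ((2 * r : ℕ) : ℝ) ≤ D.card := by exact_mod_cast (by omega)
        push_cast at this
        linarith
      have h7 : -1 ≤ (-1 : ℝ) ^ D.card := (abs_le.1 hpow.le).1
      have h8 : 0 ≤ X * ∏ q ∈ D, g q := mul_nonneg hX hprod
      nlinarith
  refine h1'.trans ((Finset.sum_le_sum h2).trans ?_)
  rw [Finset.sum_add_distrib, Finset.sum_add_distrib, ← Finset.mul_sum, ← Finset.mul_sum,
    ← Finset.mul_sum, ← Finset.prod_one_add, ← Finset.sum_filter, Real.exp_add, mul_add]
  have h9 : ∑ D ∈ P.powerset, (-1 : ℝ) ^ D.card * ∏ q ∈ D, g q = ∏ q ∈ P, (1 - g q) := by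
    simp only [sub_eq_add_neg, Finset.prod_one_add, Finset.prod_neg]
  have h10 : ∏ q ∈ P, (1 + Real.exp 1 * g q) ≤ Real.exp (Real.exp 1 * ∑ q ∈ P, g q) := by
    rw [Finset.mul_sum, Real.exp_sum]
    refine Finset.prod_le_prod (fun q hq => ?_) (fun q _ => ?_)
    · have := hg0 q hq; positivity
    · rw [add_comm]; exact Real.add_one_le_exp _
  rw [h9]
  gcongr

theorem abs_card_Ico_filter_zmod_sub_le (d : ℕ) [NeZero d] (a : ℤ) (T : ℕ) (c : ZMod d) :
    |(((Finset.Ico a (a + T)).filter fun u : ℤ => (u : ZMod d) = c).card : ℝ) - T / d| ≤ 1 := by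
  have hd : 0 < d := Nat.pos_of_ne_zero (NeZero.ne d)
  have e : ((Finset.Ico a (a + T)).filter fun u : ℤ => (u : ZMod d) = c)
      = (Finset.Ico a (a + T)).filter fun u : ℤ => u ≡ (c.val : ℤ) [ZMOD (d : ℤ)] := by
    refine Finset.filter_congr fun u _ => ?_
    rw [← ZMod.intCast_eq_intCast_iff]
    simp
  have h := Int.Ico_filter_modEq_card a (a + T) (r := (d : ℤ)) (by exact_mod_cast hd) (c.val : ℤ)
  rw [← e] at h
  set n := ((Finset.Ico a (a + T)).filter fun u : ℤ => (u : ZMod d) = c).card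
  have hq : |(n : ℚ) - T / d| ≤ 1 := by
    have hd' : (0 : ℚ) < d := by exact_mod_cast hd
    set x : ℚ := ((a + T : ℤ) - (c.val : ℤ) : ℚ) / ((d : ℤ) : ℚ) with hx
    set y : ℚ := ((a : ℤ) - (c.val : ℤ) : ℚ) / ((d : ℤ) : ℚ) with hy
    have hxy : x - y = T / d := by
      rw [hx, hy]; push_cast; field_simp; ring
    have hxy0 : 0 ≤ x - y := by rw [hxy]; positivity
    have hmax : max (⌈x⌉ - ⌈y⌉) 0 = ⌈x⌉ - ⌈y⌉ :=
      max_eq_left (sub_nonneg.2 (Int.ceil_mono (by linarith)))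
    rw [hmax] at h
    have h' : (n : ℚ) = (⌈x⌉ : ℚ) - ⌈y⌉ := by exact_mod_cast h
    rw [h', ← hxy, abs_le]
    have h1 := Int.le_ceil x
    have h2 := Int.ceil_lt_add_one x
    have h3 := Int.le_ceil y
    have h4 := Int.ceil_lt_add_one y
    constructor <;> linarith
  have hq' := (Rat.cast_le (K := ℝ)).2 hq
  push_cast at hq'
  exact hq'

/-- By the Chinese remainder theorem the conditions form a set W of at most d² classes modulo d = ∏
q. Each class meets the box in (T/d)² points up to an error 2T/d + 1 ≤ 3T. -/
theorem abs_card_box_filter_sub_le (D : Finset ℕ) (hD : ∀ q ∈ D, q.Prime)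
    (Ω : ∀ q : ℕ, Finset (ZMod q × ZMod q)) (a b : ℤ) (T : ℕ) (hT : 1 ≤ T) :
    |((((Finset.Ico a (a + T)) ×ˢ (Finset.Ico b (b + T))).filter fun s : ℤ × ℤ =>
        ∀ q ∈ D, ((s.1 : ZMod q), (s.2 : ZMod q)) ∈ Ω q).card : ℝ)
      - (T : ℝ) ^ 2 * ∏ q ∈ D, ((Ω q).card / (q : ℝ) ^ 2)|
      ≤ 3 * T * ∏ q ∈ D, (q : ℝ) ^ 2 := by
  classical
  set m : D → ℕ := fun i => (i : ℕ) with hm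
  have hcop : Pairwise (Function.onFun Nat.Coprime m) := by
    intro i j hij
    exact (Nat.coprime_primes (hD i i.2) (hD j j.2)).2 (fun h => hij (Subtype.ext h))
  set d := ∏ i, m i with hd
  have hd0 : d ≠ 0 := Finset.prod_ne_zero_iff.2 fun i _ => (hD i i.2).ne_zero
  have : NeZero d := ⟨hd0⟩
  have hinst : ∀ i : D, NeZero (m i) := fun i => ⟨(hD i i.2).ne_zero⟩
  let φ := ZMod.prodEquivPi m hcop
  let ψ : ZMod d × ZMod d ≃ (∀ i : D, ZMod (m i) × ZMod (m i)) :=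
    (φ.toEquiv.prodCongr φ.toEquiv).trans (Equiv.arrowProdEquivProdArrow _ _ _).symm
  set W : Finset (ZMod d × ZMod d) :=
    (Fintype.piFinset fun i : D => Ω (m i)).map ψ.symm.toEmbedding with hW
  have hWcard : W.card = ∏ q ∈ D, (Ω q).card := by
    rw [hW, Finset.card_map, Fintype.card_piFinset]
    exact Finset.prod_coe_sort D (fun q => (Ω q).card)
  have hdD : d = ∏ q ∈ D, q := Finset.prod_coe_sort D (fun q => q)
  have hWle : W.card ≤ d ^ 2 := by
    refine (Finset.card_le_univ W).trans ?_
    rw [Fintype.card_prod, ZMod.card, pow_two]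
  have hmem : ∀ s : ℤ × ℤ, (∀ q ∈ D, ((s.1 : ZMod q), (s.2 : ZMod q)) ∈ Ω q)
      ↔ ((s.1 : ZMod d), (s.2 : ZMod d)) ∈ W := by
    intro s
    rw [hW, Finset.mem_map_equiv, Equiv.symm_symm, Fintype.mem_piFinset]
    have : ∀ i : D, ψ ((s.1 : ZMod d), (s.2 : ZMod d)) i
        = ((s.1 : ZMod (m i)), (s.2 : ZMod (m i))) := by
      intro i
      change (φ (s.1 : ZMod d) i, φ (s.2 : ZMod d) i) = _
      rw [map_intCast, map_intCast, Pi.intCast_apply, Pi.intCast_apply]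
    simp only [this]
    exact ⟨fun h i => h i i.2, fun h q hq => h ⟨q, hq⟩⟩
  set nI : ZMod d → ℕ := fun c =>
    ((Finset.Ico a (a + T)).filter fun u : ℤ => (u : ZMod d) = c).card
  set nJ : ZMod d → ℕ := fun c =>
    ((Finset.Ico b (b + T)).filter fun u : ℤ => (u : ZMod d) = c).card
  have hcount : (((Finset.Ico a (a + T)) ×ˢ (Finset.Ico b (b + T))).filter fun s : ℤ × ℤ =>
        ∀ q ∈ D, ((s.1 : ZMod q), (s.2 : ZMod q)) ∈ Ω q).card = ∑ w ∈ W, nI w.1 * nJ w.2 := by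
    simp only [hmem]
    have hfib := Finset.card_eq_sum_card_fiberwise
      (s := (Finset.Ico a (a + T) ×ˢ Finset.Ico b (b + T)).filter
        fun s : ℤ × ℤ => ((s.1 : ZMod d), (s.2 : ZMod d)) ∈ W)
      (f := fun s : ℤ × ℤ => ((s.1 : ZMod d), (s.2 : ZMod d)))
      (t := W) (fun s hs => (Finset.mem_filter.1 (Finset.mem_coe.1 hs)).2)
    rw [hfib]
    refine Finset.sum_congr rfl fun w hw => ?_
    rw [← Finset.card_product, ← Finset.filter_product, Finset.filter_filter]
    congr 1
    refine Finset.filter_congr fun s _ => ?_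
    constructor
    · rintro ⟨_, h⟩
      rw [← h]; exact ⟨rfl, rfl⟩
    · rintro ⟨h1, h2⟩
      have : ((s.1 : ZMod d), (s.2 : ZMod d)) = w := Prod.ext h1 h2
      exact ⟨this ▸ hw, this⟩
  rw [hcount, Finset.prod_div_distrib, Finset.prod_pow]
  have hdR : (∏ q ∈ D, (q : ℝ)) = d := by rw [hdD]; push_cast; rfl
  have hWR : (∏ q ∈ D, ((Ω q).card : ℝ)) = W.card := by rw [hWcard]; push_cast; rfl
  rw [hdR, hWR]
  have hd1 : (1 : ℝ) ≤ d := by exact_mod_cast Nat.one_le_iff_ne_zero.2 hd0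
  have hT1 : (1 : ℝ) ≤ T := by exact_mod_cast hT
  have hterm : ∀ w ∈ W, |((nI w.1 * nJ w.2 : ℕ) : ℝ) - (T / d : ℝ) ^ 2| ≤ 3 * T := by
    intro w _
    have h1 := abs_card_Ico_filter_zmod_sub_le d a T w.1
    have h2 := abs_card_Ico_filter_zmod_sub_le d b T w.2
    change |(nI w.1 : ℝ) - _| ≤ 1 at h1
    change |(nJ w.2 : ℝ) - _| ≤ 1 at h2
    have h3 : (T / d : ℝ) ≤ T := div_le_self (by positivity) hd1
    have h3' : (0 : ℝ) ≤ T / d := by positivity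
    set t : ℝ := T / d
    set x : ℝ := ((nI w.1 : ℕ) : ℝ)
    set y : ℝ := ((nJ w.2 : ℕ) : ℝ)
    have e : ((nI w.1 * nJ w.2 : ℕ) : ℝ) - t ^ 2
        = (x - t) * (y - t) + t * (x - t) + t * (y - t) := by
      push_cast; ring
    rw [e]
    refine (abs_add_three _ _ _).trans ?_
    rw [abs_mul, abs_mul, abs_mul, abs_of_nonneg h3']
    have := abs_nonneg (x - t)
    have := abs_nonneg (y - t)
    nlinarith
  have e2 : ((∑ w ∈ W, nI w.1 * nJ w.2 : ℕ) : ℝ) - (T : ℝ) ^ 2 * (W.card / (d : ℝ) ^ 2)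
      = ∑ w ∈ W, (((nI w.1 * nJ w.2 : ℕ) : ℝ) - (T / d : ℝ) ^ 2) := by
    rw [Finset.sum_sub_distrib, Finset.sum_const, nsmul_eq_mul]
    push_cast
    field_simp
  rw [e2]
  refine (Finset.abs_sum_le_sum_abs _ _).trans ((Finset.sum_le_sum hterm).trans ?_)
  rw [Finset.sum_const, nsmul_eq_mul, mul_comm]
  have : (W.card : ℝ) ≤ (d : ℝ) ^ 2 := by exact_mod_cast hWle
  gcongr

theorem card_le_of_sieved_box (P : Finset ℕ) (y : ℕ) (hP : ∀ q ∈ P, q.Prime ∧ q ≤ y)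
    (Ω : ∀ q : ℕ, Finset (ZMod q × ZMod q)) (a b : ℤ) (T : ℕ) (hT : 1 ≤ T) (r : ℕ)
    (hy : 1 ≤ y) (S : Finset (ℤ × ℤ))
    (hS : S ⊆ Finset.Ico a (a + T) ×ˢ Finset.Ico b (b + T))
    (hSΩ : ∀ s ∈ S, ∀ q ∈ P, ((s.1 : ZMod q), (s.2 : ZMod q)) ∉ Ω q) :
    (S.card : ℝ) ≤ (T : ℝ) ^ 2 * (∏ q ∈ P, (1 - (Ω q).card / (q : ℝ) ^ 2)
        + Real.exp (-(2 * r) + Real.exp 1 * ∑ q ∈ P, (Ω q).card / (q : ℝ) ^ 2))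
      + 9 * T * (y : ℝ) ^ (6 * r) := by
  classical
  have h := brun_pure_sieve (Finset.Ico a (a + T) ×ˢ Finset.Ico b (b + T)) P
    (fun q s => ((s.1 : ZMod q), (s.2 : ZMod q)) ∈ Ω q) (fun q => (Ω q).card / (q : ℝ) ^ 2)
    (fun q _ => by positivity) ((T : ℝ) ^ 2) (by positivity)
    (fun D => 3 * T * ∏ q ∈ D, (q : ℝ) ^ 2) r
    (fun D hD => abs_card_box_filter_sub_le D (fun q hq => (hP q (hD hq)).1) Ω a b T hT)
  have h1 : S.card ≤ ((Finset.Ico a (a + T) ×ˢ Finset.Ico b (b + T)).filter fun s : ℤ × ℤ =>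
      ∀ q ∈ P, ((s.1 : ZMod q), (s.2 : ZMod q)) ∉ Ω q).card :=
    Finset.card_le_card fun s hs => Finset.mem_filter.2 ⟨hS hs, hSΩ s hs⟩
  have h1' : (S.card : ℝ) ≤ _ := Nat.cast_le.2 h1
  refine h1'.trans (h.trans ?_)
  gcongr
  have hy1 : (1 : ℝ) ≤ y := by exact_mod_cast hy
  have hy0 : (0 : ℝ) < y := by linarith
  -- Writing q² ≤ y³ · (1/y) keeps a factor 1/y per prime. Summed over all D these factors give (1 +
  -- 1/y)^|P| ≤ e ≤ 3, so the number of subsets D is never estimated.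
  have h2 : ∀ D ∈ P.powerset.filter (fun D => D.card ≤ 2 * r), 3 * T * ∏ q ∈ D, (q : ℝ) ^ 2
      ≤ 3 * T * (y : ℝ) ^ (6 * r) * ∏ q ∈ D, (1 / y : ℝ) := by
    intro D hD
    obtain ⟨hDP, hDr⟩ := Finset.mem_filter.1 hD
    rw [Finset.mem_powerset] at hDP
    rw [mul_assoc (3 * (T : ℝ))]
    gcongr
    have h3 : ∏ q ∈ D, (q : ℝ) ^ 2 ≤ ∏ q ∈ D, ((y : ℝ) ^ 3 * (1 / y)) := by
      refine Finset.prod_le_prod (fun q _ => by positivity) fun q hq => ?_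
      have hqy : (q : ℝ) ≤ y := by exact_mod_cast (hP q (hDP hq)).2
      have : (y : ℝ) ^ 3 * (1 / y) = y ^ 2 := by field_simp
      rw [this]
      gcongr
    refine h3.trans ?_
    rw [Finset.prod_mul_distrib]
    gcongr
    rw [Finset.prod_const, ← pow_mul]
    exact pow_le_pow_right₀ hy1 (by omega)
  refine (Finset.sum_le_sum h2).trans ?_
  rw [← Finset.mul_sum]
  have h4 : ∑ D ∈ P.powerset.filter (fun D => D.card ≤ 2 * r), ∏ q ∈ D, (1 / y : ℝ) ≤ 3 := by
    calc _ ≤ ∑ D ∈ P.powerset, ∏ q ∈ D, (1 / y : ℝ) :=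
          Finset.sum_le_sum_of_subset_of_nonneg (Finset.filter_subset _ _)
            fun D _ _ => Finset.prod_nonneg fun _ _ => by positivity
      _ = (1 + 1 / y : ℝ) ^ P.card := by rw [← Finset.prod_one_add, Finset.prod_const]
      _ ≤ Real.exp (1 / y) ^ y := by
          have hc : P.card ≤ y := by
            have : P ⊆ Finset.Icc 1 y := fun q hq =>
              Finset.mem_Icc.2 ⟨(hP q hq).1.one_le, (hP q hq).2⟩
            simpa using Finset.card_le_card this
          calc (1 + 1 / y : ℝ) ^ P.card ≤ (1 + 1 / y : ℝ) ^ y :=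
                pow_le_pow_right₀ (by simp) hc
            _ ≤ _ := by
                gcongr
                rw [add_comm]; exact Real.add_one_le_exp _
      _ = Real.exp 1 := by rw [← Real.exp_nat_mul]; field_simp
      _ ≤ 3 := Real.exp_one_lt_three.le
  have : (0 : ℝ) ≤ 3 * T * (y : ℝ) ^ (6 * r) := by positivity
  nlinarith

end BrunSieve

/-! ### Weighted sums bounded by Euler products -/

section EulerProduct

/-- Unique factorization embeds S injectively into the terms of the expanded product; exponents stay
below K + 1 because the exponent of p in n is less than n ≤ K. -/
theorem sum_prod_primeFactors_le (G : ℕ → ℕ → ℝ) (hG : ∀ p k, 0 ≤ G p k) (t : ℕ → ℝ)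
    (P : Finset ℕ) (hGt : ∀ p ∈ P, ∀ K, ∑ k ∈ Finset.range K, G p (k + 1) ≤ t p)
    (S : Finset ℕ) (hS : ∀ n ∈ S, n ≠ 0 ∧ n.primeFactors ⊆ P) :
    ∑ n ∈ S, ∏ p ∈ n.primeFactors, G p (n.factorization p) ≤ ∏ p ∈ P, (1 + t p) := by
  classical
  set K := S.sup id with hK
  let G' : ℕ → ℕ → ℝ := fun p k => if k = 0 then 1 else G p k
  have hG' : ∀ p k, 0 ≤ G' p k := fun p k => by
    dsimp only [G']; split_ifs; exacts [zero_le_one, hG p k]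
  have h1 : ∏ p ∈ P, ∑ k ∈ Finset.range (K + 1), G' p k ≤ ∏ p ∈ P, (1 + t p) := by
    refine Finset.prod_le_prod (fun p _ => Finset.sum_nonneg fun k _ => hG' p k) fun p hp => ?_
    rw [Finset.sum_range_succ']
    have : ∑ k ∈ Finset.range K, G' p (k + 1) = ∑ k ∈ Finset.range K, G p (k + 1) :=
      Finset.sum_congr rfl fun k _ => if_neg (Nat.succ_ne_zero k)
    rw [this, show G' p 0 = 1 from if_pos rfl, add_comm]
    linarith [hGt p hp K]
  refine le_trans ?_ h1
  rw [Finset.prod_sum]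
  let i : ℕ → ∀ p ∈ P, ℕ := fun n p _ => n.factorization p
  have hi : Set.InjOn i S := by
    intro n hn m hm hnm
    refine Nat.eq_of_factorization_eq (hS n hn).1 (hS m hm).1 fun p => ?_
    by_cases hp : p ∈ P
    · exact congrFun (congrFun hnm p) hp
    · have h2 : ∀ k ∈ S, k.factorization p = 0 := fun k hk => by
        have := (hS k hk).2
        rw [← Nat.support_factorization] at this
        exact Finsupp.notMem_support_iff.1 fun h => hp (this h)
      rw [h2 n hn, h2 m hm]
  calc ∑ n ∈ S, ∏ p ∈ n.primeFactors, G p (n.factorization p)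
      = ∑ n ∈ S, ∏ x ∈ P.attach, G' x.1 (i n x.1 x.2) := by
        refine Finset.sum_congr rfl fun n hn => ?_
        rw [Finset.prod_attach P (fun p => G' p (n.factorization p))]
        rw [← Finset.prod_subset (hS n hn).2]
        · refine Finset.prod_congr rfl fun p hp => ?_
          rw [← Nat.support_factorization] at hp
          exact (if_neg (Finsupp.mem_support_iff.1 hp)).symm
        · intro p _ hp
          rw [← Nat.support_factorization] at hp
          exact if_pos (Finsupp.notMem_support_iff.1 hp)
    _ = ∑ f ∈ S.image i, ∏ x ∈ P.attach, G' x.1 (f x.1 x.2) := by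
        rw [Finset.sum_image hi]
    _ ≤ _ := by
        refine Finset.sum_le_sum_of_subset_of_nonneg ?_ fun f _ _ =>
          Finset.prod_nonneg fun x _ => hG' _ _
        intro f hf
        obtain ⟨n, hn, rfl⟩ := Finset.mem_image.1 hf
        rw [Finset.mem_pi]
        intro p _
        rw [Finset.mem_range]
        have h2 : n ≤ K := Finset.le_sup (f := id) hn
        have h3 : n.factorization p < n := Nat.factorization_lt p (hS n hn).1
        change n.factorization p < K + 1
        omega

/-- The local factor at `p ^ k` of a multiplicative majorant of the number of elements of given
norm, with prescribed value `c p` at the primes. -/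
noncomputable def localWeight (c : ℕ → ℝ) (p k : ℕ) : ℝ := if k = 1 then c p else k + 1

/-- The multiplicative function with value `c p` at primes and `k + 1` at higher powers `p ^ k`. -/
noncomputable def arithWeight (c : ℕ → ℝ) (n : ℕ) : ℝ :=
  ∏ p ∈ n.primeFactors, localWeight c p (n.factorization p)

theorem localWeight_nonneg {c : ℕ → ℝ} (hc : ∀ p, 0 ≤ c p) (p k : ℕ) : 0 ≤ localWeight c p k := by
  unfold localWeight
  split_ifs
  exacts [hc p, by positivity]

theorem arithWeight_nonneg {c : ℕ → ℝ} (hc : ∀ p, 0 ≤ c p) (n : ℕ) : 0 ≤ arithWeight c n :=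
  Finset.prod_nonneg fun p _ => localWeight_nonneg hc p _

/-- From k + 3 ≤ 3(4/3)^k and (4/3)u ≤ 4/5 the tail is at most 3u² · 5. The bound 3/5 leaves room
for u = p^(-σ) with σ ≥ 3/4, since 2^(-3/4) < 3/5. -/
theorem sum_range_localWeight_mul_pow_le {c : ℕ → ℝ} (hc : ∀ p, 0 ≤ c p) (p : ℕ) (u : ℝ)
    (hu : 0 ≤ u) (hu' : u ≤ 3 / 5) (K : ℕ) :
    ∑ k ∈ Finset.range K, localWeight c p (k + 1) * u ^ (k + 1) ≤ c p * u + 15 * u ^ 2 := by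
  cases K with
  | zero => simp; have := hc p; positivity
  | succ K =>
    rw [Finset.sum_range_succ']
    have h0 : localWeight c p (0 + 1) * u ^ (0 + 1) = c p * u := by simp [localWeight]
    have h1 : ∀ k ∈ Finset.range K, localWeight c p (k + 1 + 1) * u ^ (k + 1 + 1)
        ≤ 3 * u ^ 2 * (4 / 5) ^ k := by
      intro k _
      have h2 : localWeight c p (k + 1 + 1) = (k : ℝ) + 3 := by
        rw [localWeight, if_neg (by omega)]; push_cast; ring
      have h3 : (k : ℝ) + 3 ≤ 3 * (4 / 3) ^ k := by
        have := one_add_mul_le_pow (show (-2 : ℝ) ≤ 1 / 3 by norm_num) k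
        norm_num at this
        linarith
      rw [h2]
      calc ((k : ℝ) + 3) * u ^ (k + 1 + 1) ≤ (3 * (4 / 3) ^ k) * u ^ (k + 1 + 1) := by gcongr
        _ = 3 * u ^ 2 * ((4 / 3) * u) ^ k := by rw [mul_pow]; ring
        _ ≤ _ := by gcongr; linarith
    have h4 : ∑ k ∈ Finset.range K, (4 / 5 : ℝ) ^ k ≤ 5 := by
      have := geom_sum_mul (4 / 5 : ℝ) K
      have : (0 : ℝ) ≤ (4 / 5) ^ K := by positivity
      linarith
    have h5 := Finset.sum_le_sum h1
    rw [← Finset.mul_sum] at h5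
    rw [h0]
    nlinarith [sq_nonneg u]

theorem sum_inv_rpow_le {s : ℝ} (hs : 1 < s) :
    ∃ Z : ℝ, 0 ≤ Z ∧ ∀ P : Finset ℕ, ∑ p ∈ P, 1 / (p : ℝ) ^ s ≤ Z := by
  have h := Real.summable_one_div_nat_rpow.2 hs
  exact ⟨_, tsum_nonneg fun n => by positivity, fun P =>
    h.sum_le_tsum P fun n _ => by positivity⟩

/-- The singular factor `∏_{q ∣ a} exp (4 / q)`. -/
noncomputable def singularFactor (a : ℕ) : ℝ := ∏ q ∈ a.primeFactors, Real.exp (4 / q)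

theorem one_le_singularFactor (a : ℕ) : 1 ≤ singularFactor a :=
  Finset.prod_induction _ (1 ≤ ·) (fun _ _ => one_le_mul_of_one_le_of_one_le) le_rfl
    fun q _ => by rw [Real.one_le_exp_iff]; positivity

open ArithmeticFunction in
theorem exists_sum_arithWeight_le {c : ℕ → ℝ} (hc : ∀ p, 0 ≤ c p ∧ c p ≤ 2) (hM : HasMertens c)
    {γ : ℝ} (hγ : 0 < γ) :
    ∃ K : ℝ, 0 < K ∧ ∀ x : ℝ, 2 ≤ x → ∑ n ∈ Finset.Icc 1 ⌊x⌋₊,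
      arithWeight c n * γ ^ cardDistinctFactors n * singularFactor n / n
        ≤ K * Real.log x ^ γ := by
  obtain ⟨K, hK⟩ := hM
  obtain ⟨Z, hZ0, hZ⟩ := sum_inv_rpow_le (s := 2) (by norm_num)
  set A := Real.exp 2 with hA
  have hA0 : 0 < A := Real.exp_pos _
  refine ⟨Real.exp (γ * (K + 23 * A * Z)), Real.exp_pos _, fun x hx => ?_⟩
  let G : ℕ → ℕ → ℝ := fun p k => γ * Real.exp (4 / p) * (localWeight c p k * (1 / p : ℝ) ^ k)
  have hlw := localWeight_nonneg (fun p => (hc p).1)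
  have hG : ∀ p k, 0 ≤ G p k := fun p k => by have := hlw p k; positivity
  -- The 23 is 8 + 15: with u = 1/p, exp(4u) ≤ 1 + 4uA times c(p)u ≤ 2u gives 8A u², and the higher
  -- powers give 15A u².
  let t : ℕ → ℝ := fun p => γ * (c p / p + 23 * A * (1 / (p : ℝ) ^ (2 : ℝ)))
  have ht : ∀ p ∈ Nat.primesLE ⌊x⌋₊, ∀ K, ∑ k ∈ Finset.range K, G p (k + 1) ≤ t p := by
    intro p hp K
    have hp2 : (2 : ℝ) ≤ p := by exact_mod_cast (Nat.mem_primesLE.1 hp).2.two_le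
    have hu : (1 / p : ℝ) ≤ 1 / 2 := one_div_le_one_div_of_le (by norm_num) hp2
    have h1 := sum_range_localWeight_mul_pow_le (fun p => (hc p).1) p (1 / p) (by positivity)
      (hu.trans (by norm_num)) K
    dsimp only [G, t]
    rw [← Finset.mul_sum, mul_assoc γ]
    refine mul_le_mul_of_nonneg_left ?_ hγ.le
    set u : ℝ := 1 / p with hu_def
    have hu0 : 0 ≤ u := by positivity
    have e1 : (4 / p : ℝ) = 4 * u := by rw [hu_def]; ring
    have e2 : 1 / (p : ℝ) ^ (2 : ℝ) = u ^ 2 := by rw [hu_def, Real.rpow_two, one_div_pow]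
    have e3 : c p / p = c p * u := by rw [hu_def]; ring
    rw [e1, e2, e3]
    have h2 : Real.exp (4 * u) ≤ A := Real.exp_le_exp.2 (by linarith)
    have h3 : Real.exp (4 * u) ≤ 1 + 4 * u * A := by
      have h4 := Real.add_one_le_exp (-(4 * u))
      have h5 : Real.exp (-(4 * u)) * Real.exp (4 * u) = 1 := by rw [← Real.exp_add]; simp
      have h6 : (-(4 * u) + 1) * Real.exp (4 * u) ≤ 1 :=
        (mul_le_mul_of_nonneg_right h4 (Real.exp_pos _).le).trans_eq h5
      nlinarith [mul_le_mul_of_nonneg_left h2 (by linarith : 0 ≤ 4 * u)]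
    have hcp := hc p
    calc _ ≤ Real.exp (4 * u) * (c p * u + 15 * u ^ 2) :=
          mul_le_mul_of_nonneg_left h1 (Real.exp_pos _).le
      _ = Real.exp (4 * u) * (c p * u) + Real.exp (4 * u) * (15 * u ^ 2) := by ring
      _ ≤ (1 + 4 * u * A) * (c p * u) + A * (15 * u ^ 2) :=
          add_le_add (mul_le_mul_of_nonneg_right h3 (mul_nonneg hcp.1 hu0))
            (mul_le_mul_of_nonneg_right h2 (by positivity))
      _ ≤ _ := by
          have : 0 ≤ A * u ^ 2 := by positivity
          nlinarith
  have hS : ∀ n ∈ Finset.Icc 1 ⌊x⌋₊, n ≠ 0 ∧ n.primeFactors ⊆ Nat.primesLE ⌊x⌋₊ := by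
    intro n hn
    obtain ⟨h1, h2⟩ := Finset.mem_Icc.1 hn
    refine ⟨by omega, fun p hp => ?_⟩
    rw [Nat.mem_primesLE]
    exact ⟨(Nat.le_of_mem_primeFactors hp).trans h2, Nat.prime_of_mem_primeFactors hp⟩
  have h := sum_prod_primeFactors_le G hG t _ ht _ hS
  have hterm : ∀ n ∈ Finset.Icc 1 ⌊x⌋₊,
      arithWeight c n * γ ^ cardDistinctFactors n * singularFactor n / n
      = ∏ p ∈ n.primeFactors, G p (n.factorization p) := by
    intro n hn
    have hn0 := (hS n hn).1
    dsimp only [G]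
    rw [Finset.prod_mul_distrib, Finset.prod_mul_distrib, Finset.prod_mul_distrib,
      Finset.prod_const, ← arithWeight, ← singularFactor]
    have e1 : ∏ p ∈ n.primeFactors, (1 / p : ℝ) ^ n.factorization p = 1 / n := by
      have := Nat.prod_factorization_pow_eq_self hn0
      rw [Finsupp.prod, Nat.support_factorization] at this
      conv_rhs => rw [← this]
      push_cast
      simp only [one_div, inv_pow, Finset.prod_inv_distrib]
    have e2 : cardDistinctFactors n = n.primeFactors.card := by
      rw [cardDistinctFactors_apply, ← List.card_toFinset]; rfl
    rw [e1, e2]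
    ring
  rw [Finset.sum_congr rfl hterm]
  refine h.trans ?_
  have hlx : 0 < Real.log x := Real.log_pos (by linarith)
  calc ∏ p ∈ Nat.primesLE ⌊x⌋₊, (1 + t p) ≤ ∏ p ∈ Nat.primesLE ⌊x⌋₊, Real.exp (t p) := by
        refine Finset.prod_le_prod (fun p _ => ?_) fun p _ => ?_
        · have := (hc p).1; dsimp only [t]; positivity
        · rw [add_comm]; exact Real.add_one_le_exp _
    _ = Real.exp (γ * (∑ p ∈ Nat.primesLE ⌊x⌋₊, c p / p
          + 23 * A * ∑ p ∈ Nat.primesLE ⌊x⌋₊, 1 / (p : ℝ) ^ (2 : ℝ))) := by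
        rw [← Real.exp_sum]
        dsimp only [t]
        rw [← Finset.mul_sum, Finset.sum_add_distrib, ← Finset.mul_sum]
    _ ≤ Real.exp (γ * ((K + Real.log (Real.log x)) + 23 * A * Z)) := by
        have h1 := (abs_le.1 (hK x hx)).2
        gcongr
        · linarith
        · exact hZ _
    _ = _ := by
        rw [Real.rpow_def_of_pos hlx, ← Real.exp_add]
        congr 1; ring

/-- Rankin's trick: insert (4x/n)^σ ≥ 1 with σ = 1 - 1/log y, where y is the smoothness bound. For p
≤ y this costs only p^(1/log y) ≤ e, so the Euler product is O((log x)^(2e)), and 2e ≤ 6, while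
x^(-1/log y) = (log x)^(-C). -/
theorem exists_sum_smooth_arithWeight_le {c : ℕ → ℝ} (hc : ∀ p, 0 ≤ c p ∧ c p ≤ 2)
    {C : ℝ} (hC : 0 < C) :
    ∃ K : ℝ, 0 < K ∧ ∀ᶠ x : ℝ in Filter.atTop,
      ∑ n ∈ Finset.Icc 1 ⌊4 * x⌋₊ with
          ∀ p : ℕ, p ∈ n.primeFactors →
            (p : ℝ) ≤ Real.exp (Real.log x / (C * Real.log (Real.log x))),
        arithWeight c n ≤ K * (x * Real.log x ^ (6 - C)) := by
  obtain ⟨K, hK⟩ := hasMertens_one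
  obtain ⟨Z, hZ0, hZ⟩ := sum_inv_rpow_le (s := 3 / 2) (by norm_num)
  set E := Real.exp 1 with hE
  have hE0 : 0 < E := Real.exp_pos _
  have hE3 : E ≤ 3 := Real.exp_one_lt_three.le
  refine ⟨4 * Real.exp (2 * E * K + 15 * Z), by positivity, ?_⟩
  have hll : Filter.Tendsto (fun x : ℝ => Real.log (Real.log x)) Filter.atTop Filter.atTop :=
    Real.tendsto_log_atTop.comp Real.tendsto_log_atTop
  have hlo : ∀ᶠ x : ℝ in Filter.atTop,
      4 * C * Real.log (Real.log x) ≤ Real.log x := by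
    have h1 := (Real.isLittleO_log_id_atTop.comp_tendsto Real.tendsto_log_atTop).bound
      (show (0 : ℝ) < 1 / (4 * C) by positivity)
    filter_upwards [h1, Filter.eventually_ge_atTop (1 : ℝ), hll.eventually_ge_atTop 0]
      with x hx hx1 hx2
    simp only [Function.comp_apply, id, Real.norm_eq_abs] at hx
    rw [abs_of_nonneg hx2, abs_of_nonneg (Real.log_nonneg hx1), one_div_mul_eq_div,
      le_div_iff₀ (by positivity)] at hx
    linarith
  filter_upwards [hlo, hll.eventually_ge_atTop 1, Filter.eventually_ge_atTop (3 : ℝ),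
    hll.eventually_ge_atTop (1 / C)] with x hx1 hx2 hx3 hx4
  set L := Real.log (Real.log x) with hL
  have hx0 : 0 < x := by linarith
  have hl0 : 0 < Real.log x := Real.log_pos (by linarith)
  set w := Real.log x / (C * L) with hw
  have hL0 : 0 < L := by linarith
  have hw4 : 4 ≤ w := by rw [hw, le_div_iff₀ (by positivity)]; linarith
  have hwl : w ≤ Real.log x := by
    rw [hw]
    refine div_le_self hl0.le ?_
    rw [div_le_iff₀ hC] at hx4
    linarith
  set y := Real.exp w with hy
  have hy2 : 2 ≤ y := by
    have := Real.add_one_le_exp w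
    linarith
  set σ := 1 - 1 / w with hσ
  have hσ34 : 3 / 4 ≤ σ := by
    have : 1 / w ≤ 1 / 4 := one_div_le_one_div_of_le (by norm_num) hw4
    rw [hσ]; linarith
  have hσ1 : σ ≤ 1 := by
    have : 0 ≤ 1 / w := by positivity
    rw [hσ]; linarith
  let G : ℕ → ℕ → ℝ := fun p k => localWeight c p k * ((p : ℝ) ^ (-σ)) ^ k
  have hlw := localWeight_nonneg (fun p => (hc p).1)
  have hG : ∀ p k, 0 ≤ G p k := fun p k => by have := hlw p k; positivity
  let t : ℕ → ℝ := fun p => 2 * E * (1 / p) + 15 * (1 / (p : ℝ) ^ (3 / 2 : ℝ))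
  have ht : ∀ p ∈ Nat.primesLE ⌊y⌋₊, ∀ K, ∑ k ∈ Finset.range K, G p (k + 1) ≤ t p := by
    intro p hp K
    obtain ⟨hpy, hpp⟩ := Nat.mem_primesLE.1 hp
    have hpy' : (p : ℝ) ≤ y := (Nat.le_floor_iff (by linarith)).1 hpy
    have hp2 : (2 : ℝ) ≤ p := by exact_mod_cast hpp.two_le
    have hp0 : (0 : ℝ) < p := by linarith
    set u : ℝ := (p : ℝ) ^ (-σ) with hu
    have hu0 : 0 ≤ u := by positivity
    have hu1 : u ≤ 3 / 5 := by
      have h1 : u ≤ (p : ℝ) ^ (-(3 / 4) : ℝ) :=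
        Real.rpow_le_rpow_of_exponent_le (by linarith) (by linarith)
      have h2 : (p : ℝ) ^ (-(3 / 4) : ℝ) ≤ (2 : ℝ) ^ (-(3 / 4) : ℝ) :=
        Real.rpow_le_rpow_of_nonpos (by norm_num) hp2 (by norm_num)
      have h3 : ((2 : ℝ) ^ (-(3 / 4) : ℝ)) ^ 4 ≤ (3 / 5) ^ 4 := by
        rw [← Real.rpow_natCast, ← Real.rpow_mul (by norm_num)]
        norm_num
      have h4 := le_of_pow_le_pow_left₀ (by norm_num) (by norm_num) h3
      linarith
    have hu2 : u ≤ E * (1 / p) := by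
      have h1 : (p : ℝ) ^ (1 / w) ≤ E := by
        rw [Real.rpow_def_of_pos hp0, hE]
        refine Real.exp_le_exp.2 ?_
        have : Real.log p ≤ w := by
          rw [← Real.log_exp w]; exact Real.log_le_log hp0 hpy'
        rw [mul_one_div, div_le_one (by linarith)]
        exact this
      have h2 : u = (p : ℝ) ^ (1 / w) * (1 / p) := by
        rw [hu, hσ, show -(1 - 1 / w) = 1 / w + (-1) by ring, Real.rpow_add hp0, Real.rpow_neg_one,
          one_div (p : ℝ)]
      rw [h2]
      gcongr
    have hu3 : u ^ 2 ≤ 1 / (p : ℝ) ^ (3 / 2 : ℝ) := by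
      rw [one_div, ← Real.rpow_neg hp0.le, hu, ← Real.rpow_natCast, ← Real.rpow_mul hp0.le]
      exact Real.rpow_le_rpow_of_exponent_le (by linarith) (by push_cast; linarith)
    have h1 := sum_range_localWeight_mul_pow_le (fun p => (hc p).1) p u hu0 hu1 K
    refine h1.trans ?_
    dsimp only [t]
    nlinarith [(hc p).1, (hc p).2]
  set S := (Finset.Icc 1 ⌊4 * x⌋₊).filter
    fun n => ∀ p : ℕ, p ∈ n.primeFactors → (p : ℝ) ≤ y with hSdef
  have hS : ∀ n ∈ S, n ≠ 0 ∧ n.primeFactors ⊆ Nat.primesLE ⌊y⌋₊ := by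
    intro n hn
    obtain ⟨h1, h2⟩ := Finset.mem_filter.1 hn
    refine ⟨by have := (Finset.mem_Icc.1 h1).1; omega, fun p hp => ?_⟩
    rw [Nat.mem_primesLE]
    exact ⟨Nat.le_floor (h2 p hp), Nat.prime_of_mem_primeFactors hp⟩
  have h := sum_prod_primeFactors_le G hG t _ ht _ hS
  have hterm : ∀ n ∈ S, arithWeight c n
      ≤ (4 * x) ^ σ * ∏ p ∈ n.primeFactors, G p (n.factorization p) := by
    intro n hn
    have hn0 := (hS n hn).1
    have hnpos : (0 : ℝ) < n := by exact_mod_cast Nat.pos_of_ne_zero hn0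
    have hnx : (n : ℝ) ≤ 4 * x :=
      (Nat.le_floor_iff (by linarith)).1 (Finset.mem_Icc.1 (Finset.mem_filter.1 hn).1).2
    dsimp only [G]
    rw [Finset.prod_mul_distrib, ← arithWeight]
    have e1 : ∏ p ∈ n.primeFactors, ((p : ℝ) ^ (-σ)) ^ n.factorization p = (n : ℝ) ^ (-σ) := by
      have := Nat.prod_factorization_pow_eq_self hn0
      rw [Finsupp.prod, Nat.support_factorization] at this
      conv_rhs => rw [← this]
      push_cast
      rw [← Real.finsetProd_rpow _ _ fun p _ => by positivity]
      refine Finset.prod_congr rfl fun p _ => ?_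
      rw [← Real.rpow_natCast, ← Real.rpow_natCast, ← Real.rpow_mul (by positivity),
        ← Real.rpow_mul (by positivity), mul_comm]
    rw [e1, mul_comm (arithWeight c n), ← mul_assoc]
    have h1 : 1 ≤ (4 * x) ^ σ * (n : ℝ) ^ (-σ) := by
      rw [Real.rpow_neg hnpos.le, ← div_eq_mul_inv, ← Real.div_rpow (by positivity) hnpos.le]
      exact Real.one_le_rpow (by rw [le_div_iff₀ hnpos]; linarith) (by linarith)
    exact le_mul_of_one_le_left (arithWeight_nonneg (fun p => (hc p).1) n) h1
  refine (Finset.sum_le_sum hterm).trans ?_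
  rw [← Finset.mul_sum]
  have hprod : ∏ p ∈ Nat.primesLE ⌊y⌋₊, (1 + t p)
      ≤ Real.exp (2 * E * K + 15 * Z) * Real.log x ^ (6 : ℝ) := by
    calc ∏ p ∈ Nat.primesLE ⌊y⌋₊, (1 + t p) ≤ ∏ p ∈ Nat.primesLE ⌊y⌋₊, Real.exp (t p) := by
          refine Finset.prod_le_prod (fun p _ => ?_) fun p _ => ?_
          · dsimp only [t]; positivity
          · rw [add_comm]; exact Real.add_one_le_exp _
      _ = Real.exp (2 * E * ∑ p ∈ Nat.primesLE ⌊y⌋₊, 1 / (p : ℝ)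
            + 15 * ∑ p ∈ Nat.primesLE ⌊y⌋₊, 1 / (p : ℝ) ^ (3 / 2 : ℝ)) := by
          rw [← Real.exp_sum]
          dsimp only [t]
          rw [Finset.sum_add_distrib, ← Finset.mul_sum, ← Finset.mul_sum]
      _ ≤ Real.exp (2 * E * (K + L) + 15 * Z) := by
          have h1 := (abs_le.1 (hK y hy2)).2
          have h2 : Real.log (Real.log y) ≤ L := by
            rw [hy, Real.log_exp]
            exact Real.log_le_log (by linarith) hwl
          gcongr
          · linarith
          · exact hZ _
      _ ≤ Real.exp ((2 * E * K + 15 * Z) + L * 6) := by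
          refine Real.exp_le_exp.2 ?_
          nlinarith
      _ = _ := by rw [Real.exp_add, Real.rpow_def_of_pos hl0]
  have hpow : (4 * x) ^ σ ≤ 4 * x * Real.log x ^ (-C) := by
    have h4x : 0 < 4 * x := by linarith
    rw [hσ, sub_eq_add_neg, Real.rpow_add h4x, Real.rpow_one]
    gcongr
    rw [Real.rpow_def_of_pos h4x, Real.rpow_def_of_pos hl0]
    refine Real.exp_le_exp.2 ?_
    have h1 : Real.log x ≤ Real.log (4 * x) := Real.log_le_log hx0 (by linarith)
    have h2 : C * L = Real.log x * (1 / w) := by rw [hw]; field_simp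
    have h3 : 0 ≤ 1 / w := by positivity
    nlinarith
  calc (4 * x) ^ σ * ∑ n ∈ S, ∏ p ∈ n.primeFactors, G p (n.factorization p)
      ≤ (4 * x * Real.log x ^ (-C))
        * (Real.exp (2 * E * K + 15 * Z) * Real.log x ^ (6 : ℝ)) := by
        refine mul_le_mul hpow (h.trans hprod) ?_ (by positivity)
        exact Finset.sum_nonneg fun n _ => Finset.prod_nonneg fun p _ => hG _ _
    _ = _ := by
        rw [sub_eq_add_neg 6 C, Real.rpow_add hl0]; ring

end EulerProduct

/-! ### Choice of the sieve parameters -/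

section SieveParameters

theorem tendsto_log_log_atTop :
    Filter.Tendsto (fun x : ℝ => Real.log (Real.log x)) Filter.atTop Filter.atTop :=
  Real.tendsto_log_atTop.comp Real.tendsto_log_atTop

theorem eventually_mul_log_log_sq_le_log (C : ℝ) :
    ∀ᶠ x : ℝ in Filter.atTop, C * Real.log (Real.log x) ^ 2 ≤ Real.log x := by
  have h1 := ((Real.isLittleO_pow_log_id_atTop (n := 2)).comp_tendsto
    Real.tendsto_log_atTop).bound (show (0 : ℝ) < 1 / (|C| + 1) by positivity)
  filter_upwards [h1, Filter.eventually_ge_atTop (1 : ℝ)] with x hx hx1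
  simp only [Function.comp_apply, id, Real.norm_eq_abs, abs_pow, sq_abs] at hx
  rw [abs_of_nonneg (Real.log_nonneg hx1), one_div_mul_eq_div, le_div_iff₀ (by positivity)] at hx
  have := le_abs_self C
  nlinarith [sq_nonneg (Real.log (Real.log x))]

theorem Finset.sum_union_le_of_nonneg {s t : Finset ℕ} {f : ℕ → ℝ} (hf : ∀ i, 0 ≤ f i) :
    ∑ i ∈ s ∪ t, f i ≤ ∑ i ∈ s, f i + ∑ i ∈ t, f i := by
  rw [← Finset.sum_union_inter]
  exact le_add_of_nonneg_right (Finset.sum_nonneg fun i _ => hf i)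

theorem singularFactor_eq_exp (a : ℕ) :
    singularFactor a = Real.exp (∑ q ∈ a.primeFactors, 4 / (q : ℝ)) := by
  rw [singularFactor, Real.exp_sum]

/-- The sieve density is about 2c(q)/q, so by Mertens the main factor is about 1/(log Y)², where Y
is the sieving limit. The truncation error needs r of size L, and the remainder Y^(6r) must stay
well below T; this forces log Y to be of order log x / L², whence L⁴/(log x)². -/
theorem exists_card_sieved_box_le {c : ℕ → ℝ} (hc : ∀ p, 0 ≤ c p ∧ c p ≤ 2) (hM : HasMertens c)
    {C : ℝ} (hC : 0 < C) :
    ∃ K : ℝ, 0 < K ∧ ∀ᶠ x : ℝ in Filter.atTop, ∀ (a : ℕ)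
      (Ω : ∀ q : ℕ, Finset (ZMod q × ZMod q)), a ≠ 0 →
      (∀ q : ℕ, q.Prime → q ≠ 2 → ¬ q ∣ a → 2 * c q / q - 6 / (q : ℝ) ^ 2
        ≤ (Ω q).card / (q : ℝ) ^ 2 ∧ (Ω q).card / (q : ℝ) ^ 2 ≤ 2 * c q / q) →
      ∀ (T : ℕ) (u v : ℤ) (S : Finset (ℤ × ℤ)),
      Real.exp (Real.log x / (2 * (C * Real.log (Real.log x)))) ≤ T →
      S ⊆ Finset.Ico u (u + T) ×ˢ Finset.Ico v (v + T) →
      (∀ s ∈ S, ∀ q : ℕ, q.Prime → q ≠ 2 → ¬ q ∣ a →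
        (q : ℝ) ≤ Real.exp (Real.log x / (C * Real.log (Real.log x))) →
        ((s.1 : ZMod q), (s.2 : ZMod q)) ∉ Ω q) →
      (S.card : ℝ) ≤ K * ((T : ℝ) ^ 2 * (Real.log (Real.log x) ^ 4 / Real.log x ^ 2)
        * singularFactor a) := by
  obtain ⟨K₁, hK₁⟩ := hM
  have hK₁0 : 0 ≤ K₁ := (abs_nonneg _).trans (hK₁ 2 le_rfl)
  obtain ⟨Z, hZ0, hZ⟩ := sum_inv_rpow_le (s := 2) (by norm_num)
  set A := 57600 * C ^ 2 * Real.exp (2 * K₁ + 2 + 6 * Z) with hA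
  set B := Real.exp (6 * K₁) with hB
  refine ⟨A + B + 9, by positivity, ?_⟩
  filter_upwards [eventually_mul_log_log_sq_le_log (240 * C),
    tendsto_log_log_atTop.eventually_ge_atTop 1,
    tendsto_log_log_atTop.eventually_ge_atTop (1 / C), Filter.eventually_ge_atTop (3 : ℝ)]
    with x hx1 hL1 hLC hx3
  intro a Ω ha hΩ T u v S hT hS hSΩ
  set L := Real.log (Real.log x) with hL
  set l := Real.log x with hl
  have hL0 : 0 < L := by linarith
  have hl0 : 0 < l := Real.log_pos (by linarith)
  have hexpL : Real.exp L = l := Real.exp_log hl0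
  have hCL : 1 ≤ C * L := by rwa [div_le_iff₀' hC] at hLC
  -- Since r ≤ 5L, this makes Y^(6r) ≤ exp(30 L w) = exp(l/(4CL)), the square root of the assumed
  -- lower bound for T.
  set w := l / (120 * C * L ^ 2) with hw
  have hw2 : 2 ≤ w := by
    rw [hw, le_div_iff₀ (by positivity)]; linarith
  have hwl : w ≤ l := by
    rw [hw]
    refine div_le_self hl0.le ?_
    nlinarith
  have hwC : w ≤ l / (C * L) := by
    rw [hw]
    refine div_le_div_of_nonneg_left hl0.le (by positivity) ?_
    nlinarith
  set Y := ⌊Real.exp w⌋₊ with hY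
  have hYle : (Y : ℝ) ≤ Real.exp w := Nat.floor_le (Real.exp_pos w).le
  have hexpw := Real.add_one_le_exp w
  have hYlt := Nat.lt_floor_add_one (Real.exp w)
  have hY2 : (2 : ℝ) ≤ Y := by
    have : 2 ≤ Y := Nat.le_floor (by push_cast; linarith)
    exact_mod_cast this
  have hYlog : w / 2 ≤ Real.log Y := by
    have h1 : Real.exp w / 2 ≤ Y := by
      rw [← hY] at hYlt
      linarith
    have h2 := Real.log_le_log (by positivity) h1
    rw [Real.log_div (Real.exp_pos w).ne' (by norm_num), Real.log_exp] at h2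
    linarith [Real.log_two_lt_d9]
  have hYlog' : Real.log Y ≤ w := by
    rw [← Real.log_exp w]; exact Real.log_le_log (by linarith) hYle
  set P := (Nat.primesLE Y).filter fun q => q ≠ 2 ∧ ¬ q ∣ a with hP
  have hPmem : ∀ q ∈ P, q.Prime ∧ q ≤ Y ∧ q ≠ 2 ∧ ¬ q ∣ a := by
    intro q hq
    obtain ⟨h1, h2, h3⟩ := Finset.mem_filter.1 hq
    exact ⟨(Nat.mem_primesLE.1 h1).2, (Nat.mem_primesLE.1 h1).1, h2, h3⟩
  have hT1 : 1 ≤ T := by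
    have h1 : (1 : ℝ) ≤ T := le_trans (Real.one_le_exp (by positivity)) hT
    exact_mod_cast h1
  set r := ⌈4 * L⌉₊ with hr
  have hr1 : 4 * L ≤ r := Nat.le_ceil _
  have hr2 : (r : ℝ) ≤ 5 * L := by
    have := (Nat.ceil_lt_add_one (show 0 ≤ 4 * L by positivity)).le
    linarith
  have main := card_le_of_sieved_box P Y (fun q hq => ⟨(hPmem q hq).1, (hPmem q hq).2.1⟩) Ω u v T
    hT1 r (by exact_mod_cast (by linarith : (1 : ℝ) ≤ Y)) S hS (by
      intro s hs q hq
      obtain ⟨h1, h2, h3, h4⟩ := hPmem q hq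
      refine hSΩ s hs q h1 h3 h4 ?_
      calc (q : ℝ) ≤ Y := by exact_mod_cast h2
        _ ≤ Real.exp w := hYle
        _ ≤ _ := Real.exp_le_exp.2 hwC)
  set g : ℕ → ℝ := fun q => (Ω q).card / (q : ℝ) ^ 2 with hg
  have hg0 : ∀ q, 0 ≤ g q := fun q => by positivity
  have hcq : ∀ q : ℕ, 0 ≤ c q / (q : ℝ) := fun q => div_nonneg (hc q).1 q.cast_nonneg
  have hmer := abs_le.1 (hK₁ Y hY2)
  rw [Nat.floor_natCast] at hmer
  have hup : ∑ q ∈ P, g q ≤ 2 * L + 2 * K₁ := by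
    have h1 : ∑ q ∈ P, g q ≤ ∑ q ∈ P, 2 * (c q / q) := by
      refine Finset.sum_le_sum fun q hq => ?_
      obtain ⟨h1, h2, h3, h4⟩ := hPmem q hq
      have := (hΩ q h1 h3 h4).2
      rwa [mul_div_assoc] at this
    have h2 : ∑ q ∈ P, 2 * (c q / q) ≤ ∑ q ∈ Nat.primesLE Y, 2 * (c q / q) :=
      Finset.sum_le_sum_of_subset_of_nonneg (Finset.filter_subset _ _)
        fun q _ _ => by have := hcq q; positivity
    rw [← Finset.mul_sum] at h1
    rw [← Finset.mul_sum, ← Finset.mul_sum] at h2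
    have h3 : Real.log (Real.log Y) ≤ L :=
      Real.log_le_log (by linarith) (hYlog'.trans hwl)
    linarith [hmer.2]
  -- Leaving out q = 2 loses at most 2, and each q ∣ a loses at most 2c(q)/q ≤ 4/q; the latter is
  -- what `singularFactor a` compensates.
  have hlow : 2 * (Real.log (Real.log Y) - K₁) - 2 - 6 * Z - ∑ q ∈ a.primeFactors, 4 / (q : ℝ)
      ≤ ∑ q ∈ P, g q := by
    have h1 : ∑ q ∈ P, (2 * (c q / q) - 6 * (1 / (q : ℝ) ^ (2 : ℝ))) ≤ ∑ q ∈ P, g q := by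
      refine Finset.sum_le_sum fun q hq => ?_
      obtain ⟨h1, h2, h3, h4⟩ := hPmem q hq
      have := (hΩ q h1 h3 h4).1
      rw [Real.rpow_two]
      rwa [mul_div_assoc, ← mul_one_div (6 : ℝ)] at this
    rw [Finset.sum_sub_distrib, ← Finset.mul_sum, ← Finset.mul_sum] at h1
    have h2 : ∑ q ∈ Nat.primesLE Y, c q / (q : ℝ)
        ≤ ∑ q ∈ P, c q / q + (∑ q ∈ ({2} : Finset ℕ), c q / (q : ℝ)
          + ∑ q ∈ a.primeFactors, c q / (q : ℝ)) := by
      refine le_trans ?_ ((Finset.sum_union_le_of_nonneg hcq).trans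
        (add_le_add le_rfl (Finset.sum_union_le_of_nonneg hcq)))
      refine Finset.sum_le_sum_of_subset_of_nonneg ?_ fun q _ _ => hcq q
      intro q hq
      have hqp := (Nat.mem_primesLE.1 hq).2
      simp only [Finset.mem_union, Finset.mem_singleton, hP, Finset.mem_filter,
        Nat.mem_primeFactors]
      tauto
    have h3 : ∑ q ∈ a.primeFactors, c q / (q : ℝ) ≤ ∑ q ∈ a.primeFactors, 2 / (q : ℝ) :=
      Finset.sum_le_sum fun q _ => by have := (hc q).2; gcongr
    have h4 : ∑ q ∈ a.primeFactors, 4 / (q : ℝ) = 2 * ∑ q ∈ a.primeFactors, 2 / (q : ℝ) := by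
      rw [Finset.mul_sum]; refine Finset.sum_congr rfl fun q _ => by ring
    rw [Finset.sum_singleton] at h2
    have h5 := (hc 2).2
    have h6 := hZ P
    rw [h4]
    push_cast at h2
    linarith [hmer.1]
  have hprod : ∏ q ∈ P, (1 - g q) ≤ A * (L ^ 4 / l ^ 2) * singularFactor a := by
    calc ∏ q ∈ P, (1 - g q) ≤ ∏ q ∈ P, Real.exp (-g q) := by
          refine Finset.prod_le_prod (fun q hq => ?_) fun q _ => ?_
          · have hqp := (hPmem q hq).1
            have : NeZero q := ⟨hqp.ne_zero⟩
            have hcard : ((Ω q).card : ℝ) ≤ (q : ℝ) ^ 2 := by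
              have := Finset.card_le_univ (Ω q)
              rw [Fintype.card_prod, ZMod.card, ← pow_two] at this
              exact_mod_cast this
            rw [sub_nonneg]
            exact div_le_one_of_le₀ hcard (by positivity)
          · linarith [Real.add_one_le_exp (-g q)]
      _ = Real.exp (-∑ q ∈ P, g q) := by rw [← Real.exp_sum, Finset.sum_neg_distrib]
      _ ≤ Real.exp ((2 * K₁ + 2 + 6 * Z) + ∑ q ∈ a.primeFactors, 4 / (q : ℝ)
            - 2 * Real.log (Real.log Y)) := Real.exp_le_exp.2 (by linarith)
      _ = Real.exp (2 * K₁ + 2 + 6 * Z) * singularFactor a * (1 / Real.log Y ^ 2) := by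
          rw [Real.exp_sub, Real.exp_add, ← singularFactor_eq_exp]
          have : Real.exp (2 * Real.log (Real.log Y)) = Real.log Y ^ 2 := by
            rw [two_mul, Real.exp_add, Real.exp_log (by linarith), pow_two]
          rw [this]; ring
      _ ≤ Real.exp (2 * K₁ + 2 + 6 * Z) * singularFactor a * (1 / (w / 2) ^ 2) := by
          have := (zero_le_one.trans (one_le_singularFactor a))
          gcongr
      _ = _ := by
          rw [hA, hw]; field_simp; ring
  have hexp : Real.exp (-(2 * r) + Real.exp 1 * ∑ q ∈ P, g q) ≤ B * (1 / l ^ 2) := by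
    have h0 : 0 ≤ ∑ q ∈ P, g q := Finset.sum_nonneg fun q _ => hg0 q
    have h1 : Real.exp 1 * ∑ q ∈ P, g q ≤ 3 * (2 * L + 2 * K₁) :=
      mul_le_mul Real.exp_one_lt_three.le hup h0 (by norm_num)
    have h2 : B * (1 / l ^ 2) = Real.exp (6 * K₁ - 2 * L) := by
      rw [Real.exp_sub, ← hB, two_mul L, Real.exp_add, hexpL, pow_two]; ring
    rw [h2]
    exact Real.exp_le_exp.2 (by linarith)
  have hrem : 9 * T * (Y : ℝ) ^ (6 * r) ≤ 9 * (T : ℝ) ^ 2 * (1 / l ^ 2) := by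
    have h1 : (Y : ℝ) ^ (6 * r) ≤ Real.exp (l / (4 * (C * L))) := by
      calc (Y : ℝ) ^ (6 * r) ≤ Real.exp w ^ (6 * r) := by gcongr
        _ = Real.exp ((6 * r : ℕ) * w) := by rw [Real.exp_nat_mul]
        _ ≤ _ := by
          refine Real.exp_le_exp.2 ?_
          have : l / (4 * (C * L)) = 30 * L * w := by rw [hw]; field_simp; norm_num
          rw [this]
          push_cast
          exact mul_le_mul_of_nonneg_right (by linarith) (by linarith)
    have h2 : Real.exp (l / (4 * (C * L))) ≤ T * (1 / l ^ 2) := by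
      have h3 : 1 / l ^ 2 = Real.exp (-(2 * L)) := by
        rw [Real.exp_neg, two_mul, Real.exp_add, hexpL, pow_two, one_div]
      rw [h3]
      calc Real.exp (l / (4 * (C * L)))
          ≤ Real.exp (l / (2 * (C * L))) * Real.exp (-(2 * L)) := by
            rw [← Real.exp_add]
            refine Real.exp_le_exp.2 ?_
            have h4 : l / (2 * (C * L)) = l / (4 * (C * L)) + l / (4 * (C * L)) := by
              field_simp; norm_num
            have h5 : 2 * L ≤ l / (4 * (C * L)) := by
              rw [le_div_iff₀ (by positivity)]; nlinarith
            linarith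
        _ ≤ _ := by gcongr
    calc 9 * T * (Y : ℝ) ^ (6 * r) ≤ 9 * T * (T * (1 / l ^ 2)) := by
          gcongr; exact h1.trans h2
      _ = _ := by ring
  refine main.trans ?_
  have hs1 := one_le_singularFactor a
  have hLl : 1 / l ^ 2 ≤ L ^ 4 / l ^ 2 * singularFactor a := by
    have : 1 / l ^ 2 ≤ L ^ 4 / l ^ 2 := by gcongr; exact one_le_pow₀ hL1
    exact this.trans (le_mul_of_one_le_right (by positivity) hs1)
  calc (T : ℝ) ^ 2 * (∏ q ∈ P, (1 - g q) + Real.exp (-(2 * r) + Real.exp 1 * ∑ q ∈ P, g q))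
        + 9 * T * (Y : ℝ) ^ (6 * r)
      ≤ (T : ℝ) ^ 2 * (A * (L ^ 4 / l ^ 2) * singularFactor a + B * (1 / l ^ 2))
        + 9 * (T : ℝ) ^ 2 * (1 / l ^ 2) := by gcongr
    _ = (T : ℝ) ^ 2 * (A * (L ^ 4 / l ^ 2 * singularFactor a) + (B + 9) * (1 / l ^ 2)) := by ring
    _ ≤ (T : ℝ) ^ 2 * (A * (L ^ 4 / l ^ 2 * singularFactor a)
        + (B + 9) * (L ^ 4 / l ^ 2 * singularFactor a)) := by gcongr
    _ = _ := by ring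

end SieveParameters

/-! ### Counting Gaussian integers of given norm -/

section GaussianNorm

theorem GaussianInt.norm_eq_sq_add_sq (α : GaussianInt) : α.norm = α.re ^ 2 + α.im ^ 2 := by
  rw [Zsqrtd.norm_def]; ring

theorem GaussianInt.finite_setOf_norm_eq (n : ℤ) : {α : GaussianInt | α.norm = n}.Finite := by
  have hinj : Function.Injective fun α : GaussianInt => (α.re, α.im) := by
    intro α β h
    rw [Prod.mk.injEq] at h
    exact Zsqrtd.ext h.1 h.2
  refine Set.Finite.of_finite_image (f := fun α : GaussianInt => (α.re, α.im)) ?_ hinj.injOn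
  refine (Set.finite_Icc ((-n, -n) : ℤ × ℤ) (n, n)).subset ?_
  rintro _ ⟨α, hα, rfl⟩
  simp only [Set.mem_ofPred_eq, GaussianInt.norm_eq_sq_add_sq] at hα
  simp only [Set.mem_Icc, Prod.mk_le_mk]
  refine ⟨⟨?_, ?_⟩, ?_, ?_⟩ <;> nlinarith [sq_nonneg α.re, sq_nonneg α.im,
    sq_nonneg (α.re - 1), sq_nonneg (α.im - 1), sq_nonneg (α.re + 1), sq_nonneg (α.im + 1)]

/-- The number of Gaussian integers of norm `n`. -/
noncomputable def gaussianNormCount (n : ℕ) : ℕ := {α : GaussianInt | α.norm = n}.ncard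

theorem GaussianInt.prime_of_norm_eq {π : GaussianInt} {p : ℕ} (hp : p.Prime) (h : π.norm = p) :
    Prime π := by
  rw [← irreducible_iff_prime]
  refine ⟨fun hu => ?_, fun a b hab => ?_⟩
  · rw [← Zsqrtd.norm_eq_one_iff, h] at hu
    simp at hu
    exact hp.one_lt.ne' hu
  · have h1 : a.norm.natAbs * b.norm.natAbs = p := by
      rw [← Int.natAbs_mul, ← Zsqrtd.norm_mul, ← hab, h]; simp
    rw [← Zsqrtd.norm_eq_one_iff, ← Zsqrtd.norm_eq_one_iff]
    have h2 := (Nat.prime_mul_iff.1 (h1 ▸ hp : (a.norm.natAbs * b.norm.natAbs).Prime))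
    rcases h2 with h2 | h2
    · exact Or.inr h2.2
    · exact Or.inl h2.2

theorem GaussianInt.exists_norm_eq {p : ℕ} (hp : p.Prime) (h : p % 4 ≠ 3) :
    ∃ π : GaussianInt, π.norm = p := by
  have := Fact.mk hp
  obtain ⟨a, b, hab⟩ := Nat.Prime.sq_add_sq h
  refine ⟨⟨a, b⟩, ?_⟩
  rw [GaussianInt.norm_eq_sq_add_sq, ← hab]
  push_cast
  rfl

theorem GaussianInt.dvd_or_star_dvd {π α : GaussianInt} {p : ℕ} (hp : p.Prime) (h : π.norm = p)
    (hd : (p : ℤ) ∣ α.norm) : π ∣ α ∨ star π ∣ α := by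
  have hπ := GaussianInt.prime_of_norm_eq hp h
  have h1 : π ∣ α * star α := by
    have h2 : π ∣ ((p : ℤ) : GaussianInt) := ⟨star π, by rw [← h, Zsqrtd.norm_eq_mul_conj]⟩
    have h3 : ((p : ℤ) : GaussianInt) ∣ ((α.norm : ℤ) : GaussianInt) :=
      map_dvd (Int.castRingHom GaussianInt) hd
    rw [← Zsqrtd.norm_eq_mul_conj]
    exact h2.trans h3
  rcases hπ.dvd_or_dvd h1 with h2 | h2
  · exact Or.inl h2
  · right
    obtain ⟨β, hβ⟩ := h2
    exact ⟨star β, by rw [← star_star α, hβ, star_mul, mul_comm]⟩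

theorem GaussianInt.natCast_dvd_of_mod_four_eq_three {α : GaussianInt} {p : ℕ} (hp : p.Prime)
    (h : p % 4 = 3) (hd : (p : ℤ) ∣ α.norm) : (p : GaussianInt) ∣ α := by
  have := Fact.mk hp
  have hprime : Prime (p : GaussianInt) := GaussianInt.prime_of_nat_prime_of_mod_four_eq_three p h
  have h1 : (p : GaussianInt) ∣ α * star α := by
    rw [← Zsqrtd.norm_eq_mul_conj]
    have h2 := map_dvd (Int.castRingHom GaussianInt) hd
    rwa [eq_intCast, eq_intCast, Int.cast_natCast] at h2
  rcases hprime.dvd_or_dvd h1 with h2 | h2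
  · exact h2
  · obtain ⟨β, hβ⟩ := h2
    refine ⟨star β, ?_⟩
    rw [← star_star α, hβ, star_mul, star_natCast, mul_comm]

theorem GaussianInt.norm_natCast (p : ℕ) : (p : GaussianInt).norm = (p : ℤ) ^ 2 := by
  rw [Zsqrtd.norm_natCast, pow_two]

/-- The divisor is a prime element above q: q itself, of norm q², if q ≡ 3 mod 4, and otherwise a
factor π or its conjugate, of norm q. -/
theorem GaussianInt.exists_dvd_of_prime_dvd_norm {α : GaussianInt} {q : ℕ} (hq : q.Prime)
    (hd : (q : ℤ) ∣ α.norm) : ∃ β, β ∣ α ∧ (β.norm = q ∨ β.norm = (q : ℤ) ^ 2) := by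
  by_cases h : q % 4 = 3
  · exact ⟨q, GaussianInt.natCast_dvd_of_mod_four_eq_three hq h hd,
      Or.inr (GaussianInt.norm_natCast q)⟩
  · obtain ⟨π, hπ⟩ := GaussianInt.exists_norm_eq hq h
    rcases GaussianInt.dvd_or_star_dvd hq hπ hd with h1 | h1
    · exact ⟨π, h1, Or.inl hπ⟩
    · exact ⟨star π, h1, Or.inl (by rw [Zsqrtd.norm_conj, hπ])⟩

theorem gaussianNormCount_one_le : gaussianNormCount 1 ≤ 4 := by
  have hsub : {α : GaussianInt | α.norm = (1 : ℕ)} ⊆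
      (({⟨1, 0⟩, ⟨-1, 0⟩, ⟨0, 1⟩, ⟨0, -1⟩} : Finset GaussianInt) : Set GaussianInt) := by
    intro α hα
    simp only [Set.mem_ofPred_eq, GaussianInt.norm_eq_sq_add_sq, Nat.cast_one] at hα
    have h1 : α.re ≤ 1 := by nlinarith [sq_nonneg α.im]
    have h2 : -1 ≤ α.re := by nlinarith [sq_nonneg α.im]
    have h3 : α.im ≤ 1 := by nlinarith [sq_nonneg α.re]
    have h4 : -1 ≤ α.im := by nlinarith [sq_nonneg α.re]
    obtain ⟨a, b⟩ := α
    dsimp only at *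
    interval_cases a <;> interval_cases b <;> simp_all
  refine (Set.ncard_le_ncard hsub (Finset.finite_toSet _)).trans ?_
  rw [Set.ncard_coe_finset]
  exact Finset.card_le_four

theorem GaussianInt.eq_mul_pow_mul_pow {π : GaussianInt} {p a : ℕ} (hp : p.Prime) (hπ : π.norm = p)
    (n : ℕ) (α : GaussianInt) (hα : α.norm = (p ^ n * a : ℕ)) :
    ∃ j ∈ Finset.range (n + 1), ∃ β : GaussianInt,
      β.norm = a ∧ π ^ j * star π ^ (n - j) * β = α := by
  have hp0 : (p : ℤ) ≠ 0 := by exact_mod_cast hp.ne_zero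
  induction n generalizing α with
  | zero => exact ⟨0, by simp, α, by simpa using hα, by simp⟩
  | succ n ih =>
    have hd : (p : ℤ) ∣ α.norm := by
      rw [hα]; push_cast; rw [pow_succ']; exact ⟨p ^ n * a, by ring⟩
    rcases GaussianInt.dvd_or_star_dvd hp hπ hd with ⟨α', rfl⟩ | ⟨α', rfl⟩
    · rw [Zsqrtd.norm_mul, hπ] at hα
      obtain ⟨j, hj, β, hβ, rfl⟩ := ih α' (by
        apply mul_left_cancel₀ hp0
        rw [hα]; push_cast; ring)
      rw [Finset.mem_range] at hj
      refine ⟨j + 1, Finset.mem_range.2 (by omega), β, hβ, ?_⟩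
      rw [show n + 1 - (j + 1) = n - j by omega]; ring
    · rw [Zsqrtd.norm_mul, Zsqrtd.norm_conj, hπ] at hα
      obtain ⟨j, hj, β, hβ, rfl⟩ := ih α' (by
        apply mul_left_cancel₀ hp0
        rw [hα]; push_cast; ring)
      rw [Finset.mem_range] at hj
      refine ⟨j, Finset.mem_range.2 (by omega), β, hβ, ?_⟩
      rw [show n + 1 - j = n - j + 1 by omega]; ring

theorem gaussianNormCount_prime_pow_mul_le {p : ℕ} (hp : p.Prime) (h : p % 4 ≠ 3) (n a : ℕ) :
    gaussianNormCount (p ^ n * a) ≤ (n + 1) * gaussianNormCount a := by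
  classical
  obtain ⟨π, hπ⟩ := GaussianInt.exists_norm_eq hp h
  set B := (GaussianInt.finite_setOf_norm_eq a).toFinset with hB
  have hsub : {α : GaussianInt | α.norm = (p ^ n * a : ℕ)} ⊆
      (((Finset.range (n + 1)).biUnion fun j => B.image fun β => π ^ j * star π ^ (n - j) * β :
        Finset GaussianInt) : Set GaussianInt) := by
    intro α hα
    obtain ⟨j, hj, β, hβ, h⟩ := GaussianInt.eq_mul_pow_mul_pow hp hπ n α hα
    rw [Finset.mem_coe, Finset.mem_biUnion]
    exact ⟨j, hj, Finset.mem_image.2 ⟨β, by simpa [hB] using hβ, h⟩⟩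
  refine (Set.ncard_le_ncard hsub (Finset.finite_toSet _)).trans ?_
  rw [Set.ncard_coe_finset]
  refine Finset.card_biUnion_le.trans ?_
  refine (Finset.sum_le_card_nsmul _ _ (gaussianNormCount a) fun j _ => ?_).trans ?_
  · refine Finset.card_image_le.trans (le_of_eq ?_)
    rw [gaussianNormCount, Set.ncard_eq_toFinset_card _ (GaussianInt.finite_setOf_norm_eq a)]
  · simp

/-- The prime 2 ramifies: 1 + i and its conjugate are associates, so the n + 1 shapes of
`GaussianInt.eq_mul_pow_mul_pow` collapse to one. The bound n + 1 would not do at n = 1, where the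
weight is 1 + χ₄(2) = 1. -/
theorem gaussianNormCount_two_pow_mul_le (n a : ℕ) :
    gaussianNormCount (2 ^ n * a) ≤ gaussianNormCount a := by
  classical
  set π : GaussianInt := ⟨1, 1⟩ with hπ
  have hn : π.norm = (2 : ℕ) := by rw [GaussianInt.norm_eq_sq_add_sq]; rfl
  have hstar : star π = π * ⟨0, -1⟩ := by rw [hπ]; decide
  have hsub : {α : GaussianInt | α.norm = (2 ^ n * a : ℕ)} ⊆
      (fun β => π ^ n * β) '' {α : GaussianInt | α.norm = a} := by
    intro α hα
    obtain ⟨j, hj, β, hβ, h⟩ := GaussianInt.eq_mul_pow_mul_pow Nat.prime_two hn n α hα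
    rw [Finset.mem_range] at hj
    refine ⟨⟨0, -1⟩ ^ (n - j) * β, ?_, ?_⟩
    · have h1 : ∀ k : ℕ, ((⟨0, -1⟩ : GaussianInt) ^ k).norm = 1 := by
        intro k
        induction k with
        | zero => simp
        | succ k ih => rw [pow_succ, Zsqrtd.norm_mul, ih]; rfl
      rw [Set.mem_ofPred_eq, Zsqrtd.norm_mul, h1, one_mul, hβ]
    · rw [← h, hstar, mul_pow]
      have : π ^ n = π ^ j * π ^ (n - j) := by rw [← pow_add]; congr 1; omega
      dsimp only
      rw [this]; ring
  have hfin := GaussianInt.finite_setOf_norm_eq a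
  exact (Set.ncard_le_ncard hsub (hfin.image _)).trans (Set.ncard_image_le hfin)

theorem gaussianNormCount_prime_mul_eq_zero {p a : ℕ} (hp : p.Prime) (h : p % 4 = 3)
    (ha : ¬ p ∣ a) : gaussianNormCount (p * a) = 0 := by
  rw [gaussianNormCount, Set.ncard_eq_zero (GaussianInt.finite_setOf_norm_eq _)]
  refine Set.eq_empty_of_forall_notMem fun α hα => ha ?_
  rw [Set.mem_ofPred_eq] at hα
  obtain ⟨β, rfl⟩ := GaussianInt.natCast_dvd_of_mod_four_eq_three (α := α) hp h
    (by rw [hα]; push_cast; exact ⟨a, rfl⟩)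
  rw [Zsqrtd.norm_mul, GaussianInt.norm_natCast] at hα
  have hp0 : (p : ℤ) ≠ 0 := by exact_mod_cast hp.ne_zero
  have : (p : ℤ) * β.norm = a := by
    apply mul_left_cancel₀ hp0
    push_cast at hα
    rw [← hα]; ring
  exact_mod_cast (Dvd.intro _ this : (p : ℤ) ∣ a)

theorem gaussianNormCount_prime_sq_mul_le {p : ℕ} (hp : p.Prime) (h : p % 4 = 3) (a : ℕ) :
    gaussianNormCount (p ^ 2 * a) ≤ gaussianNormCount a := by
  have hp0 : ((p : ℤ) ^ 2) ≠ 0 := by exact_mod_cast pow_ne_zero 2 hp.ne_zero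
  have hsub : {α : GaussianInt | α.norm = (p ^ 2 * a : ℕ)} ⊆
      (fun β => (p : GaussianInt) * β) '' {α : GaussianInt | α.norm = a} := by
    intro α hα
    rw [Set.mem_ofPred_eq] at hα
    obtain ⟨β, rfl⟩ := GaussianInt.natCast_dvd_of_mod_four_eq_three (α := α) hp h
      (by rw [hα]; push_cast; exact ⟨p * a, by ring⟩)
    refine ⟨β, ?_, rfl⟩
    rw [Zsqrtd.norm_mul, GaussianInt.norm_natCast] at hα
    push_cast at hα
    exact mul_left_cancel₀ hp0 hα
  have hfin := GaussianInt.finite_setOf_norm_eq a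
  exact (Set.ncard_le_ncard hsub (hfin.image _)).trans (Set.ncard_image_le hfin)

theorem gaussianNormCount_inert_pow_mul_le {p a : ℕ} (hp : p.Prime) (h : p % 4 = 3)
    (ha : ¬ p ∣ a) (n : ℕ) : gaussianNormCount (p ^ n * a) ≤ gaussianNormCount a := by
  induction n using Nat.strong_induction_on with
  | _ n ih =>
    match n with
    | 0 => simp
    | 1 => rw [pow_one, gaussianNormCount_prime_mul_eq_zero hp h ha]; exact Nat.zero_le _
    | n + 2 =>
      rw [show p ^ (n + 2) * a = p ^ 2 * (p ^ n * a) by ring]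
      exact (gaussianNormCount_prime_sq_mul_le hp h _).trans (ih n (by omega))

theorem arithWeight_prime_pow_mul (c : ℕ → ℝ) {p a n : ℕ} (hp : p.Prime) (hpa : ¬ p ∣ a)
    (hn : 0 < n) (ha : a ≠ 0) :
    arithWeight c (p ^ n * a) = localWeight c p n * arithWeight c a := by
  have hpf : p ∉ a.primeFactors := fun h => hpa (Nat.dvd_of_mem_primeFactors h)
  have hpn : p ^ n ≠ 0 := pow_ne_zero _ hp.ne_zero
  rw [arithWeight, Nat.primeFactors_mul hpn ha, Nat.primeFactors_prime_pow hn.ne' hp,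
    ← Finset.insert_eq, Finset.prod_insert hpf, Nat.factorization_mul hpn ha,
    hp.factorization_pow, arithWeight]
  congr 1
  · congr 1
    simp [Nat.factorization_eq_zero_of_not_dvd hpa]
  · refine Finset.prod_congr rfl fun q hq => ?_
    have : q ≠ p := fun h => hpf (h ▸ hq)
    congr 1
    simp [this.symm]

theorem chi_four_add_one_bounds (p : ℕ) :
    0 ≤ 1 + ((ZMod.χ₄ p : ℤ) : ℝ) ∧ 1 + ((ZMod.χ₄ p : ℤ) : ℝ) ≤ 2 := by
  have := abs_le.1 (abs_chi_four_le_one p)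
  constructor <;> linarith [this.1, this.2]

/-- The factor 4 counts the units. The rest is a comparison at each prime power: split primes give n
+ 1, the prime 2 gives 1, and inert primes give 0 for n = 1 and at most 1 otherwise. -/
theorem gaussianNormCount_le (n : ℕ) (hn : n ≠ 0) :
    (gaussianNormCount n : ℝ) ≤ 4 * arithWeight (fun p => 1 + ((ZMod.χ₄ p : ℤ) : ℝ)) n := by
  set c : ℕ → ℝ := fun p => 1 + ((ZMod.χ₄ p : ℤ) : ℝ) with hc
  have hc0 : ∀ p, 0 ≤ c p := fun p => (chi_four_add_one_bounds p).1
  induction n using Nat.recOnPrimePow with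
  | zero => exact absurd rfl hn
  | one => simpa [arithWeight] using gaussianNormCount_one_le
  | prime_pow_mul a p n hp hpa hn' ih =>
    have ha : a ≠ 0 := right_ne_zero_of_mul hn
    have ih := ih ha
    rw [arithWeight_prime_pow_mul c hp hpa hn' ha]
    have key : (gaussianNormCount (p ^ n * a) : ℝ) ≤ localWeight c p n * gaussianNormCount a := by
      have hg : (0 : ℝ) ≤ gaussianNormCount a := Nat.cast_nonneg _
      by_cases h3 : p % 4 = 3
      · by_cases hn1 : n = 1
        · rw [hn1, pow_one, gaussianNormCount_prime_mul_eq_zero hp h3 hpa]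
          have := localWeight_nonneg hc0 p 1
          push_cast
          positivity
        · rw [localWeight, if_neg hn1]
          have h1 : (gaussianNormCount (p ^ n * a) : ℝ) ≤ gaussianNormCount a := by
            exact_mod_cast gaussianNormCount_inert_pow_mul_le hp h3 hpa n
          nlinarith [Nat.cast_nonneg (α := ℝ) n]
      · rcases hp.eq_two_or_odd with h2 | h2
        · subst h2
          have h1 : (gaussianNormCount (2 ^ n * a) : ℝ) ≤ gaussianNormCount a := by
            exact_mod_cast gaussianNormCount_two_pow_mul_le n a
          have h4 : 1 ≤ localWeight c 2 n := by
            rw [localWeight]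
            split_ifs
            · have : ZMod.χ₄ ((2 : ℕ) : ZMod 4) = 0 := by rw [ZMod.χ₄_nat_eq_if_mod_four]; simp
              simp only [hc, this]; simp
            · linarith [Nat.cast_nonneg (α := ℝ) n]
          nlinarith
        · have h1 : (gaussianNormCount (p ^ n * a) : ℝ) ≤ (n + 1) * gaussianNormCount a := by
            exact_mod_cast gaussianNormCount_prime_pow_mul_le hp h3 n a
          have h4 : localWeight c p n = n + 1 := by
            rw [localWeight]
            split_ifs with hn1
            · have : ZMod.χ₄ (p : ZMod 4) = 1 := ZMod.χ₄_nat_one_mod_four (by omega)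
              simp only [hc, this, hn1]; norm_num
            · rfl
          rwa [h4]
    have := localWeight_nonneg hc0 p n
    calc (gaussianNormCount (p ^ n * a) : ℝ) ≤ localWeight c p n * gaussianNormCount a := key
      _ ≤ localWeight c p n * (4 * arithWeight c a) := by gcongr
      _ = _ := by ring

end GaussianNorm

/-! ### Densities of the sieved residue classes -/

section ResidueFamilies

open Classical in
/-- The finite set of residue pairs modulo `q` satisfying a predicate (empty for `q = 0`). -/
noncomputable def residuePairs (R : ∀ q : ℕ, ZMod q × ZMod q → Prop) (q : ℕ) :
    Finset (ZMod q × ZMod q) :=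
  if h : q = 0 then ∅ else haveI : NeZero q := ⟨h⟩; Finset.univ.filter (R q)

theorem mem_residuePairs (R : ∀ q : ℕ, ZMod q × ZMod q → Prop) (q : ℕ) [NeZero q]
    (w : ZMod q × ZMod q) : w ∈ residuePairs R q ↔ R q w := by
  simp [residuePairs, NeZero.ne q]

open Classical in
theorem card_residuePairs (R : ∀ q : ℕ, ZMod q × ZMod q → Prop) (q : ℕ) [NeZero q] :
    (residuePairs R q).card + (Finset.univ.filter fun w => ¬ R q w).card = q ^ 2 := by
  have h : residuePairs R q = Finset.univ.filter (R q) := by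
    ext w; simp [mem_residuePairs]
  rw [h, Finset.card_filter_add_card_filter_not, Finset.card_univ, Fintype.card_prod, ZMod.card,
    pow_two]

variable {F : Type*} [Field F] [Fintype F] [DecidableEq F]

theorem card_filter_not_linear (a : F) (ha : a ≠ 0) :
    (Finset.univ.filter fun w : F × F => ¬ (w.1 = 0 ∨ a * w.1 = 1)).card
      = (Fintype.card F - 2) * Fintype.card F := by
  have h : (Finset.univ.filter fun w : F × F => ¬ (w.1 = 0 ∨ a * w.1 = 1))
      = ({0, a⁻¹} : Finset F)ᶜ ×ˢ Finset.univ := by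
    ext w
    have : a * w.1 = 1 ↔ w.1 = a⁻¹ := by
      rw [mul_comm]; exact ⟨fun h => eq_inv_of_mul_eq_one_left h, fun h => by rw [h]; field_simp⟩
    simp [this]
  rw [h, Finset.card_product, Finset.card_compl, Finset.card_univ,
    Finset.card_pair (inv_ne_zero ha).symm]

/-- Over a field containing i, the coordinates z = u + iv and z' = u - iv split both norms: they
become zz' and (Az + 1)(Bz' + 1) with A, B ≠ 0. Each coordinate therefore avoids exactly two values.
-/
theorem card_filter_not_gaussian (h2 : (2 : F) ≠ 0) (i s t : F) (hi : i ^ 2 = -1)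
    (hst : s ^ 2 + t ^ 2 ≠ 0) :
    (Finset.univ.filter fun w : F × F => ¬ (w.1 ^ 2 + w.2 ^ 2 = 0 ∨
      (s * w.1 - t * w.2 + 1) ^ 2 + (s * w.2 + t * w.1) ^ 2 = 0)).card
      = (Fintype.card F - 2) ^ 2 := by
  have hi0 : i ≠ 0 := by rintro rfl; norm_num at hi
  have hfac : s ^ 2 + t ^ 2 = (s + t * i) * (s - t * i) := by linear_combination t ^ 2 * hi
  set A := s + t * i with hA
  set B := s - t * i with hB
  have hA0 : A ≠ 0 := left_ne_zero_of_mul (hfac ▸ hst)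
  have hB0 : B ≠ 0 := right_ne_zero_of_mul (hfac ▸ hst)
  rw [pow_two]
  have hc : ∀ z : F, z ≠ 0 → (({0, z} : Finset F)ᶜ).card = Fintype.card F - 2 := fun z hz => by
    rw [Finset.card_compl, Finset.card_pair hz.symm]
  have hcA := hc (-A⁻¹) (by simpa using hA0)
  have hcB := hc (-B⁻¹) (by simpa using hB0)
  have e1 : ∀ u v : F, u ^ 2 + v ^ 2 = (u + i * v) * (u - i * v) := fun u v => by
    linear_combination v ^ 2 * hi
  have e2 : ∀ u v : F, (s * u - t * v + 1) ^ 2 + (s * v + t * u) ^ 2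
      = (A * (u + i * v) + 1) * (B * (u - i * v) + 1) := fun u v => by
    rw [hA, hB]
    linear_combination (-(2 * (s * u - t * v + 1) * t * v + t ^ 2 * v ^ 2 * (i ^ 2 + 1)
      - (s * v + t * u) ^ 2)) * hi
  have e3 : ∀ z : F × F, (z.1 + z.2) / 2 + i * ((z.1 - z.2) / (2 * i)) = z.1 := fun z => by
    field_simp; ring
  have e4 : ∀ z : F × F, (z.1 + z.2) / 2 - i * ((z.1 - z.2) / (2 * i)) = z.2 := fun z => by
    field_simp; ring
  nth_rewrite 1 [← hcA]
  rw [← hcB]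
  rw [← Finset.card_product]
  refine Finset.card_bij' (fun w _ => (w.1 + i * w.2, w.1 - i * w.2))
    (fun z _ => ((z.1 + z.2) / 2, (z.1 - z.2) / (2 * i))) ?_ ?_ ?_ ?_
  · intro w hw
    rw [Finset.mem_filter, not_or] at hw
    obtain ⟨_, h1, h3⟩ := hw
    rw [e1] at h1
    rw [e2] at h3
    simp only [Finset.mem_product, Finset.mem_compl, Finset.mem_insert, Finset.mem_singleton,
      not_or]
    refine ⟨⟨left_ne_zero_of_mul h1, fun h => left_ne_zero_of_mul h3 ?_⟩,
      right_ne_zero_of_mul h1, fun h => right_ne_zero_of_mul h3 ?_⟩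
    · rw [h]; field_simp; ring
    · rw [h]; field_simp; ring
  · intro z hz
    simp only [Finset.mem_product, Finset.mem_compl, Finset.mem_insert, Finset.mem_singleton,
      not_or] at hz
    obtain ⟨⟨h1, h3⟩, h4, h5⟩ := hz
    rw [Finset.mem_filter, not_or]
    refine ⟨Finset.mem_univ _, ?_, ?_⟩
    · rw [e1, e3, e4]; exact mul_ne_zero h1 h4
    · rw [e2, e3, e4]
      refine mul_ne_zero (fun h => h3 ?_) (fun h => h5 ?_)
      · rw [eq_neg_iff_add_eq_zero]
        field_simp
        linear_combination h
      · rw [eq_neg_iff_add_eq_zero]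
        field_simp
        linear_combination h
  · intro w _
    ext <;> dsimp only <;> field_simp <;> ring
  · intro z _
    exact Prod.ext (e3 z) (e4 z)

/-- The residues `(m, v)` for which `m` or `a * m - 1` vanishes. -/
def linearResidue (a : ℕ) (q : ℕ) (w : ZMod q × ZMod q) : Prop :=
  w.1 = 0 ∨ (a : ZMod q) * w.1 = 1

/-- For `q ≡ 1 mod 4`, the residues `β = u + v i` for which the norm of `β` or of `α * β + 1`
vanishes. -/
def gaussianResidue (α : GaussianInt) (q : ℕ) (w : ZMod q × ZMod q) : Prop :=
  q % 4 = 1 ∧ (w.1 ^ 2 + w.2 ^ 2 = 0 ∨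
    ((α.re : ZMod q) * w.1 - (α.im : ZMod q) * w.2 + 1) ^ 2
      + ((α.re : ZMod q) * w.2 + (α.im : ZMod q) * w.1) ^ 2 = 0)

theorem linearResidue_density (a q : ℕ) (hq : q.Prime) (hqa : ¬ q ∣ a) :
    2 * (1 : ℝ) / q - 6 / (q : ℝ) ^ 2 ≤ (residuePairs (linearResidue a) q).card / (q : ℝ) ^ 2 ∧
      (residuePairs (linearResidue a) q).card / (q : ℝ) ^ 2 ≤ 2 * (1 : ℝ) / q := by
  classical
  have := Fact.mk hq
  have ha : (a : ZMod q) ≠ 0 := by rwa [Ne, ZMod.natCast_eq_zero_iff]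
  have h1 := card_residuePairs (linearResidue a) q
  have h2 := card_filter_not_linear (F := ZMod q) a ha
  rw [ZMod.card] at h2
  have h3 : (Finset.univ.filter fun w => ¬ linearResidue a q w).card = (q - 2) * q := by
    rw [← h2]; congr 1; ext w; simp [linearResidue]
  rw [h3] at h1
  have hq2 := hq.two_le
  have hq0 : (0 : ℝ) < q := by exact_mod_cast hq.pos
  have h4 : ((residuePairs (linearResidue a) q).card : ℝ) = 2 * q := by
    have h5 : ((residuePairs (linearResidue a) q).card : ℝ) + ((q : ℝ) - 2) * q = (q : ℝ) ^ 2 := by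
      rw [← Nat.cast_two, ← Nat.cast_sub hq2]
      exact_mod_cast h1
    linarith
  have h6 : (2 * q : ℝ) / (q : ℝ) ^ 2 = 2 * 1 / q := by field_simp
  rw [h4, h6]
  exact ⟨by linarith [show (0 : ℝ) ≤ 6 / (q : ℝ) ^ 2 by positivity], le_rfl⟩

/-- For q ≡ 1 mod 4 the count is q² - (q - 2)² = 4q - 4. For q ≡ 3 mod 4 nothing is sieved, in
agreement with 1 + χ₄(q) = 0. -/
theorem gaussianResidue_density (α : GaussianInt) (q : ℕ) (hq : q.Prime) (hq2 : q ≠ 2)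
    (hqa : ¬ q ∣ α.norm.natAbs) :
    2 * (1 + ((ZMod.χ₄ q : ℤ) : ℝ)) / q - 6 / (q : ℝ) ^ 2
        ≤ (residuePairs (gaussianResidue α) q).card / (q : ℝ) ^ 2 ∧
      (residuePairs (gaussianResidue α) q).card / (q : ℝ) ^ 2
        ≤ 2 * (1 + ((ZMod.χ₄ q : ℤ) : ℝ)) / q := by
  classical
  have := Fact.mk hq
  have hodd := hq.eq_two_or_odd.resolve_left hq2
  have hq0 : (0 : ℝ) < q := by exact_mod_cast hq.pos
  by_cases h4 : q % 4 = 1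
  · have hχ : ZMod.χ₄ (q : ZMod 4) = 1 := ZMod.χ₄_nat_one_mod_four h4
    obtain ⟨i, hi⟩ : IsSquare (-1 : ZMod q) := by
      rw [FiniteField.isSquare_neg_one_iff, ZMod.card]; omega
    have h2 : (2 : ZMod q) ≠ 0 := by
      have : ringChar (ZMod q) ≠ 2 := by rwa [ZMod.ringChar_zmod_n]
      exact Ring.two_ne_zero this
    have hst : (α.re : ZMod q) ^ 2 + (α.im : ZMod q) ^ 2 ≠ 0 := by
      have h5 : ((α.norm : ℤ) : ZMod q) ≠ 0 := by
        rw [Ne, ZMod.intCast_zmod_eq_zero_iff_dvd]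
        rwa [← Int.natCast_dvd] at hqa
      rw [GaussianInt.norm_eq_sq_add_sq] at h5
      exact_mod_cast h5
    have h1 := card_residuePairs (gaussianResidue α) q
    have h5 := card_filter_not_gaussian h2 i α.re α.im (by rw [pow_two, ← hi]) hst
    rw [ZMod.card] at h5
    have h3 : (Finset.univ.filter fun w => ¬ gaussianResidue α q w).card = (q - 2) ^ 2 := by
      rw [← h5]; congr 1; ext w; simp [gaussianResidue, h4]
    rw [h3] at h1
    have h6 : ((residuePairs (gaussianResidue α) q).card : ℝ) = 4 * q - 4 := by
      have h7 : ((residuePairs (gaussianResidue α) q).card : ℝ) + ((q : ℝ) - 2) ^ 2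
          = (q : ℝ) ^ 2 := by
        rw [← Nat.cast_two, ← Nat.cast_sub hq.two_le]
        exact_mod_cast h1
      linarith
    have h7 : (4 * q - 4 : ℝ) / (q : ℝ) ^ 2 = 4 / q - 4 / (q : ℝ) ^ 2 := by field_simp
    have h8 : (4 : ℝ) / (q : ℝ) ^ 2 ≤ 6 / (q : ℝ) ^ 2 := by gcongr; norm_num
    have h9 : (0 : ℝ) ≤ 4 / (q : ℝ) ^ 2 := by positivity
    have h10 : 2 * (1 + ((1 : ℤ) : ℝ)) = 4 := by norm_num
    rw [h6, h7, hχ, h10]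
    constructor <;> linarith
  · have hχ : ZMod.χ₄ (q : ZMod 4) = -1 := ZMod.χ₄_nat_three_mod_four (by omega)
    have h6 : residuePairs (gaussianResidue α) q = ∅ := by
      ext w; simp [mem_residuePairs, gaussianResidue, h4]
    rw [h6, hχ]
    norm_num
    positivity

end ResidueFamilies

/-! ### The counting argument in a monoid with norm -/

section Counting

open ArithmeticFunction

theorem sum_comp_le_sum_mul_of_card_fiber_le {ι : Type*} (ν : ι → ℕ) (w : ℕ → ℝ)
    (S : Finset ι) (M : Finset ℕ) (F : ℕ → ℝ) (hF : ∀ m ∈ M, 0 ≤ F m) (hS : ∀ α ∈ S, ν α ∈ M)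
    (hw : ∀ m ∈ M, ((S.filter fun α => ν α = m).card : ℝ) ≤ w m) :
    ∑ α ∈ S, F (ν α) ≤ ∑ m ∈ M, w m * F m := by
  rw [← Finset.sum_fiberwise_of_maps_to hS]
  refine Finset.sum_le_sum fun m hm => ?_
  have : ∑ α ∈ S with ν α = m, F (ν α) = ∑ α ∈ S with ν α = m, F m :=
    Finset.sum_congr rfl fun α hα => by rw [(Finset.mem_filter.1 hα).2]
  rw [this, Finset.sum_const, nsmul_eq_mul]
  exact mul_le_mul_of_nonneg_right (hw m hm) (hF m hm)

theorem cardDistinctFactors_mul_prime_pow (m q k : ℕ) (hm : m ≠ 0) (hq : q.Prime) :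
    cardDistinctFactors m ≤ cardDistinctFactors (m * q ^ k) ∧
      cardDistinctFactors (m * q ^ k) ≤ cardDistinctFactors m + 1 := by
  have e : ∀ n : ℕ, cardDistinctFactors n = n.primeFactors.card := fun n => by
    rw [cardDistinctFactors_apply, ← List.card_toFinset]; rfl
  rw [e, e, Nat.primeFactors_mul hm (pow_ne_zero _ hq.ne_zero)]
  refine ⟨Finset.card_le_card Finset.subset_union_left, (Finset.card_union_le _ _).trans ?_⟩
  have : (q ^ k).primeFactors ⊆ {q} := by
    rcases eq_or_ne k 0 with rfl | hk
    · simp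
    · rw [Nat.primeFactors_prime_pow hk hq]
  have := Finset.card_le_card this
  rw [Finset.card_singleton] at this
  omega

theorem rpow_log_log_eq {γ l : ℝ} (hγ : 0 < γ) (hl : 0 < l) :
    γ ^ (-(γ * Real.log l)) = l ^ (-(γ * Real.log γ)) := by
  rw [Real.rpow_def_of_pos hγ, Real.rpow_def_of_pos hl]
  congr 1; ring

variable {ι : Type*} [CommMonoid ι]

/-- The set Q is covered by three pieces: p ≤ √x, smooth norms, and the rest. In the rest e(p) = αβ
with β above a prime exceeding y; the sieve hypothesis counts the p with the same α, and the
weighted Euler product sums over α. -/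
theorem exists_card_le_of_sieve (ν : ι →* ℕ) {c : ℕ → ℝ} (hc : ∀ p, 0 ≤ c p ∧ c p ≤ 2)
    (hM : HasMertens c)
    (hfib : ∀ m : ℕ, m ≠ 0 → ∀ S : Finset ι, (∀ α ∈ S, ν α = m) →
      (S.card : ℝ) ≤ 4 * arithWeight c m)
    (hdvd : ∀ (α : ι) (q : ℕ), q.Prime → q ∣ ν α → ∃ β, β ∣ α ∧ (ν β = q ∨ ν β = q ^ 2))
    {γ C K₀ : ℝ} (hγ : 0 < γ) (hC : 8 + |γ * Real.log γ| ≤ C) (hK₀ : 0 < K₀) :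
    ∃ K : ℝ, 0 < K ∧ ∀ᶠ x : ℝ in Filter.atTop, ∀ (Q : Finset ℕ) (e : ℕ → ι), Set.InjOn e Q →
      (∀ p ∈ Q, (p : ℝ) ≤ x ∧ ν (e p) ≠ 0 ∧ (ν (e p) : ℝ) ≤ 4 * x ∧
        1 ≤ γ ^ ((cardDistinctFactors (ν (e p)) : ℝ) - γ * Real.log (Real.log x))) →
      (∀ α : ι, ν α ≠ 0 →
        (ν α : ℝ) ≤ 4 * x / Real.exp (Real.log x / (C * Real.log (Real.log x))) →
        ∀ Q' ⊆ Q, (∀ p ∈ Q', √x < p ∧ ∃ (β : ι) (q : ℕ), q.Prime ∧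
          Real.exp (Real.log x / (C * Real.log (Real.log x))) < q ∧
          (ν β = q ∨ ν β = q ^ 2) ∧ e p = α * β) →
        (Q'.card : ℝ) ≤ K₀ * (x / ν α * (Real.log (Real.log x) ^ 4 / Real.log x ^ 2)
          * singularFactor (ν α))) →
      (Q.card : ℝ) ≤ K * (x * Real.log (Real.log x) ^ 4
        / Real.log x ^ (2 + γ * Real.log γ - γ)) := by
  classical
  have hC0 : 0 < C := by linarith [abs_nonneg (γ * Real.log γ)]
  obtain ⟨K₁, hK₁, h₁⟩ := exists_sum_arithWeight_le hc hM hγ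
  obtain ⟨K₂, hK₂, h₂⟩ := exists_sum_smooth_arithWeight_le hc hC0
  set E := 2 + γ * Real.log γ - γ with hE
  -- Passing from e(p) to α removes a power of one prime, so ω drops by at most 1 and the weight
  -- changes by a factor at most max(1, γ).
  set G := max 1 γ with hG
  have hG1 : 1 ≤ G := le_max_left _ _
  have hsqrt : ∀ᶠ x : ℝ in Filter.atTop, √x + 1 ≤ 2 * (x / Real.log x ^ E) := by
    have h3 := (isLittleO_log_rpow_rpow_atTop E (show (0 : ℝ) < 1 / 2 by norm_num)).bound
      one_pos
    filter_upwards [h3, Filter.eventually_ge_atTop (3 : ℝ)] with x hx hx3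
    have hl0 : 0 < Real.log x := Real.log_pos (by linarith)
    rw [Real.norm_of_nonneg (by positivity), Real.norm_of_nonneg (by positivity), one_mul,
      ← Real.sqrt_eq_rpow] at hx
    have h4 : 1 ≤ √x := Real.one_le_sqrt.2 (by linarith)
    have h5 : √x * √x = x := Real.mul_self_sqrt (by linarith)
    have h6 : √x ≤ x / Real.log x ^ E := by
      rw [le_div_iff₀ (by positivity)]
      calc √x * Real.log x ^ E ≤ √x * √x := by gcongr
        _ = x := h5
    linarith
  refine ⟨2 + 4 * K₂ + K₀ * (4 * K₁) * G, by positivity, ?_⟩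
  filter_upwards [h₂, hsqrt, Filter.eventually_ge_atTop (3 : ℝ),
    tendsto_log_log_atTop.eventually_ge_atTop 1, eventually_mul_log_log_sq_le_log (2 * C)]
    with x hsmooth hsq hx3 hL1 hlC Q e he hQ hsieve
  set L := Real.log (Real.log x) with hL
  set l := Real.log x with hl
  set y := Real.exp (l / (C * L)) with hy
  have hx0 : 0 < x := by linarith
  have hL0 : 0 < L := by linarith
  have hl0 : 0 < l := Real.log_pos (by linarith)
  have hl1 : 1 ≤ l := by
    by_contra h
    have : L ≤ 0 := Real.log_nonpos hl0.le (by linarith)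
    linarith
  have hy4 : 4 ≤ y := by
    have h3 : 2 ≤ l / (C * L) := by
      rw [le_div_iff₀ (by positivity)]; nlinarith
    have h4 : Real.exp 2 ≤ y := Real.exp_le_exp.2 h3
    have h5 : Real.exp 2 = Real.exp 1 * Real.exp 1 := by rw [← Real.exp_add]; norm_num
    have h6 := Real.add_one_le_exp 1
    nlinarith
  set Q₁ := Q.filter fun p : ℕ => (p : ℝ) ≤ √x with hQ₁
  set Q₂ := Q.filter fun p : ℕ => ∀ q : ℕ, q ∈ (ν (e p)).primeFactors → (q : ℝ) ≤ y with hQ₂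
  set Q₃ := Q.filter fun p : ℕ => √x < (p : ℝ) ∧
    ¬ ∀ q : ℕ, q ∈ (ν (e p)).primeFactors → (q : ℝ) ≤ y with hQ₃
  have hunion : Q ⊆ Q₁ ∪ (Q₂ ∪ Q₃) := by
    intro p hp
    simp only [Finset.mem_union, hQ₁, hQ₂, hQ₃, Finset.mem_filter, hp, true_and]
    rcases le_or_gt (p : ℝ) (√x) with h | h <;> tauto
  have hcard : (Q.card : ℝ) ≤ Q₁.card + (Q₂.card + Q₃.card) := by
    exact_mod_cast (Finset.card_le_card hunion).trans ((Finset.card_union_le _ _).trans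
      (Nat.add_le_add_left (Finset.card_union_le _ _) _))
  have hL4 : 1 ≤ L ^ 4 := one_le_pow₀ hL1
  have hB0 : 0 < x / l ^ E := by positivity
  have hB : x / l ^ E ≤ x * L ^ 4 / l ^ E := by
    gcongr; exact le_mul_of_one_le_right hx0.le hL4
  have hc₁ : (Q₁.card : ℝ) ≤ 2 * (x * L ^ 4 / l ^ E) := by
    have h3 : Q₁ ⊆ Finset.range (⌊√x⌋₊ + 1) := by
      intro p hp
      have := (Finset.mem_filter.1 hp).2
      rw [Finset.mem_range, Nat.lt_succ_iff]
      exact Nat.le_floor this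
    have h4 : (Q₁.card : ℝ) ≤ ⌊√x⌋₊ + 1 := by
      have := Finset.card_le_card h3
      rw [Finset.card_range] at this
      exact_mod_cast this
    have h5 := Nat.floor_le (Real.sqrt_nonneg x)
    linarith
  have hc₂ : (Q₂.card : ℝ) ≤ 4 * K₂ * (x * L ^ 4 / l ^ E) := by
    set M := (Finset.Icc 1 ⌊4 * x⌋₊).filter fun n => ∀ p : ℕ, p ∈ n.primeFactors → (p : ℝ) ≤ y
      with hMdef
    have h3 := sum_comp_le_sum_mul_of_card_fiber_le ν (fun m => 4 * arithWeight c m)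
      (Q₂.image e) M (fun _ => 1)
      (fun _ _ => zero_le_one) (by
        intro α hα
        obtain ⟨p, hp, rfl⟩ := Finset.mem_image.1 hα
        obtain ⟨hpQ, hps⟩ := Finset.mem_filter.1 hp
        obtain ⟨-, h4, h5, -⟩ := hQ p hpQ
        exact Finset.mem_filter.2 ⟨Finset.mem_Icc.2 ⟨Nat.one_le_iff_ne_zero.2 h4,
          Nat.le_floor h5⟩, hps⟩)
      (by
        intro m hm
        have hm1 := (Finset.mem_Icc.1 (Finset.mem_filter.1 hm).1).1
        exact hfib m (by omega) _ fun α hα => (Finset.mem_filter.1 hα).2)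
    have h4 : (Q₂.image e).card = Q₂.card :=
      Finset.card_image_of_injOn (he.mono (Finset.coe_subset.2 (Finset.filter_subset _ _)))
    simp only [Finset.sum_const, nsmul_eq_mul, mul_one, h4, ← Finset.mul_sum] at h3
    -- This is where C ≥ 8 + |γ log γ| is needed.
    have h5 : l ^ (6 - C) ≤ l ^ (-E) := by
      refine Real.rpow_le_rpow_of_exponent_le hl1 ?_
      have := le_abs_self (γ * Real.log γ)
      rw [hE]; linarith
    rw [Real.rpow_neg hl0.le] at h5
    calc (Q₂.card : ℝ) ≤ 4 * ∑ m ∈ M, arithWeight c m := h3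
      _ ≤ 4 * (K₂ * (x * l ^ (6 - C))) := by gcongr
      _ ≤ 4 * (K₂ * (x * (l ^ E)⁻¹)) := by gcongr
      _ = 4 * K₂ * (x / l ^ E) := by rw [div_eq_mul_inv]; ring
      _ ≤ _ := by gcongr
  have hc₃ : (Q₃.card : ℝ) ≤ K₀ * (4 * K₁) * G * (x * L ^ 4 / l ^ E) := by
    have hex : ∀ p ∈ Q₃, ∃ α : ι, ν α ≠ 0 ∧ (ν α : ℝ) ≤ 4 * x / y ∧
        cardDistinctFactors (ν α) ≤ cardDistinctFactors (ν (e p)) ∧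
        cardDistinctFactors (ν (e p)) ≤ cardDistinctFactors (ν α) + 1 ∧
        ∃ (β : ι) (q : ℕ), q.Prime ∧ y < q ∧ (ν β = q ∨ ν β = q ^ 2) ∧ e p = α * β := by
      intro p hp
      obtain ⟨hpQ, -, hns⟩ := Finset.mem_filter.1 hp
      push Not at hns
      obtain ⟨q, hq, hyq⟩ := hns
      obtain ⟨-, h4, h5, -⟩ := hQ p hpQ
      have hqp := Nat.prime_of_mem_primeFactors hq
      obtain ⟨β, ⟨α, hα⟩, hβ⟩ := hdvd (e p) q hqp (Nat.dvd_of_mem_primeFactors hq)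
      rw [mul_comm] at hα
      have hmul : ν (e p) = ν α * ν β := by rw [hα, map_mul]
      have hα0 : ν α ≠ 0 := left_ne_zero_of_mul (hmul ▸ h4)
      obtain ⟨k, hk, hk0⟩ : ∃ k, ν β = q ^ k ∧ k ≠ 0 := by
        rcases hβ with h | h
        · exact ⟨1, by rw [h, pow_one], one_ne_zero⟩
        · exact ⟨2, h, two_ne_zero⟩
      have hω := cardDistinctFactors_mul_prime_pow (ν α) q k hα0 hqp
      rw [← hk, ← hmul] at hω
      refine ⟨α, hα0, ?_, hω.1, hω.2, β, q, hqp, hyq, hβ, hα⟩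
      rw [le_div_iff₀ (by positivity)]
      have h6 : y ≤ ν β := by
        have : q ≤ ν β := by rw [hk]; exact Nat.le_self_pow hk0 q
        have : (q : ℝ) ≤ ν β := by exact_mod_cast this
        linarith
      calc (ν α : ℝ) * y ≤ ν α * ν β := by gcongr
        _ = ν (e p) := by rw [hmul]; push_cast; ring
        _ ≤ _ := h5
    choose! f hf using hex
    have hterm : ∀ p ∈ Q₃, (1 : ℝ) ≤ G * l ^ (-(γ * Real.log γ)) *
        γ ^ cardDistinctFactors (ν (f p)) := by
      intro p hp
      obtain ⟨-, -, h3, h4, -⟩ := hf p hp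
      have h5 := (hQ p (Finset.mem_filter.1 hp).1).2.2.2
      rw [sub_eq_add_neg, Real.rpow_add hγ, rpow_log_log_eq hγ hl0, Real.rpow_natCast] at h5
      have h6 : γ ^ cardDistinctFactors (ν (e p)) ≤ G * γ ^ cardDistinctFactors (ν (f p)) := by
        rcases h3.eq_or_lt with h | h
        · rw [← h]; exact le_mul_of_one_le_left (by positivity) hG1
        · rw [show cardDistinctFactors (ν (e p)) = cardDistinctFactors (ν (f p)) + 1 by omega,
            pow_succ']
          gcongr
          exact le_max_right _ _
      calc (1 : ℝ) ≤ _ := h5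
        _ ≤ G * γ ^ cardDistinctFactors (ν (f p)) * l ^ (-(γ * Real.log γ)) := by gcongr
        _ = _ := by ring
    have hsum1 : (Q₃.card : ℝ) ≤ G * l ^ (-(γ * Real.log γ)) *
        ∑ p ∈ Q₃, γ ^ cardDistinctFactors (ν (f p)) := by
      rw [Finset.mul_sum]
      calc (Q₃.card : ℝ) = ∑ p ∈ Q₃, (1 : ℝ) := by simp
        _ ≤ _ := Finset.sum_le_sum hterm
    have hsum2 : ∑ p ∈ Q₃, γ ^ cardDistinctFactors (ν (f p))
        ≤ ∑ α ∈ Q₃.image f, (fun m : ℕ => γ ^ cardDistinctFactors m *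
          (K₀ * (x / m * (L ^ 4 / l ^ 2) * singularFactor m))) (ν α) := by
      rw [← Finset.sum_fiberwise_of_maps_to (t := Q₃.image f) (g := f)
        fun p hp => Finset.mem_image_of_mem f hp]
      refine Finset.sum_le_sum fun α hα => ?_
      have h3 : ∑ p ∈ Q₃ with f p = α, γ ^ cardDistinctFactors (ν (f p))
          = ∑ p ∈ Q₃ with f p = α, γ ^ cardDistinctFactors (ν α) :=
        Finset.sum_congr rfl fun p hp => by rw [(Finset.mem_filter.1 hp).2]
      rw [h3, Finset.sum_const, nsmul_eq_mul, mul_comm]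
      obtain ⟨p₀, hp₀, rfl⟩ := Finset.mem_image.1 hα
      obtain ⟨h4, h5, -⟩ := hf p₀ hp₀
      refine mul_le_mul_of_nonneg_left (hsieve (f p₀) h4 h5 _ ?_ ?_) (by positivity)
      · exact (Finset.filter_subset _ _).trans (Finset.filter_subset _ _)
      · intro p hp
        obtain ⟨h6, h7⟩ := Finset.mem_filter.1 hp
        have h8 := (hf p h6).2.2.2.2
        rw [h7] at h8
        exact ⟨(Finset.mem_filter.1 h6).2.1, h8⟩
    have hsum3 := sum_comp_le_sum_mul_of_card_fiber_le ν (fun m => 4 * arithWeight c m) (Q₃.image f)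
      (Finset.Icc 1 ⌊x⌋₊) (fun m : ℕ => γ ^ cardDistinctFactors m *
          (K₀ * (x / m * (L ^ 4 / l ^ 2) * singularFactor m)))
      (by
        intro m _
        have := zero_le_one.trans (one_le_singularFactor m)
        positivity)
      (by
        intro α hα
        obtain ⟨p, hp, rfl⟩ := Finset.mem_image.1 hα
        obtain ⟨h4, h5, -⟩ := hf p hp
        refine Finset.mem_Icc.2 ⟨Nat.one_le_iff_ne_zero.2 h4, Nat.le_floor (h5.trans ?_)⟩
        rw [div_le_iff₀ (by positivity)]
        nlinarith)
      (by
        intro m hm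
        have hm1 := (Finset.mem_Icc.1 hm).1
        exact hfib m (by omega) _ fun α hα => (Finset.mem_filter.1 hα).2)
    have hsum4 : ∑ m ∈ Finset.Icc 1 ⌊x⌋₊, 4 * arithWeight c m * (γ ^ cardDistinctFactors m *
          (K₀ * (x / m * (L ^ 4 / l ^ 2) * singularFactor m)))
        = K₀ * 4 * x * (L ^ 4 / l ^ 2) * ∑ m ∈ Finset.Icc 1 ⌊x⌋₊,
          arithWeight c m * γ ^ cardDistinctFactors m * singularFactor m / m := by
      rw [Finset.mul_sum]
      refine Finset.sum_congr rfl fun m _ => ?_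
      ring
    have h5 := h₁ x (by linarith)
    have hpow : l ^ (-(γ * Real.log γ)) * (1 / l ^ 2) * l ^ γ = (l ^ E)⁻¹ := by
      rw [← Real.rpow_neg hl0.le, one_div, ← Real.rpow_natCast l 2, ← Real.rpow_neg hl0.le,
        ← Real.rpow_add hl0, ← Real.rpow_add hl0, hE]
      congr 1; push_cast; ring
    calc (Q₃.card : ℝ) ≤ G * l ^ (-(γ * Real.log γ)) * (K₀ * 4 * x * (L ^ 4 / l ^ 2) *
          (K₁ * l ^ γ)) := by
          refine hsum1.trans ?_
          gcongr
          refine hsum2.trans (hsum3.trans (hsum4.le.trans ?_))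
          gcongr
      _ = K₀ * (4 * K₁) * G * (x * L ^ 4) *
          (l ^ (-(γ * Real.log γ)) * (1 / l ^ 2) * l ^ γ) := by ring
      _ = _ := by rw [hpow, div_eq_mul_inv]; ring
  calc (Q.card : ℝ) ≤ _ := hcard
    _ ≤ 2 * (x * L ^ 4 / l ^ E) + (4 * K₂ * (x * L ^ 4 / l ^ E)
        + K₀ * (4 * K₁) * G * (x * L ^ 4 / l ^ E)) := add_le_add hc₁ (add_le_add hc₂ hc₃)
    _ = _ := by ring

end Counting

/-! ### Application to p + 1 and to π - 1 -/

section Application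

open ArithmeticFunction Filter

theorem exp_log_div_le_sqrt {x D : ℝ} (hx : 1 ≤ x) (hD : 2 ≤ D) :
    Real.exp (Real.log x / D) ≤ √x := by
  have h : √x = Real.exp (Real.log x / 2) := by
    rw [Real.exp_half, Real.exp_log (by linarith)]
  rw [h]
  refine Real.exp_le_exp.2 ?_
  have := Real.log_nonneg hx
  gcongr

theorem one_le_arithWeight_one (n : ℕ) : 1 ≤ arithWeight (fun _ => (1 : ℝ)) n := by
  refine Finset.one_le_prod fun p _ => ?_
  unfold localWeight
  split_ifs
  · exact le_rfl
  · exact le_add_of_nonneg_left (Nat.cast_nonneg _)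

theorem eq_of_prime_dvd_eq_or_eq_sq {r q m : ℕ} (hr : r.Prime) (hq : q.Prime)
    (hm : m = q ∨ m = q ^ 2) (h : r ∣ m) : r = q := by
  rcases hm with rfl | rfl
  · exact (Nat.prime_dvd_prime_iff_eq hr hq).1 h
  · exact (Nat.prime_dvd_prime_iff_eq hr hq).1 (hr.dvd_of_dvd_pow h)

/-- Here p + 1 = am and the sieve acts on m and am - 1 = p. To use the two-dimensional box estimate,
m is paired with a free second coordinate running over T values, and the resulting bound is divided
by T. -/
theorem exists_card_add_one_le {γ : ℝ} (hγ : 0 < γ) :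
    ∃ K : ℝ, 0 < K ∧ ∀ᶠ x : ℝ in atTop, ∀ Q : Finset ℕ,
      (∀ p ∈ Q, p.Prime ∧ (p : ℝ) ≤ x ∧
        1 ≤ γ ^ ((cardDistinctFactors (p + 1) : ℝ) - γ * Real.log (Real.log x))) →
      (Q.card : ℝ) ≤ K * (x * Real.log (Real.log x) ^ 4
        / Real.log x ^ (2 + γ * Real.log γ - γ)) := by
  classical
  set C := 8 + |γ * Real.log γ| with hC
  have hC8 : 8 ≤ C := by rw [hC]; linarith [abs_nonneg (γ * Real.log γ)]
  have hc : ∀ p : ℕ, 0 ≤ (fun _ : ℕ => (1 : ℝ)) p ∧ (fun _ : ℕ => (1 : ℝ)) p ≤ 2 := fun p => by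
    norm_num
  obtain ⟨K, hK, hbox⟩ := exists_card_sieved_box_le hc hasMertens_one (show 0 < C by linarith)
  obtain ⟨K', hK', hmain⟩ := exists_card_le_of_sieve (MonoidHom.id ℕ) hc hasMertens_one
    (fun m _ S hS => by
      have h1 : S.card ≤ 1 := Finset.card_le_one.2 fun a ha b hb => (hS a ha).trans (hS b hb).symm
      have h2 : (S.card : ℝ) ≤ 1 := by exact_mod_cast h1
      linarith [one_le_arithWeight_one m])
    (fun α q _ hd => ⟨q, hd, Or.inl rfl⟩) hγ hC.ge (show 0 < 8 * K by positivity)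
  refine ⟨K', hK', ?_⟩
  filter_upwards [hmain, hbox, eventually_ge_atTop 3, tendsto_log_log_atTop.eventually_ge_atTop 1]
    with x hmain hbox hx3 hL1 Q hQ
  have hlog : 0 < Real.log x := Real.log_pos (by linarith)
  set L := Real.log (Real.log x) with hL
  have hCL : 2 ≤ C * L := by nlinarith
  set y := Real.exp (Real.log x / (C * L)) with hy
  have hysqrt : y ≤ √x := exp_log_div_le_sqrt (by linarith) hCL
  have hy1 : 1 ≤ y := Real.one_le_exp (by positivity)
  refine hmain Q (fun p => p + 1) (fun a _ b _ h => Nat.succ_injective h) ?_ ?_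
  · intro p hp
    obtain ⟨-, h2, h3⟩ := hQ p hp
    refine ⟨h2, Nat.succ_ne_zero p, ?_, h3⟩
    simp only [MonoidHom.id_apply]; push_cast; linarith
  intro a ha hax Q' hQ' hfac
  simp only [MonoidHom.id_apply] at ha hax hfac ⊢
  have ha0 : (0 : ℝ) < a := by exact_mod_cast Nat.pos_of_ne_zero ha
  have hyX : y ≤ 4 * x / a := by
    rw [le_div_iff₀ ha0]; rw [le_div_iff₀ (by positivity)] at hax; linarith
  set T := ⌊4 * x / a⌋₊ + 1 with hT
  have hTlt : 4 * x / a < T := by rw [hT]; push_cast; exact Nat.lt_floor_add_one _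
  -- Rounding up at most doubles 4x/a, since 4x/a ≥ y ≥ 1.
  have hTle : (T : ℝ) ≤ 8 * (x / a) := by
    have := Nat.floor_le (show 0 ≤ 4 * x / a by positivity)
    rw [hT]; push_cast
    have h2 : 8 * (x / a) = 2 * (4 * x / a) := by ring
    linarith
  have hT0 : (0 : ℝ) < T := by linarith
  have hm : ∀ p ∈ Q', ∃ m : ℕ, p + 1 = a * m ∧ ∃ q : ℕ, q.Prime ∧ y < q ∧ (m = q ∨ m = q ^ 2) := by
    intro p hp
    obtain ⟨-, β, q, h1, h2, h3, h4⟩ := hfac p hp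
    exact ⟨β, h4, q, h1, h2, h3⟩
  choose! m hm hmq using hm
  have hminj : Set.InjOn m Q' := fun p hp p' hp' h => by
    have := (hm p hp).trans ((congrArg (a * ·) h).trans (hm p' hp').symm)
    omega
  set S : Finset (ℤ × ℤ) := (Q'.image fun p => (m p : ℤ)) ×ˢ Finset.Ico 0 (T : ℤ) with hS
  have hScard : S.card = Q'.card * T := by
    rw [hS, Finset.card_product, Finset.card_image_of_injOn
      (fun p hp p' hp' h => hminj hp hp' (by exact_mod_cast h)), Int.card_Ico]
    simp
  have hb := hbox a (residuePairs (linearResidue a)) ha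
    (fun q hq _ hqa => linearResidue_density a q hq hqa) T 0 0 S ?_ ?_ ?_
  · rw [hScard] at hb
    push_cast at hb
    have h5 : (Q'.card : ℝ) ≤ K * (T * (L ^ 4 / Real.log x ^ 2) * singularFactor a) := by
      refine le_of_mul_le_mul_right ?_ hT0
      calc _ ≤ _ := hb
        _ = _ := by ring
    have hs := zero_le_one.trans (one_le_singularFactor a)
    calc (Q'.card : ℝ) ≤ _ := h5
      _ ≤ K * (8 * (x / a) * (L ^ 4 / Real.log x ^ 2) * singularFactor a) := by gcongr
      _ = _ := by ring
  · refine le_trans (Real.exp_le_exp.2 ?_) (hyX.trans hTlt.le)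
    have : 0 < C * L := by linarith
    refine div_le_div_of_nonneg_left hlog.le this (by linarith)
  · rw [zero_add, hS]
    refine Finset.product_subset_product_left fun z hz => ?_
    obtain ⟨p, hp, rfl⟩ := Finset.mem_image.1 hz
    refine Finset.mem_Ico.2 ⟨by positivity, ?_⟩
    have h1 : ((p : ℝ) + 1) = a * m p := by exact_mod_cast hm p hp
    have h2 := (hQ p (hQ' hp)).2.1
    have h3 : (m p : ℝ) ≤ 4 * x / a := by rw [le_div_iff₀ ha0]; linarith
    have h4 : (m p : ℝ) < T := h3.trans_lt hTlt
    exact_mod_cast h4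
  · intro s hs r hr _ _ hry hmem
    have : NeZero r := ⟨hr.ne_zero⟩
    rw [mem_residuePairs] at hmem
    obtain ⟨p, hp, hps⟩ := Finset.mem_image.1 (Finset.mem_product.1 hs).1
    obtain ⟨q, hq, hyq, hmp⟩ := hmq p hp
    rw [linearResidue] at hmem
    dsimp only at hmem
    rw [← hps] at hmem
    push_cast at hmem
    rcases hmem with h | h
    · rw [ZMod.natCast_eq_zero_iff] at h
      rw [eq_of_prime_dvd_eq_or_eq_sq hr hq hmp h] at hry
      linarith
    -- A sieving prime r dividing am - 1 = p must equal p, which is impossible because r ≤ y ≤ √x <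
    -- p.
    · have h1 : ((p : ℕ) : ZMod r) = 0 := by
        have : ((p + 1 : ℕ) : ZMod r) = ((a * m p : ℕ) : ZMod r) := by rw [hm p hp]
        push_cast at this
        rw [h] at this
        simpa using this
      rw [ZMod.natCast_eq_zero_iff, Nat.prime_dvd_prime_iff_eq hr (hQ p (hQ' hp)).1] at h1
      have := (hfac p hp).1
      rw [h1] at hry
      linarith

/-- The norm of a Gaussian integer as a natural number. -/
def gaussianNormHom : GaussianInt →* ℕ where
  toFun α := α.norm.natAbs
  map_one' := by simp
  map_mul' α β := by rw [Zsqrtd.norm_mul, Int.natAbs_mul]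

theorem gaussianNormHom_cast (α : GaussianInt) : ((gaussianNormHom α : ℕ) : ℤ) = α.norm :=
  Int.natAbs_of_nonneg (GaussianInt.norm_nonneg α)

/-- With e(p) = π - 1 = αβ, the coordinates of β lie in a square of side about 2√(4x/N(α)), and the
sieve acts on the norms of β and of αβ + 1 = π. -/
theorem exists_card_gaussian_le {γ : ℝ} (hγ : 0 < γ) :
    ∃ K : ℝ, 0 < K ∧ ∀ᶠ x : ℝ in atTop, ∀ (Q : Finset ℕ) (e : ℕ → GaussianInt),
      (∀ p ∈ Q, p.Prime ∧ (p : ℝ) ≤ x ∧ (e p + 1).norm = p ∧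
        1 ≤ γ ^ ((cardDistinctFactors (gaussianNormHom (e p)) : ℝ)
          - γ * Real.log (Real.log x))) →
      (Q.card : ℝ) ≤ K * (x * Real.log (Real.log x) ^ 4
        / Real.log x ^ (2 + γ * Real.log γ - γ)) := by
  classical
  set C := 8 + |γ * Real.log γ| with hC
  have hC8 : 8 ≤ C := by rw [hC]; linarith [abs_nonneg (γ * Real.log γ)]
  have hc := chi_four_add_one_bounds
  obtain ⟨K, hK, hbox⟩ := exists_card_sieved_box_le hc hasMertens_one_add_chi_four
    (show 0 < C by linarith)
  obtain ⟨K', hK', hmain⟩ := exists_card_le_of_sieve gaussianNormHom hc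
    hasMertens_one_add_chi_four
    (fun n hn S hS => by
      refine le_trans ?_ (gaussianNormCount_le n hn)
      rw [gaussianNormCount, ← Set.ncard_coe_finset S]
      have : (S : Set GaussianInt) ⊆ {α : GaussianInt | α.norm = n} := fun α hα => by
        rw [Set.mem_ofPred_eq, ← gaussianNormHom_cast, hS α hα]
      exact_mod_cast Set.ncard_le_ncard this (GaussianInt.finite_setOf_norm_eq n))
    (fun α q hq hd => by
      obtain ⟨β, h1, h2⟩ := GaussianInt.exists_dvd_of_prime_dvd_norm (α := α) hq (by
        rw [← gaussianNormHom_cast]; exact_mod_cast hd)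
      refine ⟨β, h1, ?_⟩
      rw [← gaussianNormHom_cast] at h2
      exact_mod_cast h2) hγ hC.ge (show 0 < 36 * K by positivity)
  refine ⟨K', hK', ?_⟩
  filter_upwards [hmain, hbox, eventually_ge_atTop 3, tendsto_log_log_atTop.eventually_ge_atTop 1]
    with x hmain hbox hx3 hL1 Q e hQ
  have hlog : 0 < Real.log x := Real.log_pos (by linarith)
  set L := Real.log (Real.log x) with hL
  have hCL : 2 ≤ C * L := by nlinarith
  set y := Real.exp (Real.log x / (C * L)) with hy
  have hysqrt : y ≤ √x := exp_log_div_le_sqrt (by linarith) hCL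
  have hy1 : 1 ≤ y := Real.one_le_exp (by positivity)
  have hinj : Set.InjOn e Q := fun p hp p' hp' h => by
    have h1 := (hQ p hp).2.2.1
    rw [h, (hQ p' hp').2.2.1] at h1
    exact_mod_cast h1.symm
  have hbound : ∀ p ∈ Q, gaussianNormHom (e p) ≠ 0 ∧ (gaussianNormHom (e p) : ℝ) ≤ 4 * x := by
    intro p hp
    obtain ⟨h1, h2, h3, -⟩ := hQ p hp
    constructor
    · intro h
      have h4 : (e p).norm = 0 := by rw [← gaussianNormHom_cast, h]; rfl
      rw [GaussianInt.norm_eq_zero.1 h4, zero_add, Zsqrtd.norm_one] at h3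
      exact h1.one_lt.ne (by exact_mod_cast h3)
    -- From p ≥ 1 one has 4p ≥ 2p + 2, and 2N(e + 1) + 2 - N(e) is the sum of squares (re e + 2)² +
    -- (im e)².
    · have h4 : (e p).norm ≤ 4 * p := by
        have h5 : (1 : ℤ) ≤ p := by exact_mod_cast h1.one_lt.le
        rw [GaussianInt.norm_eq_sq_add_sq] at h3 ⊢
        simp only [Zsqrtd.re_add, Zsqrtd.im_add, Zsqrtd.re_one, Zsqrtd.im_one] at h3
        nlinarith [sq_nonneg ((e p).re + 2), sq_nonneg (e p).im]
      rw [← gaussianNormHom_cast] at h4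
      have h5 : (gaussianNormHom (e p) : ℝ) ≤ 4 * p := by exact_mod_cast h4
      linarith
  refine hmain Q e hinj (fun p hp => ⟨(hQ p hp).2.1, (hbound p hp).1, (hbound p hp).2,
    (hQ p hp).2.2.2⟩) ?_
  intro α hα hax Q' hQ' hfac
  set a := gaussianNormHom α with ha
  have ha0 : (0 : ℝ) < a := by exact_mod_cast Nat.pos_of_ne_zero hα
  set X := 4 * x / a with hX
  have hyX : y ≤ X := by
    rw [hX, le_div_iff₀ ha0]; rw [le_div_iff₀ (by positivity)] at hax; linarith
  have hX0 : 0 < X := by linarith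
  have hX1 : 1 ≤ √X := Real.one_le_sqrt.2 (by linarith)
  set U := ⌊√X⌋₊ with hU
  set T := 2 * U + 1 with hT
  have hUlt : √X < U + 1 := Nat.lt_floor_add_one _
  have hUle : (U : ℝ) ≤ √X := Nat.floor_le (Real.sqrt_nonneg _)
  have hTle : (T : ℝ) ^ 2 ≤ 36 * (x / a) := by
    have h1 : (T : ℝ) ≤ 3 * √X := by rw [hT]; push_cast; linarith
    calc (T : ℝ) ^ 2 ≤ (3 * √X) ^ 2 := by gcongr
      _ = 9 * X := by rw [mul_pow, Real.sq_sqrt hX0.le]; norm_num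
      _ = _ := by rw [hX]; ring
  have hm : ∀ p ∈ Q', ∃ β : GaussianInt, e p = α * β ∧
      ∃ q : ℕ, q.Prime ∧ y < q ∧ (gaussianNormHom β = q ∨ gaussianNormHom β = q ^ 2) := by
    intro p hp
    obtain ⟨-, β, q, h1, h2, h3, h4⟩ := hfac p hp
    exact ⟨β, h4, q, h1, h2, h3⟩
  choose! m hm hmq using hm
  have hminj : Set.InjOn m Q' := fun p hp p' hp' h =>
    hinj (hQ' hp) (hQ' hp') ((hm p hp).trans ((congrArg (α * ·) h).trans (hm p' hp').symm))
  set S : Finset (ℤ × ℤ) := Q'.image fun p => ((m p).re, (m p).im) with hS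
  have hScard : S.card = Q'.card :=
    Finset.card_image_of_injOn fun p hp p' hp' h =>
      hminj hp hp' (Zsqrtd.ext (Prod.ext_iff.1 h).1 (Prod.ext_iff.1 h).2)
  have hcoord : ∀ p ∈ Q', ∀ z : ℤ, z ^ 2 ≤ (m p).norm → z ∈ Finset.Ico (-(U : ℤ)) (-U + T) := by
    intro p hp z hz
    have h1 : (gaussianNormHom (e p) : ℝ) = a * gaussianNormHom (m p) := by
      rw [hm p hp, map_mul]; push_cast; rfl
    have h2 : (gaussianNormHom (m p) : ℝ) ≤ X := by
      rw [hX, le_div_iff₀ ha0]; linarith [(hbound p (hQ' hp)).2]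
    rw [← gaussianNormHom_cast] at hz
    have h3 : (z : ℝ) ^ 2 ≤ gaussianNormHom (m p) := by exact_mod_cast hz
    have h4 : (z.natAbs : ℝ) ≤ √X := by
      rw [Nat.cast_natAbs, Int.cast_abs]
      exact Real.abs_le_sqrt (h3.trans h2)
    have h5 : z.natAbs ≤ U := Nat.le_floor h4
    rw [Finset.mem_Ico]
    omega
  have hb := hbox a (residuePairs (gaussianResidue α)) hα
    (fun q hq hq2 hqa => gaussianResidue_density α q hq hq2 hqa) T (-U) (-U) S ?_ ?_ ?_
  · rw [hScard] at hb
    have hs := zero_le_one.trans (one_le_singularFactor a)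
    calc (Q'.card : ℝ) ≤ _ := hb
      _ ≤ K * (36 * (x / a) * (L ^ 4 / Real.log x ^ 2) * singularFactor a) := by gcongr
      _ = _ := by ring
  -- The norm bound X is at least y, so the side of the square is at least √y; hence the extra 2 in
  -- the side condition of the box estimate.
  · have h1 : Real.exp (Real.log x / (2 * (C * L))) = √y := by
      rw [hy, ← Real.exp_half]; congr 1; rw [div_div, mul_comm]
    rw [h1]
    have h2 : √y ≤ √X := Real.sqrt_le_sqrt hyX
    rw [hT]; push_cast
    linarith [(Nat.cast_nonneg U : (0 : ℝ) ≤ U)]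
  · intro s hs
    obtain ⟨p, hp, rfl⟩ := Finset.mem_image.1 hs
    refine Finset.mem_product.2 ⟨hcoord p hp _ ?_, hcoord p hp _ ?_⟩ <;>
    · rw [GaussianInt.norm_eq_sq_add_sq]
      nlinarith [sq_nonneg (m p).re, sq_nonneg (m p).im]
  · intro s hs r hr _ _ hry hmem
    have : NeZero r := ⟨hr.ne_zero⟩
    rw [mem_residuePairs] at hmem
    obtain ⟨p, hp, rfl⟩ := Finset.mem_image.1 hs
    obtain ⟨q, hq, hyq, hmp⟩ := hmq p hp
    rw [gaussianResidue] at hmem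
    rcases hmem.2 with h | h
    · have h1 : ((gaussianNormHom (m p) : ℕ) : ZMod r) = 0 := by
        rw [← h, ← Int.cast_natCast, gaussianNormHom_cast, GaussianInt.norm_eq_sq_add_sq]
        push_cast; rfl
      rw [ZMod.natCast_eq_zero_iff] at h1
      rw [eq_of_prime_dvd_eq_or_eq_sq hr hq hmp h1] at hry
      linarith
    · have h1 : ((p : ℕ) : ZMod r) = 0 := by
        rw [← h, ← Int.cast_natCast, ← (hQ p (hQ' hp)).2.2.1, hm p hp,
          GaussianInt.norm_eq_sq_add_sq]
        simp only [Zsqrtd.re_add, Zsqrtd.im_add, Zsqrtd.re_one, Zsqrtd.im_one, Zsqrtd.re_mul,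
          Zsqrtd.im_mul]
        push_cast; ring
      rw [ZMod.natCast_eq_zero_iff, Nat.prime_dvd_prime_iff_eq hr (hQ p (hQ' hp)).1] at h1
      have := (hfac p hp).1
      rw [h1] at hry
      linarith

end Application

/-! ### Assembling both residue classes and all x ≥ 3 -/

section Conclusion

open ArithmeticFunction Filter

theorem exists_card_goodPrime_le {γ : ℝ} (hγ : 0 < γ) :
    ∃ K : ℝ, 0 < K ∧ ∀ᶠ x : ℝ in atTop, ∀ Q : Finset ℕ,
      (∀ p ∈ Q, GoodPrime p ∧ (p : ℝ) ≤ x ∧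
        1 ≤ γ ^ ((cardDistinctFactors (numPoints p) : ℝ) - γ * Real.log (Real.log x))) →
      (Q.card : ℝ) ≤ K * (x * Real.log (Real.log x) ^ 4
        / Real.log x ^ (2 + γ * Real.log γ - γ)) := by
  classical
  obtain ⟨K₁, hK₁, h₁⟩ := exists_card_add_one_le hγ
  obtain ⟨K₂, hK₂, h₂⟩ := exists_card_gaussian_le hγ
  refine ⟨K₁ + K₂, by positivity, ?_⟩
  have he : ∀ p : ℕ, ∃ α : GaussianInt, p.Prime → p % 4 = 1 →
      (α + 1).norm = p ∧ gaussianNormHom α = numPoints p := by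
    intro p
    by_cases h : p.Prime ∧ p % 4 = 1
    · obtain ⟨a, b, hab, hn⟩ := numPoints_of_mod_four_eq_one p h.1 h.2
      refine ⟨⟨a - 1, b⟩, fun _ _ => ⟨?_, ?_⟩⟩
      · rw [GaussianInt.norm_eq_sq_add_sq, ← hab]
        simp
      · have h1 := gaussianNormHom_cast ⟨a - 1, b⟩
        rw [GaussianInt.norm_eq_sq_add_sq, ← hn] at h1
        exact_mod_cast h1
    · exact ⟨0, fun h1 h2 => absurd ⟨h1, h2⟩ h⟩
  choose e he using he
  filter_upwards [h₁, h₂] with x h₁ h₂ Q hQ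
  have h3 := h₁ (Q.filter fun p => ¬ p % 4 = 1) fun p hp => by
    obtain ⟨hpQ, hp4⟩ := Finset.mem_filter.1 hp
    obtain ⟨hg, hx, hω⟩ := hQ p hpQ
    obtain ⟨hpp, hp2⟩ := (goodPrime_iff p).1 hg
    have hodd := hpp.eq_two_or_odd
    rw [numPoints_of_mod_four_eq_three p hpp (by omega)] at hω
    exact ⟨hpp, hx, hω⟩
  have h4 := h₂ (Q.filter fun p => p % 4 = 1) e fun p hp => by
    obtain ⟨hpQ, hp4⟩ := Finset.mem_filter.1 hp
    obtain ⟨hg, hx, hω⟩ := hQ p hpQ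
    obtain ⟨h5, h6⟩ := he p hg.1 hp4
    exact ⟨hg.1, hx, h5, h6 ▸ hω⟩
  rw [← Finset.card_filter_add_card_filter_not (s := Q) (fun p => p % 4 = 1)]
  push_cast
  linarith

/-- For large x one has log log x ≥ 1, so the fourth power is below the fifth. On the remaining
compact interval the majorant is continuous and positive, because log log 3 > 0, so its minimum
absorbs the trivial bound x + 1. -/
theorem exists_ncard_le_of_eventually {A : ℝ → Set ℕ} {K E : ℝ}
    (hA : ∀ x, ∀ p ∈ A x, (p : ℝ) ≤ x)
    (h : ∀ᶠ x : ℝ in atTop, ((A x).ncard : ℝ) ≤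
      K * (x * Real.log (Real.log x) ^ 4 / Real.log x ^ E)) :
    ∃ C : ℝ, 0 < C ∧ ∀ x : ℝ, 3 ≤ x →
      ((A x).ncard : ℝ) ≤ C * (x * Real.log (Real.log x) ^ 5 / Real.log x ^ E) := by
  have hone : ∀ x : ℝ, 3 ≤ x → 1 < Real.log x := fun x hx => by
    rw [Real.lt_log_iff_exp_lt (by linarith)]
    exact Real.exp_one_lt_three.trans_le hx
  obtain ⟨x₀, hx₀⟩ := eventually_atTop.1
    (h.and (tendsto_log_log_atTop.eventually_ge_atTop 1))
  have hcont : ContinuousOn (fun x : ℝ => x * Real.log (Real.log x) ^ 5 / Real.log x ^ E)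
      (Set.Icc 3 (max 3 x₀)) := by
    intro x hx
    have h1 : x ≠ 0 := by linarith [hx.1]
    have h2 : Real.log x ≠ 0 := by linarith [hone x hx.1]
    have h3 : Real.log x ^ E ≠ 0 := (Real.rpow_pos_of_pos (by linarith [hone x hx.1]) E).ne'
    refine ContinuousAt.continuousWithinAt ?_
    have h4 := Real.continuousAt_log h1
    exact (continuousAt_id.mul ((h4.log h2).pow 5)).div (h4.rpow_const (Or.inl h2)) h3
  obtain ⟨z, hz, hmin⟩ := isCompact_Icc.exists_isMinOn
    ⟨3, Set.left_mem_Icc.2 (le_max_left 3 x₀)⟩ hcont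
  set B := z * Real.log (Real.log z) ^ 5 / Real.log z ^ E with hB
  have hB0 : 0 < B := by
    have h1 := hone z hz.1
    have h2 := Real.log_pos h1
    have : 0 < z := by linarith [hz.1]
    have : 0 < Real.log z := by linarith
    positivity
  refine ⟨|K| + (max 3 x₀ + 1) / B, by positivity, fun x hx => ?_⟩
  have hl := hone x hx
  have hL := Real.log_pos hl
  have hl0 : 0 < Real.log x := by linarith
  have hx0 : 0 < x := by linarith
  rw [add_mul]
  rcases le_or_gt x (max 3 x₀) with hxx | hxx
  · have h1 : B ≤ x * Real.log (Real.log x) ^ 5 / Real.log x ^ E := hmin ⟨hx, hxx⟩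
    have h2 : A x ⊆ (Finset.range (⌊x⌋₊ + 1) : Finset ℕ) := fun p hp => by
      rw [Finset.mem_coe, Finset.mem_range, Nat.lt_succ_iff]
      exact Nat.le_floor (hA x p hp)
    have h3 : (A x).ncard ≤ ⌊x⌋₊ + 1 := by
      have := Set.ncard_le_ncard h2 (Finset.finite_toSet _)
      rwa [Set.ncard_coe_finset, Finset.card_range] at this
    have h4 : ((A x).ncard : ℝ) ≤ x + 1 := by
      have h5 : ((A x).ncard : ℝ) ≤ ⌊x⌋₊ + 1 := by exact_mod_cast h3
      linarith [Nat.floor_le hx0.le]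
    calc ((A x).ncard : ℝ) ≤ (max 3 x₀ + 1) / B * B := by
          rw [div_mul_cancel₀ _ hB0.ne']; linarith
      _ ≤ (max 3 x₀ + 1) / B * (x * Real.log (Real.log x) ^ 5 / Real.log x ^ E) := by gcongr
      _ ≤ _ := le_add_of_nonneg_left (by positivity)
  · obtain ⟨h1, h2⟩ := hx₀ x ((le_max_right 3 x₀).trans hxx.le)
    have h3 : Real.log (Real.log x) ^ 4 ≤ Real.log (Real.log x) ^ 5 :=
      pow_le_pow_right₀ h2 (by norm_num)
    calc ((A x).ncard : ℝ) ≤ _ := h1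
      _ ≤ |K| * (x * Real.log (Real.log x) ^ 4 / Real.log x ^ E) := by
        gcongr; exact le_abs_self K
      _ ≤ |K| * (x * Real.log (Real.log x) ^ 5 / Real.log x ^ E) := by gcongr
      _ ≤ _ := le_add_of_nonneg_right (by positivity)

/-- The predicate P stands for either tail inequality; only the Rankin weight bound it implies
matters. -/
theorem exists_ncard_goodPrime_le {γ : ℝ} (hγ : 0 < γ) (P : ℝ → ℝ → Prop)
    (hP : ∀ n L, P n L → 1 ≤ γ ^ (n - γ * L)) :
    ∃ C : ℝ, 0 < C ∧ ∀ x : ℝ, 3 ≤ x →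
      (({p : ℕ | GoodPrime p ∧ (p : ℝ) ≤ x ∧
          P (cardDistinctFactors (numPoints p)) (Real.log (Real.log x))}.ncard : ℕ) : ℝ)
        ≤ C * (x * Real.log (Real.log x) ^ 5
            / Real.log x ^ (2 + γ * Real.log γ - γ)) := by
  obtain ⟨K, -, hK⟩ := exists_card_goodPrime_le hγ
  refine exists_ncard_le_of_eventually (K := K) (fun x p hp => hp.2.1) ?_
  filter_upwards [hK] with x hK
  have hfin : {p : ℕ | GoodPrime p ∧ (p : ℝ) ≤ x ∧
      P (cardDistinctFactors (numPoints p)) (Real.log (Real.log x))}.Finite :=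
    (Set.finite_Iic ⌊x⌋₊).subset fun p hp => Nat.le_floor hp.2.1
  rw [Set.ncard_eq_toFinset_card _ hfin]
  refine hK _ fun p hp => ?_
  rw [Set.Finite.mem_toFinset] at hp
  exact ⟨hp.1, hp.2.1, hP _ _ hp.2.2⟩

end Conclusion

theorem theorem3p1 :
    (∀ γ : ℝ, 1 < γ → ∃ C : ℝ, 0 < C ∧ ∀ x : ℝ, 3 ≤ x →
      (({p : ℕ | GoodPrime p ∧ (p : ℝ) ≤ x ∧
          (ArithmeticFunction.cardDistinctFactors (numPoints p) : ℝ)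
            > γ * Real.log (Real.log x)}.ncard : ℕ) : ℝ)
        ≤ C * (x * Real.log (Real.log x) ^ 5
            / Real.log x ^ (2 + γ * Real.log γ - γ))) ∧
    (∀ γ : ℝ, 0 < γ → γ < 1 → ∃ C : ℝ, 0 < C ∧ ∀ x : ℝ, 3 ≤ x →
      (({p : ℕ | GoodPrime p ∧ (p : ℝ) ≤ x ∧
          (ArithmeticFunction.cardDistinctFactors (numPoints p) : ℝ)
            < γ * Real.log (Real.log x)}.ncard : ℕ) : ℝ)
        ≤ C * (x * Real.log (Real.log x) ^ 5
            / Real.log x ^ (2 + γ * Real.log γ - γ))) :=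
  ⟨fun γ hγ => exists_ncard_goodPrime_le (by linarith) (fun n L => n > γ * L)
      fun _ _ h => Real.one_le_rpow hγ.le (sub_nonneg.2 (le_of_lt h)),
    fun γ hγ hγ1 => exists_ncard_goodPrime_le hγ (fun n L => n < γ * L)
      fun _ _ h => Real.one_le_rpow_of_pos_of_le_one_of_nonpos hγ hγ1.le
        (sub_nonpos.2 (le_of_lt h))⟩
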